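/- **Theorem (Qualitative determinacy and polynomial time computability, positive winning).** Let $G=(S,A,\Gamma_1,\Gamma_2,\delta)$ be a concurrent stochastic game structure with finite state space $S$ and finite set $A$ of moves: $\Gamma_i(s)\subseteq A$ is the non-empty set of moves available to player $i\in\{1,2\}$ at $s$, and $\delta(s,a,b)$ is a probability distribution on $S$, for $s\in S$, $a,b\in A$. Let $\mathrm{r}:S\times A\times A\to\{0,1\}$ be a boolean reward function. In every round the two players simultaneously and independently choose available moves $a,b$ at the current state $s$, and the next state is drawn from $\delta(s,a,b)$. Write $\mathrm{Succ}(s,a,b)=\{t\mid \delta(s,a,b)(t)>0\}$. A play is an infinite sequence $\omega=(s_k,a_k,b_k)_{k\ge 0}$ with $a_k\in\Gamma_1(s_k)$, $b_k\in\Gamma_2(s_k)$ and $s_{k+1}\in\mathrm{Succ}(s_k,a_k,b_k)$ for all $k$. A strategy $\sigma_i$ of player $i$ maps every finite sequence of past rounds in $S\times A\times A$ and current state $s$ to a probability distribution on $\Gamma_i(s)$, and $\Pr_s^{\sigma_1,\sigma_2}$ is the resulting probability measure on plays from $s$. Let $\mathsf{LimInfAvg}(\omega)$ and $\mathsf{LimSupAvg}(\omega)$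 be the limit inferior and the limit superior of $\frac1k\sum_{i<k}\mathrm{r}(s_i,a_i,b_i)$ as $k\to\infty$, and for real $\lambda$ let $\mathsf{LimInfAvg}(\lambda)$ and $\overline{\mathsf{LimInfAvg}}(\lambda)$ be the sets of plays $\omega$ with $\mathsf{LimInfAvg}(\omega)\ge\lambda$ and with $\mathsf{LimInfAvg}(\omega)<\lambda$, respectively; $\mathsf{LimSupAvg}(\lambda)$ and $\overline{\mathsf{LimSupAvg}}(\lambda)$ are defined in the same way. For a set $\Phi$ of plays let $$\mathsf{Positive}_1(\Phi)=\{s\mid\exists\sigma_1\,\forall\sigma_2:\ \Pr\nolimits_s^{\sigma_1,\sigma_2}(\Phi)>0\},\qquad \mathsf{Almost}_2(\Phi)=\{s\mid\exists\sigma_2\,\forall\sigma_1:\ \Pr\nolimits_s^{\sigma_1,\sigma_2}(\Phi)=1\}.$$ For $X,Y,Z\subseteq S$ and $s\in S$ let * $\mathrm{Allow}_1(s,X)=\{a\in\Gamma_1(s)\mid\forall b\in\Gamma_2(s):\ \mathrm{Succ}(s,a,b)\subseteq X\}$, * $\mathrm{Bad}_2(s,X,Y)=\{b\in\Gamma_2(s)\mid\exists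 a\in\mathrm{Allow}_1(s,X):\ \mathrm{Succ}(s,a,b)\cap Y\ne\emptyset\}$, * $\mathrm{Good}_1(s,X,Y,Z)=\{a\in\mathrm{Allow}_1(s,X)\mid\forall b\in\Gamma_2(s)\setminus\mathrm{Bad}_2(s,X,Y):\ \mathrm{Succ}(s,a,b)\subseteq Z\text{ and }\mathrm{r}(s,a,b)=1\}$, * $\mathrm{ASP}(X,Y,Z)=\{s\mid\mathrm{Good}_1(s,X,Y,Z)\neq\emptyset\}$, and let $Y^*=\mu Y.\,\nu Z.\,\mathrm{ASP}(S,Y,Z)$ ($\mu$ and $\nu$ denote least and greatest fixpoints). Then: 1. For every such game, $$Y^*=\mathsf{Positive}_1(\mathsf{LimInfAvg}(1))=\mathsf{Positive}_1(\mathsf{LimSupAvg}(1))=\bigcap_{\varepsilon>0}\mathsf{Positive}_1(\mathsf{LimInfAvg}(1-\varepsilon))=\bigcap_{\varepsilon>0}\mathsf{Positive}_1(\mathsf{LimSupAvg}(1-\varepsilon))$$ and $$S\setminus Y^*=\mathsf{Almost}_2(\overline{\mathsf{LimInfAvg}}(1))=\mathsf{Almost}_2(\overline{\mathsf{LimSupAvg}}(1))=\bigcup_{c>0}\mathsf{Almost}_2(\overline{\mathsf{LimInfAvg}}(1-c))=\bigcup_{c>0}\mathsf{Almost}_2(\overline{\mathsf{LimSupAvg}}(1-c)).$$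 2. The set $Y^*$ can be computed in time $O(n\cdot|\delta|)$, where $n=|S|\ge 1$ and $|\delta|=\sum_{s\in S}\sum_{a\in\Gamma_1(s)}\sum_{b\in\Gamma_2(s)}|\mathrm{Succ}(s,a,b)|$: there are a single program of a random access machine (unit-cost addition, truncated subtraction, test for zero, indirect reading and writing, on natural numbers) and a constant $C$ such that, for every such game with $S\neq\emptyset$, and for every numbering of its states and every listing of its available moves and successors, the program, given the list of all transitions with their rewards and successor lists, halts after at most $C\cdot n\cdot|\delta|$ steps and outputs the characteristic function of $Y^*$. -/

import Mathlib

open Set Filter MeasureTheory ProbabilityTheory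

universe u v

/-- A two-player concurrent stochastic game structure with state space `S` and set of moves `A`,
together with a boolean reward function. `Γ₁ s` and `Γ₂ s` are the moves available at `s`. -/
structure ConcurrentGame (S : Type u) (A : Type v) where
  Γ₁ : S → Finset A
  Γ₂ : S → Finset A
  nonempty₁ : ∀ s, (Γ₁ s).Nonempty
  nonempty₂ : ∀ s, (Γ₂ s).Nonempty
  /-- the probabilistic transition function -/
  δ : S → A → A → PMF S
  /-- the reward is 1 for `true` and 0 for `false` -/
  reward : S → A → A → Bool

/-- One round of a play: the current state and the moves chosen by the two players. -/
@[ext]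
structure Round (S : Type u) (A : Type v) where
  state : S
  move₁ : A
  move₂ : A

namespace Round

variable {S : Type u} {A : Type v}

instance : MeasurableSpace (Round S A) := ⊤

instance : DiscreteMeasurableSpace (Round S A) := ⟨fun _ => trivial⟩

instance [Finite S] [Finite A] : Finite (Round S A) :=
  Finite.of_injective (fun r : Round S A => (r.state, r.move₁, r.move₂)) (by
    rintro ⟨s, a, b⟩ ⟨s', a', b'⟩ h
    simpa using h)

end Round

/-- A strategy of a player whose available moves are given by `Γ`: to every finite history (in
chronological order) and current state it assigns a distribution on the available moves. -/
structure Strategy {S : Type u} {A : Type v} (Γ : S → Finset A) where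
  act : List (Round S A) → S → PMF A
  available : ∀ h s, (act h s).support ⊆ (Γ s : Set A)

namespace ConcurrentGame

variable {S : Type u} {A : Type v} (G : ConcurrentGame S A)

/-- The possible successors of `s` under the moves `a`, `b`. -/
def succ (s : S) (a b : A) : Set S := (G.δ s a b).support

/-- The size `|δ|` of the transition relation. -/
noncomputable def transitionSize [Fintype S] : ℕ :=
  ∑ s : S, ∑ a ∈ G.Γ₁ s, ∑ b ∈ G.Γ₂ s, (G.succ s a b).ncard

section Probability

/-- The law of the round played at state `s` after the history `h`: the two players draw their
moves independently. -/
noncomputable def roundLaw (σ₁ : Strategy G.Γ₁) (σ₂ : Strategy G.Γ₂)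
    (h : List (Round S A)) (s : S) : PMF (Round S A) :=
  (σ₁.act h s).bind fun a => (σ₂.act h s).map fun b => ⟨s, a, b⟩

/-- The law of the round following the rounds `h`, the last of which is `r`. -/
noncomputable def nextLaw (σ₁ : Strategy G.Γ₁) (σ₂ : Strategy G.Γ₂)
    (h : List (Round S A)) (r : Round S A) : PMF (Round S A) :=
  (G.δ r.state r.move₁ r.move₂).bind fun t => G.roundLaw σ₁ σ₂ h t

/-- The rounds `0, …, n` as a list in chronological order. -/
def historyList {n : ℕ} (x : (i : Finset.Iic n) → Round S A) : List (Round S A) :=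
  List.ofFn fun i : Fin (n + 1) => x ⟨i, Finset.mem_Iic.2 (Nat.lt_succ_iff.1 i.2)⟩

/-- The transition kernel from the rounds `0, …, n` to round `n + 1`. -/
noncomputable def stepKernel [Finite S] [Finite A] (σ₁ : Strategy G.Γ₁) (σ₂ : Strategy G.Γ₂)
    (n : ℕ) : Kernel ((i : Finset.Iic n) → Round S A) (Round S A) where
  toFun x := (G.nextLaw σ₁ σ₂ (historyList x) (x ⟨n, Finset.mem_Iic.2 le_rfl⟩)).toMeasure
  measurable' := measurable_of_countable _

instance [Finite S] [Finite A] (σ₁ : Strategy G.Γ₁) (σ₂ : Strategy G.Γ₂) (n : ℕ) :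
    IsMarkovKernel (G.stepKernel σ₁ σ₂ n) :=
  ⟨fun _ => PMF.toMeasure.isProbabilityMeasure _⟩

/-- The probability measure on infinite sequences of rounds when the game starts in `s` and the
players use `σ₁` and `σ₂`: the first round is drawn at `s` with empty history, and the
remaining rounds are drawn successively (Ionescu-Tulcea). -/
noncomputable def playMeasure [Finite S] [Finite A] (σ₁ : Strategy G.Γ₁) (σ₂ : Strategy G.Γ₂)
    (s : S) : Measure (ℕ → Round S A) :=
  (G.roundLaw σ₁ σ₂ [] s).toMeasure.bind fun r =>
    Kernel.traj (X := fun _ => Round S A) (G.stepKernel σ₁ σ₂) 0 fun _ => r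

end Probability

section Objectives

/-- The plays (paths) of the game. -/
def plays : Set (ℕ → Round S A) :=
  {ω | ∀ k, (ω k).move₁ ∈ G.Γ₁ (ω k).state ∧ (ω k).move₂ ∈ G.Γ₂ (ω k).state ∧
    (ω (k + 1)).state ∈ G.succ (ω k).state (ω k).move₁ (ω k).move₂}

/-- The average reward of the first `n` rounds. -/
noncomputable def avgReward (ω : ℕ → Round S A) (n : ℕ) : ℝ :=
  (1 / (n : ℝ)) * ∑ i ∈ Finset.range n,
    ((G.reward (ω i).state (ω i).move₁ (ω i).move₂).toNat : ℝ)

/-- The limit-inferior average payoff. -/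
noncomputable def limInf (ω : ℕ → Round S A) : ℝ := liminf (G.avgReward ω) atTop

/-- The limit-superior average payoff. -/
noncomputable def limSup (ω : ℕ → Round S A) : ℝ := limsup (G.avgReward ω) atTop

/-- The objective `LimInfAvg(l)`. -/
def LimInfAvg (l : ℝ) : Set (ℕ → Round S A) := {ω ∈ G.plays | G.limInf ω ≥ l}

/-- The objective `LimSupAvg(l)`. -/
def LimSupAvg (l : ℝ) : Set (ℕ → Round S A) := {ω ∈ G.plays | G.limSup ω ≥ l}

/-- The complementary objective of `LimInfAvg(l)`. -/
def CoLimInfAvg (l : ℝ) : Set (ℕ → Round S A) := {ω ∈ G.plays | G.limInf ω < l}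

/-- The complementary objective of `LimSupAvg(l)`. -/
def CoLimSupAvg (l : ℝ) : Set (ℕ → Round S A) := {ω ∈ G.plays | G.limSup ω < l}

/-- The positive winning set of player 1. -/
def Positive₁ [Finite S] [Finite A] (Φ : Set (ℕ → Round S A)) : Set S :=
  {s | ∃ σ₁ : Strategy G.Γ₁, ∀ σ₂ : Strategy G.Γ₂, 0 < G.playMeasure σ₁ σ₂ s Φ}

/-- The almost-sure winning set of player 2. -/
def Almost₂ [Finite S] [Finite A] (Φ : Set (ℕ → Round S A)) : Set S :=
  {s | ∃ σ₂ : Strategy G.Γ₂, ∀ σ₁ : Strategy G.Γ₁, G.playMeasure σ₁ σ₂ s Φ = 1}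

end Objectives

section Predecessor

/-- The moves of player 1 at `s` that never leave `X`. -/
def Allow₁ (s : S) (X : Set S) : Set A :=
  {a | a ∈ G.Γ₁ s ∧ ∀ b ∈ G.Γ₂ s, G.succ s a b ⊆ X}

/-- The moves of player 2 at `s` for which some allowed move of player 1 reaches `Y` with positive
probability. -/
def Bad₂ (s : S) (X Y : Set S) : Set A :=
  {b | b ∈ G.Γ₂ s ∧ ∃ a ∈ G.Allow₁ s X, (G.succ s a b ∩ Y).Nonempty}

/-- The allowed moves of player 1 at `s` that stay in `Z` with reward 1 against every move of
player 2 that is not bad. -/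
def Good₁ (s : S) (X Y Z : Set S) : Set A :=
  {a | a ∈ G.Allow₁ s X ∧
    ∀ b ∈ (G.Γ₂ s : Set A) \ G.Bad₂ s X Y, G.succ s a b ⊆ Z ∧ G.reward s a b = true}

/-- The allow-stay-progress predecessor operator. -/
def ASP (X Y Z : Set S) : Set S := {s | (G.Good₁ s X Y Z).Nonempty}

theorem ASP_mono (X : Set S) {Y Y' Z Z' : Set S} (hY : Y ⊆ Y') (hZ : Z ⊆ Z') :
    G.ASP X Y Z ⊆ G.ASP X Y' Z' := by
  rintro s ⟨a, ha, h⟩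
  refine ⟨a, ha, fun b hb => ?_⟩
  have hb' : b ∈ (G.Γ₂ s : Set A) \ G.Bad₂ s X Y :=
    ⟨hb.1, fun ⟨h1, c, hc, h2⟩ => hb.2 ⟨h1, c, hc, h2.mono (inter_subset_inter_right _ hY)⟩⟩
  exact ⟨(h b hb').1.trans hZ, (h b hb').2⟩

/-- The monotone operator `Z ↦ ASP(X, Y, Z)`. -/
def ASPHom (X Y : Set S) : Set S →o Set S where
  toFun Z := G.ASP X Y Z
  monotone' _ _ h := G.ASP_mono X Subset.rfl h

/-- The monotone operator `Y ↦ νZ. ASP(X, Y, Z)`. -/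
def nuASP (X : Set S) : Set S →o Set S where
  toFun Y := OrderHom.gfp (G.ASPHom X Y)
  monotone' _ _ h := OrderHom.gfp.monotone fun _ => G.ASP_mono X h Subset.rfl

/-- The set `Y* = μY. νZ. ASP(S, Y, Z)`. -/
def YStar : Set S := OrderHom.lfp (G.nuASP univ)

end Predecessor

/-- A listing of a finite game by which it can be presented to a machine: a numbering of the
states, and for every state a list (in any order, without repetition) of the available moves of
each player and of the successors. -/
structure Listing [Fintype S] where
  num : S ≃ Fin (Fintype.card S)
  moves₁ : S → List A
  moves₂ : S → List A
  succs : S → A → A → List S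
  nodup₁ : ∀ s, (moves₁ s).Nodup
  nodup₂ : ∀ s, (moves₂ s).Nodup
  nodup_succs : ∀ s a b, (succs s a b).Nodup
  mem₁ : ∀ s a, a ∈ moves₁ s ↔ a ∈ G.Γ₁ s
  mem₂ : ∀ s b, b ∈ moves₂ s ↔ b ∈ G.Γ₂ s
  mem_succs : ∀ s a b t, t ∈ succs s a b ↔ t ∈ G.succ s a b

namespace Listing

variable {G} [Fintype S] (L : G.Listing)

/-- The record of one transition: reward, number of successors, successors. -/
def transitionCode (s : S) (a b : A) : List ℕ :=
  (G.reward s a b).toNat :: (L.succs s a b).length :: (L.succs s a b).map fun t => (L.num t : ℕ)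

/-- The record of one state: the numbers of moves of the two players, then the records of all
transitions. -/
def stateCode (s : S) : List ℕ :=
  (L.moves₁ s).length :: (L.moves₂ s).length ::
    (L.moves₁ s).flatMap fun a => (L.moves₂ s).flatMap fun b => L.transitionCode s a b

/-- The game written as a list of natural numbers: the number of states, then the records of all
states in the order of their numbers. -/
def code : List ℕ :=
  Fintype.card S ::
    (List.finRange (Fintype.card S)).flatMap fun i => L.stateCode (L.num.symm i)

end Listing

end ConcurrentGame

/-! A random access machine with unit costs, programmed in structured form. -/

namespace RAM

/-- The memory: arrays of natural numbers; `m x i` is the content of cell `i` of array `x`. A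
program addresses only the finitely many arrays named in it. -/
abbrev Memory := ℕ → ℕ → ℕ

/-- Arithmetical expressions: constants, indirect reading, addition and truncated subtraction. -/
inductive Exp where
  | lit (k : ℕ)
  | read (x : ℕ) (e : Exp)
  | add (e₁ e₂ : Exp)
  | sub (e₁ e₂ : Exp)

/-- The value of an expression. -/
def Exp.val (m : Memory) : Exp → ℕ
  | .lit k => k
  | .read x e => m x (e.val m)
  | .add e₁ e₂ => e₁.val m + e₂.val m
  | .sub e₁ e₂ => e₁.val m - e₂.val m

/-- The number of elementary operations in the evaluation of an expression. -/
def Exp.cost : Exp → ℕ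
  | .lit _ => 1
  | .read _ e => e.cost + 1
  | .add e₁ e₂ => e₁.cost + e₂.cost + 1
  | .sub e₁ e₂ => e₁.cost + e₂.cost + 1

/-- Programs. `write x i e` stores the value of `e` in cell `i` of array `x`; a test succeeds when
the value of the expression is not zero. -/
inductive Program where
  | skip
  | write (x : ℕ) (i e : Exp)
  | seq (p q : Program)
  | ite (e : Exp) (p q : Program)
  | loop (e : Exp) (p : Program)

/-- The memory after storing `k` in cell `i` of array `x`. -/
def Memory.store (m : Memory) (x i k : ℕ) : Memory :=
  Function.update m x (Function.update (m x) i k)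

/-- `Runs p m t m'`: started with memory `m`, the program `p` halts after exactly `t` elementary
steps, with memory `m'`. -/
inductive Runs : Program → Memory → ℕ → Memory → Prop
  | skip (m : Memory) : Runs .skip m 1 m
  | write (x : ℕ) (i e : Exp) (m : Memory) :
      Runs (.write x i e) m (i.cost + e.cost + 1) (m.store x (i.val m) (e.val m))
  | seq {p q : Program} {m m' m'' : Memory} {t t' : ℕ} :
      Runs p m t m' → Runs q m' t' m'' → Runs (.seq p q) m (t + t') m''
  | iteTrue {e : Exp} {p q : Program} {m m' : Memory} {t : ℕ} :
      e.val m ≠ 0 → Runs p m t m' → Runs (.ite e p q) m (e.cost + t + 1) m'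
  | iteFalse {e : Exp} {p q : Program} {m m' : Memory} {t : ℕ} :
      e.val m = 0 → Runs q m t m' → Runs (.ite e p q) m (e.cost + t + 1) m'
  | loopTrue {e : Exp} {p : Program} {m m' m'' : Memory} {t t' : ℕ} :
      e.val m ≠ 0 → Runs p m t m' → Runs (.loop e p) m' t' m'' →
      Runs (.loop e p) m (e.cost + t + t' + 1) m''
  | loopFalse {e : Exp} {p : Program} {m : Memory} :
      e.val m = 0 → Runs (.loop e p) m (e.cost + 1) m

/-- The initial memory: the input word in array 0, and zeros elsewhere. -/
def init (w : List ℕ) : Memory := fun x i => if x = 0 then w.getD i 0 else 0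

end RAM

/-- On the input `L.code` the program halts within `T` steps, and then array 1 holds the
characteristic function of the set `U` of states. -/
def ComputesWithin {S : Type u} {A : Type v} [Fintype S] {G : ConcurrentGame S A}
    (p : RAM.Program) (L : G.Listing) (U : Set S) (T : ℕ) : Prop :=
  ∃ t m, RAM.Runs p (RAM.init L.code) t m ∧ t ≤ T ∧
    ∀ s : S, (s ∈ U → m 1 (L.num s) = 1) ∧ (s ∉ U → m 1 (L.num s) = 0)

/-! Part 1 rests on two explicit strategies. With X = S every available move of player 1 is allowed,
and Y* satisfies Y* = ASP(S, Y*, Y*).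

Outside Y*, player 2 plays uniformly all moves that are not bad for Y*, so the play never enters Y*.
The decreasing iteration of νZ. ASP(S, Y*, Z) removes every state outside Y* at some stage, its
rank; against each move of player 1 some non-bad move gives reward 0 or has a successor of smaller
rank (`exists_rank`). With the potential g = 1 - q^rank / 2 for a small q, the product of
(1/2)^(number of rounds without reward) and g loses a fixed factor ρ < 1 in expectation in every
round (`exists_potential`, `lintegral_zeros_le`). A summability argument then shows that almost
surely the rounds without reward have positive lower density, so the limit superior stays below 1 -
c, with c depending on ρ only (`exists_ae_limSup_le`).

Inside Y*, let Y_i be the approximations from below. At a state of Y_(i+1) outside Y_i, player 1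
plays a good move up to an error of 2^-(k+2) after k rounds, and gives every available move positive
probability. If Y_i is reached with positive probability, induction on i applies. Otherwise player 2
almost surely never plays a bad move, because every move of player 1 might have been drawn against
it (`ae_move₂_notMem_Bad₂`). Given a visit to Y_(i+1), with conditional probability at least 1/2
player 1 never deviates afterwards; the play then stays in Y_(i+1) with reward 1 for ever
(`measure_EventuallyRewarded_pos`). All eight equalities follow, since each objective lies between
"from some round on all rewards are 1" and "limit superior at least 1 - c", or is complementary to
such a set.

For part 2, the least fixpoint on n states needs at most n outer iterations, so it suffices to
compute each inner greatest fixpoint in time O(n + E), where E is the number of edges. A missing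
reward is encoded as an edge to an additional state n that is removed from the start; goodness of a
move then only says that its edges in non-bad columns stay in Z. A worklist removes states
backwards: each removed state kills the moves with a non-bad edge into it, and a state without live
moves is removed in turn. Each edge is handled once, when its target leaves the queue (`does_kill`,
`does_killQueue`). Finally `step_numbers` identifies the computed operator with Y ↦ νZ. ASP(S, Y,
Z). -/

namespace ConcurrentGame

/-! ### One-step conditioning for the play measure -/

variable {S : Type u} {A : Type v} (G : ConcurrentGame S A)

/-- The first `k` rounds of a play. -/
def pref (k : ℕ) (ω : ℕ → Round S A) : List (Round S A) := List.ofFn fun i : Fin k => ω i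

theorem pref_succ (k : ℕ) (ω : ℕ → Round S A) : pref (k + 1) ω = pref k ω ++ [ω k] := by
  simp only [pref, List.ofFn_succ_last]
  rfl

@[simp] theorem length_pref (k : ℕ) (ω : ℕ → Round S A) : (pref k ω).length = k := by
  simp [pref]

theorem measurable_pref [Finite S] [Finite A] {β : Type*} [MeasurableSpace β] (k : ℕ)
    (F : List (Round S A) → β) : Measurable fun ω : ℕ → Round S A => F (pref k ω) := by
  have h : Measurable fun x : Fin k → Round S A => F (List.ofFn x) := measurable_of_countable _
  exact h.comp (measurable_pi_lambda _ fun i => measurable_pi_apply _)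

/-- The law of the state that follows the rounds `h` of a play from `s`. -/
noncomputable def stateLaw (s : S) (h : List (Round S A)) : PMF S :=
  match h.getLast? with
  | none => PMF.pure s
  | some r => G.δ r.state r.move₁ r.move₂

/-- The law of the round that follows the rounds `h` of a play from `s`. -/
noncomputable def law (σ₁ : Strategy G.Γ₁) (σ₂ : Strategy G.Γ₂) (s : S)
    (h : List (Round S A)) : PMF (Round S A) :=
  (G.stateLaw s h).bind (G.roundLaw σ₁ σ₂ h)

@[simp] theorem stateLaw_nil (s : S) : G.stateLaw s [] = PMF.pure s := rfl

@[simp] theorem stateLaw_append (s : S) (h : List (Round S A)) (r : Round S A) :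
    G.stateLaw s (h ++ [r]) = G.δ r.state r.move₁ r.move₂ := by
  simp [stateLaw]

@[simp] theorem law_nil (σ₁ : Strategy G.Γ₁) (σ₂ : Strategy G.Γ₂) (s : S) :
    G.law σ₁ σ₂ s [] = G.roundLaw σ₁ σ₂ [] s := by
  simp [law]

theorem law_append (σ₁ : Strategy G.Γ₁) (σ₂ : Strategy G.Γ₂) (s : S)
    (h : List (Round S A)) (r : Round S A) :
    G.law σ₁ σ₂ s (h ++ [r]) = G.nextLaw σ₁ σ₂ (h ++ [r]) r := by
  simp [law, nextLaw]

variable [Finite S] [Finite A] (σ₁ : Strategy G.Γ₁) (σ₂ : Strategy G.Γ₂) (s : S)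

instance : IsProbabilityMeasure (G.playMeasure σ₁ σ₂ s) := by
  have h1 : IsProbabilityMeasure (G.roundLaw σ₁ σ₂ [] s).toMeasure :=
    PMF.toMeasure.isProbabilityMeasure _
  refine ⟨?_⟩
  rw [playMeasure, Measure.bind_apply MeasurableSet.univ (measurable_of_countable _).aemeasurable]
  simp

theorem lintegral_playMeasure {f : (ℕ → Round S A) → ENNReal} (hf : Measurable f) :
    ∫⁻ ω, f ω ∂G.playMeasure σ₁ σ₂ s = ∫⁻ r, ∫⁻ ω, f ω
      ∂Kernel.traj (X := fun _ => Round S A) (G.stepKernel σ₁ σ₂) 0 (fun _ => r)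
      ∂(G.roundLaw σ₁ σ₂ [] s).toMeasure := by
  rw [playMeasure, Measure.lintegral_bind (measurable_of_countable _).aemeasurable hf.aemeasurable]

theorem lintegral_toMeasure_eq (p : PMF (Round S A)) (f : Round S A → ENNReal) :
    ∫⁻ r, f r ∂p.toMeasure = ∑' r, p r * f r := by
  rw [lintegral_countable']
  refine tsum_congr fun r => ?_
  rw [PMF.toMeasure_apply_singleton _ _ (measurableSet_singleton _), mul_comm]

/-- Both integrands depend on finitely many rounds, so they are integrated against finite marginals,
and the marginal up to round k + 1 is the one up to round k followed by the step kernel.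
Measurability is automatic because the spaces of finite histories are countable. -/
theorem lintegral_traj_step (r₀ : Round S A) (k : ℕ)
    (F : List (Round S A) → Round S A → ENNReal) :
    ∫⁻ ω, F (pref (k + 1) ω) (ω (k + 1))
      ∂Kernel.traj (X := fun _ => Round S A) (G.stepKernel σ₁ σ₂) 0 (fun _ => r₀) =
    ∫⁻ ω, ∑' r, G.law σ₁ σ₂ s (pref (k + 1) ω) r * F (pref (k + 1) ω) r
      ∂Kernel.traj (X := fun _ => Round S A) (G.stepKernel σ₁ σ₂) 0 (fun _ => r₀) := by
  set κ := G.stepKernel σ₁ σ₂ with hκ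
  have key : ∀ (j : ℕ) (f : ((i : Finset.Iic j) → Round S A) → ENNReal),
      ∫⁻ ω, f (Preorder.frestrictLe j ω) ∂Kernel.traj (X := fun _ => Round S A) κ 0 (fun _ => r₀) =
        ∫⁻ x, f x ∂Kernel.partialTraj (X := fun _ => Round S A) κ 0 j (fun _ => r₀) := by
    intro j f
    rw [← Kernel.traj_map_frestrictLe_apply, lintegral_map (measurable_of_countable _)
      (by fun_prop)]
  have h1 := key (k + 1) fun x =>
    F (historyList fun i : Finset.Iic k => x ⟨i, Finset.mem_Iic.2
      ((Finset.mem_Iic.1 i.2).trans k.le_succ)⟩) (x ⟨k + 1, Finset.mem_Iic.2 le_rfl⟩)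
  have h2 := key k fun x => ∑' r, G.nextLaw σ₁ σ₂ (historyList x) (x ⟨k, Finset.mem_Iic.2 le_rfl⟩) r
    * F (historyList x) r
  have e1 : ∀ ω : ℕ → Round S A, G.law σ₁ σ₂ s (pref (k + 1) ω) =
      G.nextLaw σ₁ σ₂ (pref (k + 1) ω) (ω k) := by
    intro ω
    rw [pref_succ, law_append]
  simp only [e1]
  refine h1.trans (Eq.trans ?_ h2.symm)
  rw [Kernel.partialTraj_succ_eq_comp (Nat.zero_le k), Kernel.comp_apply,
    Measure.lintegral_bind (Kernel.aemeasurable _) (measurable_of_countable _).aemeasurable]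
  refine lintegral_congr fun x => ?_
  rw [Kernel.partialTraj_succ_self, Kernel.map_apply _ (by fun_prop),
    lintegral_map (measurable_of_countable _) (by fun_prop), Kernel.prod_apply,
    lintegral_prod _ (measurable_of_countable _).aemeasurable, Kernel.id_apply,
    lintegral_dirac' _ (measurable_of_countable _), Kernel.map_apply _ (by fun_prop),
    lintegral_map (measurable_of_countable _) (by fun_prop), ← lintegral_toMeasure_eq]
  refine lintegral_congr fun r => ?_
  -- Appending a round to a history and then forgetting it gives back the history.
  have e2 : (fun i : Finset.Iic k => IicProdIoc (X := fun _ => Round S A) k (k + 1)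
      (x, MeasurableEquiv.piSingleton (X := fun _ => Round S A) k r) ⟨i, Finset.mem_Iic.2
      ((Finset.mem_Iic.1 i.2).trans k.le_succ)⟩) = x := by
    funext i
    simp [IicProdIoc, Finset.mem_Iic.1 i.2]
  rw [e2]
  congr 1
  simp [IicProdIoc, MeasurableEquiv.piSingleton]

/-- Conditioning a function of the first rounds on the rounds before the last one. -/
theorem lintegral_step (k : ℕ) (F : List (Round S A) → Round S A → ENNReal) :
    ∫⁻ ω, F (pref k ω) (ω k) ∂G.playMeasure σ₁ σ₂ s =
    ∫⁻ ω, ∑' r, G.law σ₁ σ₂ s (pref k ω) r * F (pref k ω) r ∂G.playMeasure σ₁ σ₂ s := by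
  have hm : ∀ k, Measurable fun ω : ℕ → Round S A => F (pref k ω) (ω k) := by
    intro k
    -- The value 0 at the empty list is irrelevant: a prefix of length k + 1 has a last round.
    have := measurable_pref (k + 1) fun l : List (Round S A) =>
      match l.getLast? with | none => 0 | some r => F l.dropLast r
    simpa [pref_succ] using this
  rw [lintegral_playMeasure _ _ _ _ (hm k), lintegral_playMeasure _ _ _ _ (measurable_pref k
    fun l => ∑' r, G.law σ₁ σ₂ s l r * F l r)]
  cases k with
  | succ k => exact lintegral_congr fun r => G.lintegral_traj_step σ₁ σ₂ s r k F
  -- Round 0 is not drawn by a step kernel but by the outer law in the definition of the play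
  -- measure.
  | zero =>
    have e : ∀ r : Round S A, ∫⁻ ω, F (pref 0 ω) (ω 0)
        ∂Kernel.traj (X := fun _ => Round S A) (G.stepKernel σ₁ σ₂) 0 (fun _ => r) = F [] r := by
      intro r
      have h0 : ∀ ω : ℕ → Round S A, F (pref 0 ω) (ω 0) =
          F [] (Preorder.frestrictLe (π := fun _ => Round S A) 0 ω
            ⟨0, Finset.mem_Iic.2 le_rfl⟩) := fun ω => rfl
      simp only [h0]
      rw [← lintegral_map (f := fun x : (i : Finset.Iic 0) → Round S A =>
        F [] (x ⟨0, Finset.mem_Iic.2 le_rfl⟩)) (measurable_of_countable _) (by fun_prop),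
        Kernel.traj_map_frestrictLe_apply, Kernel.partialTraj_self, Kernel.id_apply,
        lintegral_dirac' _ (measurable_of_countable _)]
    simp only [e, lintegral_toMeasure_eq]
    have : ∀ ω : ℕ → Round S A, pref 0 ω = [] := fun ω => rfl
    have h1 : IsProbabilityMeasure (G.roundLaw σ₁ σ₂ [] s).toMeasure :=
      PMF.toMeasure.isProbabilityMeasure _
    simp [this, ENNReal.tsum_mul_right]

end ConcurrentGame

/-! ### Means with respect to discrete distributions -/

/-- The mean of a function with respect to a discrete distribution. -/
noncomputable def PMF.mean {α : Type*} (p : PMF α) (f : α → ENNReal) : ENNReal := ∑' x, p x * f x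

namespace PMF

variable {α β : Type*} (p : PMF α)

theorem mean_pure (x : α) (f : α → ENNReal) : (PMF.pure x).mean f = f x := by
  rw [mean, tsum_eq_single x]
  · simp
  · intro y hy
    simp [hy]

theorem mean_bind (g : α → PMF β) (f : β → ENNReal) :
    (p.bind g).mean f = p.mean fun x => (g x).mean f := by
  simp only [mean, bind_apply, ← ENNReal.tsum_mul_right, ← ENNReal.tsum_mul_left]
  rw [ENNReal.tsum_comm]
  simp only [mul_assoc]

theorem mean_map (g : α → β) (f : β → ENNReal) : (p.map g).mean f = p.mean fun x => f (g x) := by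
  rw [← bind_pure_comp, mean_bind]
  simp [mean_pure]

theorem mean_const (c : ENNReal) : (p.mean fun _ => c) = c := by
  simp [mean, ENNReal.tsum_mul_right]

theorem mean_mono {f g : α → ENNReal} (h : ∀ x ∈ p.support, f x ≤ g x) : p.mean f ≤ p.mean g := by
  refine ENNReal.tsum_le_tsum fun x => ?_
  by_cases hx : p x = 0
  · simp [hx]
  · gcongr
    exact h x ((p.mem_support_iff x).2 hx)

theorem mean_mul_left (c : ENNReal) (f : α → ENNReal) :
    (p.mean fun x => c * f x) = c * p.mean f := by
  simp only [mean, ← ENNReal.tsum_mul_left]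
  exact tsum_congr fun x => by ring

theorem mean_add (f g : α → ENNReal) : (p.mean fun x => f x + g x) = p.mean f + p.mean g := by
  simp only [mean, mul_add]
  exact ENNReal.tsum_add

theorem mul_le_mean (f : α → ENNReal) (x : α) : p x * f x ≤ p.mean f :=
  ENNReal.le_tsum x

/-- A function bounded by 1 that is smaller at one point has a smaller mean. -/
theorem mean_add_le {f : α → ENNReal} (hf : ∀ x ∈ p.support, f x ≤ 1) {x₀ : α} {w d : ENNReal}
    (hw : w ≤ p x₀) (hd : f x₀ + d ≤ 1) : p.mean f + w * d ≤ 1 := by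
  classical
  calc p.mean f + w * d ≤ p.mean f + p.mean (fun x => if x = x₀ then d else 0) := by
        gcongr
        have h : w * d ≤ p x₀ * d := by gcongr
        exact h.trans (le_trans (by simp) (p.mul_le_mean _ x₀))
    _ = p.mean (fun x => f x + if x = x₀ then d else 0) := (p.mean_add _ _).symm
    _ ≤ p.mean (fun _ => 1) := by
        refine p.mean_mono fun x hx => ?_
        split_ifs with h
        · subst h; exact hd
        · simpa using hf x hx
    _ = 1 := p.mean_const 1

end PMF

/-! ### Laws of single rounds and almost sure properties of plays -/

namespace ConcurrentGame

variable {S : Type u} {A : Type v} (G : ConcurrentGame S A)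

theorem mean_roundLaw (σ₁ : Strategy G.Γ₁) (σ₂ : Strategy G.Γ₂) (h : List (Round S A)) (t : S)
    (f : Round S A → ENNReal) : (G.roundLaw σ₁ σ₂ h t).mean f =
      (σ₁.act h t).mean fun a => (σ₂.act h t).mean fun b => f ⟨t, a, b⟩ := by
  simp only [roundLaw, PMF.mean_bind, PMF.mean_map]

theorem mem_support_roundLaw (σ₁ : Strategy G.Γ₁) (σ₂ : Strategy G.Γ₂) (h : List (Round S A))
    (t : S) (r : Round S A) : r ∈ (G.roundLaw σ₁ σ₂ h t).support ↔ r.state = t ∧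
      r.move₁ ∈ (σ₁.act h t).support ∧ r.move₂ ∈ (σ₂.act h t).support := by
  simp only [roundLaw, PMF.mem_support_bind_iff, PMF.mem_support_map_iff]
  constructor
  · rintro ⟨a, ha, b, hb, rfl⟩
    exact ⟨rfl, ha, hb⟩
  · rintro ⟨rfl, ha, hb⟩
    exact ⟨_, ha, _, hb, rfl⟩

theorem mem_support_law (σ₁ : Strategy G.Γ₁) (σ₂ : Strategy G.Γ₂) (s : S) (h : List (Round S A))
    (r : Round S A) : r ∈ (G.law σ₁ σ₂ s h).support ↔ r.state ∈ (G.stateLaw s h).support ∧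
      r.move₁ ∈ (σ₁.act h r.state).support ∧ r.move₂ ∈ (σ₂.act h r.state).support := by
  simp only [law, PMF.mem_support_bind_iff, mem_support_roundLaw]
  constructor
  · rintro ⟨t, ht, rfl, h⟩
    exact ⟨ht, h⟩
  · rintro ⟨ht, h⟩
    exact ⟨_, ht, rfl, h⟩

variable [Finite S] [Finite A] (σ₁ : Strategy G.Γ₁) (σ₂ : Strategy G.Γ₂) (s : S)

theorem lintegral_round (k : ℕ) (F : List (Round S A) → Round S A → ENNReal) :
    ∫⁻ ω, F (pref k ω) (ω k) ∂G.playMeasure σ₁ σ₂ s =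
    ∫⁻ ω, (G.law σ₁ σ₂ s (pref k ω)).mean (F (pref k ω)) ∂G.playMeasure σ₁ σ₂ s :=
  G.lintegral_step σ₁ σ₂ s k F

theorem measurable_pref_round {β : Type*} [MeasurableSpace β] (k : ℕ)
    (F : List (Round S A) → Round S A → β) :
    Measurable fun ω : ℕ → Round S A => F (pref k ω) (ω k) := by
  have h : Measurable fun x : (Fin k → Round S A) × Round S A => F (List.ofFn x.1) x.2 :=
    measurable_of_countable _
  have h' : Measurable fun ω : ℕ → Round S A => ((fun i : Fin k => ω i), ω k) := by fun_prop
  exact h.comp h'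

/-- The indicator of leaving the support has conditional mean 0 in each round, and there are
countably many rounds. -/
theorem ae_mem_support_law :
    ∀ᵐ ω ∂G.playMeasure σ₁ σ₂ s, ∀ k, ω k ∈ (G.law σ₁ σ₂ s (pref k ω)).support := by
  classical
  refine ae_all_iff.2 fun k => ?_
  have h := G.lintegral_round σ₁ σ₂ s k
    fun h r => if r ∈ (G.law σ₁ σ₂ s h).support then 0 else 1
  have h0 : ∀ l : List (Round S A), ((G.law σ₁ σ₂ s l).mean
      fun r => if r ∈ (G.law σ₁ σ₂ s l).support then 0 else 1) = 0 := by
    intro l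
    refine le_antisymm ?_ (zero_le)
    refine (PMF.mean_mono _ (g := fun _ => 0) fun x hx => by simp [hx]).trans ?_
    rw [PMF.mean_const]
  simp only [h0, lintegral_zero] at h
  rw [lintegral_eq_zero_iff (measurable_pref_round k
    fun h r => if r ∈ (G.law σ₁ σ₂ s h).support then (0 : ENNReal) else 1)] at h
  filter_upwards [h] with ω hω
  by_contra hn
  simp [hn] at hω

theorem ae_mem_plays : ∀ᵐ ω ∂G.playMeasure σ₁ σ₂ s, ω ∈ G.plays := by
  filter_upwards [G.ae_mem_support_law σ₁ σ₂ s] with ω hω k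
  have h1 := (G.mem_support_law _ _ _ _ _).1 (hω k)
  have h2 := ((G.mem_support_law _ _ _ _ _).1 (hω (k + 1))).1
  rw [pref_succ, stateLaw_append] at h2
  exact ⟨σ₁.available _ _ h1.2.1, σ₂.available _ _ h1.2.2, h2⟩

end ConcurrentGame

/-! ### Counting the rounds without reward -/

namespace ConcurrentGame

variable {S : Type u} {A : Type v} (G : ConcurrentGame S A)

/-- The number of rounds without reward. -/
def zeros (h : List (Round S A)) : ℕ :=
  h.countP fun r => !G.reward r.state r.move₁ r.move₂

theorem sum_reward_add_zeros (ω : ℕ → Round S A) (k : ℕ) :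
    (∑ i ∈ Finset.range k, ((G.reward (ω i).state (ω i).move₁ (ω i).move₂).toNat : ℝ)) +
      G.zeros (pref k ω) = k := by
  induction k with
  | zero => simp [zeros, pref]
  | succ k ih =>
    rw [Finset.sum_range_succ, pref_succ, zeros, List.countP_append, ← zeros]
    cases h : G.reward (ω k).state (ω k).move₁ (ω k).move₂ <;> simp [h] <;> linarith

theorem avgReward_nonneg (ω : ℕ → Round S A) (k : ℕ) : 0 ≤ G.avgReward ω k := by
  unfold avgReward; positivity

theorem avgReward_le_one (ω : ℕ → Round S A) (k : ℕ) : G.avgReward ω k ≤ 1 := by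
  have h := G.sum_reward_add_zeros ω k
  have h0 : (0 : ℝ) ≤ G.zeros (pref k ω) := by positivity
  rw [avgReward, one_div, inv_mul_eq_div]
  exact div_le_one_of_le₀ (by linarith) (by positivity)

theorem isBoundedUnder_le_avgReward (ω : ℕ → Round S A) :
    IsBoundedUnder (· ≤ ·) atTop (G.avgReward ω) :=
  isBoundedUnder_of ⟨1, G.avgReward_le_one ω⟩

theorem isBoundedUnder_ge_avgReward (ω : ℕ → Round S A) :
    IsBoundedUnder (· ≥ ·) atTop (G.avgReward ω) :=
  isBoundedUnder_of ⟨0, G.avgReward_nonneg ω⟩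

theorem limInf_le_limSup (ω : ℕ → Round S A) : G.limInf ω ≤ G.limSup ω :=
  liminf_le_limsup (G.isBoundedUnder_le_avgReward ω) (G.isBoundedUnder_ge_avgReward ω)

/-- Taking logarithms, the hypothesis says that the first k rounds contain at least -k log ρ / log 2
rounds without reward. -/
theorem limSup_le_of_zeros {ω : ℕ → Round S A} {ρ : ℝ}
    (h : ∀ᶠ k in atTop, (1 / 2 : ℝ) ^ G.zeros (pref k ω) ≤ ρ ^ k) :
    G.limSup ω ≤ 1 + Real.log ρ / Real.log 2 := by
  refine limsup_le_of_le (G.isBoundedUnder_ge_avgReward ω).isCoboundedUnder_le ?_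
  filter_upwards [h, eventually_gt_atTop 0] with k hk hk0
  have h1 := Real.log_le_log (by positivity) hk
  rw [Real.log_pow, Real.log_pow, one_div, Real.log_inv] at h1
  have h2 : 0 < Real.log 2 := Real.log_pos (by norm_num)
  have h3 := G.sum_reward_add_zeros ω k
  have h4 : (0 : ℝ) < k := by exact_mod_cast hk0
  rw [avgReward, one_div, inv_mul_eq_div, div_le_iff₀ h4, eq_sub_of_add_eq h3]
  have h5 : -(G.zeros (pref k ω) : ℝ) ≤ k * (Real.log ρ / Real.log 2) := by
    rw [← mul_div_assoc, le_div_iff₀ h2]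
    linarith
  linarith

variable [Finite S] [Finite A]

/-- A supermartingale bound on the number of rounds without reward. -/
theorem lintegral_zeros_le (σ₁ : Strategy G.Γ₁) (σ₂ : Strategy G.Γ₂) (s : S) (g : S → ENNReal)
    (ρ : ENNReal) (hg : ∀ t, 1 / 2 ≤ g t) (hs : g s ≤ 1)
    (hstep : ∀ h t, (G.roundLaw σ₁ σ₂ h t).mean (fun r =>
      (if G.reward r.state r.move₁ r.move₂ then 1 else 1 / 2) *
        (G.δ r.state r.move₁ r.move₂).mean g) ≤ ρ * g t) (k : ℕ) :
    ∫⁻ ω, (1 / 2) ^ G.zeros (pref k ω) ∂G.playMeasure σ₁ σ₂ s ≤ 2 * ρ ^ k := by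
  -- The supermartingale is the discount for the zeros so far times the mean of `g` at the state
  -- about to be visited.
  have key : ∫⁻ ω, (1 / 2) ^ G.zeros (pref k ω) * (G.stateLaw s (pref k ω)).mean g
      ∂G.playMeasure σ₁ σ₂ s ≤ ρ ^ k := by
    induction k with
    | zero =>
      have : ∀ ω : ℕ → Round S A, pref 0 ω = [] := fun ω => rfl
      simpa [this, zeros, PMF.mean_pure] using hs
    | succ k ih =>
      have h1 : ∀ ω : ℕ → Round S A, ((1 / 2 : ENNReal)) ^ G.zeros (pref (k + 1) ω) *
          (G.stateLaw s (pref (k + 1) ω)).mean g = (1 / 2) ^ G.zeros (pref k ω) *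
          ((if G.reward (ω k).state (ω k).move₁ (ω k).move₂ then 1 else 1 / 2) *
          (G.δ (ω k).state (ω k).move₁ (ω k).move₂).mean g) := by
        intro ω
        rw [pref_succ, stateLaw_append, zeros, List.countP_append, ← zeros, pow_add, mul_assoc]
        congr 2
        cases h : G.reward (ω k).state (ω k).move₁ (ω k).move₂ <;> simp [h]
      simp only [h1]
      rw [G.lintegral_round σ₁ σ₂ s k fun h r => (1 / 2) ^ G.zeros h *
          ((if G.reward r.state r.move₁ r.move₂ then 1 else 1 / 2) *
          (G.δ r.state r.move₁ r.move₂).mean g)]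
      calc _ ≤ ∫⁻ ω, ρ * ((1 / 2) ^ G.zeros (pref k ω) * (G.stateLaw s (pref k ω)).mean g)
            ∂G.playMeasure σ₁ σ₂ s := by
            refine lintegral_mono fun ω => ?_
            rw [PMF.mean_mul_left, law, PMF.mean_bind, mul_left_comm]
            gcongr
            exact (PMF.mean_mono _ fun t _ => hstep _ t).trans_eq (PMF.mean_mul_left _ _ _)
        _ ≤ ρ ^ (k + 1) := by
            rw [lintegral_const_mul _ (measurable_pref k fun l => (1 / 2) ^ G.zeros l *
              (G.stateLaw s l).mean g), pow_succ']
            gcongr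
  -- The factor 2 compensates for the potential, which is at least 1/2.
  calc ∫⁻ ω, (1 / 2) ^ G.zeros (pref k ω) ∂G.playMeasure σ₁ σ₂ s
      ≤ ∫⁻ ω, 2 * ((1 / 2) ^ G.zeros (pref k ω) * (G.stateLaw s (pref k ω)).mean g)
          ∂G.playMeasure σ₁ σ₂ s := by
        refine lintegral_mono fun ω => ?_
        have h : (1 / 2 : ENNReal) ≤ (G.stateLaw s (pref k ω)).mean g := by
          rw [← PMF.mean_const (G.stateLaw s (pref k ω)) (1 / 2)]
          exact PMF.mean_mono _ fun t _ => hg t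
        calc (1 / 2 : ENNReal) ^ G.zeros (pref k ω)
            = 2 * ((1 / 2) ^ G.zeros (pref k ω) * (1 / 2)) := by
              rw [mul_left_comm, one_div, ENNReal.mul_inv_cancel (by simp) (by simp), mul_one]
          _ ≤ _ := by gcongr
    _ ≤ 2 * ρ ^ k := by
        rw [lintegral_const_mul _ (measurable_pref k fun l => (1 / 2) ^ G.zeros l *
              (G.stateLaw s l).mean g)]
        gcongr

/-- If the expected discount for the missing rewards decays geometrically, then almost surely the
average reward stays below 1. -/
theorem exists_ae_limSup_le {ρ : NNReal} (hρ0 : 0 < ρ) (hρ : ρ < 1) :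
    ∃ c > (0 : ℝ), ∀ (σ₁ : Strategy G.Γ₁) (σ₂ : Strategy G.Γ₂) (s : S) (C : NNReal),
      (∀ k, ∫⁻ ω, (1 / 2) ^ G.zeros (pref k ω) ∂G.playMeasure σ₁ σ₂ s ≤ C * (ρ : ENNReal) ^ k) →
      ∀ᵐ ω ∂G.playMeasure σ₁ σ₂ s, G.limSup ω < 1 - c := by
  -- A slower rate ρ' makes the series with ratio ρ / ρ' converge.
  obtain ⟨ρ', h1, h2⟩ := exists_between hρ
  have hρ' : 0 < ρ' := hρ0.trans h1
  have hlog2 : 0 < Real.log 2 := Real.log_pos (by norm_num)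
  have hlog : Real.log ρ' < 0 := Real.log_neg (by exact_mod_cast hρ') (by exact_mod_cast h2)
  have hneg : Real.log ρ' / Real.log 2 < 0 := div_neg_of_neg_of_pos hlog hlog2
  -- Half of the gap obtained from ρ', so that the final inequality is strict. It depends on ρ only,
  -- not on the strategies or the state.
  refine ⟨-(Real.log ρ' / Real.log 2) / 2, by linarith, fun σ₁ σ₂ s C hC => ?_⟩
  have hρ'0 : (ρ' : ENNReal) ≠ 0 := by exact_mod_cast hρ'.ne'
  have hm : ∀ k, Measurable fun ω : ℕ → Round S A =>
      ((ρ' : ENNReal) ^ k)⁻¹ * (1 / 2) ^ G.zeros (pref k ω) := fun k =>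
    measurable_pref k fun l => ((ρ' : ENNReal) ^ k)⁻¹ * (1 / 2) ^ G.zeros l
  have hsum : ∫⁻ ω, ∑' k, ((ρ' : ENNReal) ^ k)⁻¹ * (1 / 2) ^ G.zeros (pref k ω)
      ∂G.playMeasure σ₁ σ₂ s ≠ ⊤ := by
    rw [lintegral_tsum fun k => (hm k).aemeasurable]
    have hq : ρ / ρ' < 1 := (div_lt_one hρ').2 h1
    have : ∀ k, ∫⁻ ω, ((ρ' : ENNReal) ^ k)⁻¹ * (1 / 2) ^ G.zeros (pref k ω)
        ∂G.playMeasure σ₁ σ₂ s ≤ ((C * (ρ / ρ') ^ k : NNReal) : ENNReal) := by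
      intro k
      rw [lintegral_const_mul _ (measurable_pref k fun l => (1 / 2) ^ G.zeros l)]
      calc _ ≤ ((ρ' : ENNReal) ^ k)⁻¹ * (C * (ρ : ENNReal) ^ k) := by gcongr; exact hC k
        _ = _ := by
          rw [← ENNReal.coe_pow, ← ENNReal.coe_inv (by positivity)]
          norm_cast
          rw [div_pow]
          field_simp
    refine ne_top_of_le_ne_top ?_ (ENNReal.tsum_le_tsum this)
    rw [ENNReal.tsum_coe_ne_top_iff_summable]
    exact (NNReal.summable_geometric hq).mul_left C
  -- A series with finite expectation converges almost surely, so its terms are eventually below 1.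
  filter_upwards [ae_lt_top (Measurable.tsum hm) hsum] with ω hω
  have ht := ENNReal.tendsto_atTop_zero_of_tsum_ne_top hω.ne
  have he : ∀ᶠ k in atTop, ((1 / 2 : ℝ)) ^ G.zeros (pref k ω) ≤ (ρ' : ℝ) ^ k := by
    filter_upwards [ht.eventually (gt_mem_nhds (zero_lt_one (α := ENNReal)))] with k hk
    have h3 : ((1 / 2 : ENNReal)) ^ G.zeros (pref k ω) ≤ (ρ' : ENNReal) ^ k := by
      have h4 : ((ρ' : ENNReal) ^ k)⁻¹ * (1 / 2) ^ G.zeros (pref k ω) ≤ 1 := hk.le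
      rw [← ENNReal.div_eq_inv_mul] at h4
      have := (ENNReal.div_le_iff (pow_ne_zero _ hρ'0) (by simp)).1 h4
      simpa using this
    have h5 := ENNReal.toReal_mono (by simp) h3
    simpa using h5
  have := G.limSup_le_of_zeros he
  linarith

end ConcurrentGame

/-! ### Fixpoints on finite powersets -/

/-- On the powerset of a finite type a least fixpoint is reached after as many iterations as there
are points. -/
theorem OrderHom.iterate_card_eq_lfp {S : Type*} [Finite S] (f : Set S →o Set S) :
    f^[Nat.card S] ∅ = OrderHom.lfp f := by
  have hle : ∀ k, f^[k] ∅ ⊆ OrderHom.lfp f := by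
    intro k
    induction k with
    | zero => simp
    | succ k ih =>
      rw [Function.iterate_succ_apply', ← f.map_lfp]
      exact f.monotone ih
  have hmono : ∀ k, f^[k] ∅ ⊆ f^[k + 1] ∅ := by
    intro k
    induction k with
    | zero => simp
    | succ k ih =>
      rw [Function.iterate_succ_apply', Function.iterate_succ_apply' f (k + 1)]
      exact f.monotone ih
  -- Until the iteration stops, each step adds at least one point.
  have key : ∀ k, f^[k] ∅ = OrderHom.lfp f ∨ k ≤ (f^[k] ∅).ncard := by
    intro k
    induction k with
    | zero => simp
    | succ k ih =>
      rcases ih with ih | ih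
      · left
        rw [Function.iterate_succ_apply', ih, f.map_lfp]
      · by_cases h : f^[k] ∅ = f^[k + 1] ∅
        · left
          refine (hle _).antisymm (OrderHom.lfp_le f ?_)
          rw [← h, ← Function.iterate_succ_apply' f]
          exact h.symm.le
        · right
          have := Set.ncard_lt_ncard ((hmono k).ssubset_of_ne h)
          omega
  rcases key (Nat.card S) with h | h
  · exact h
  · have h1 : f^[Nat.card S] ∅ = univ := by
      refine Set.eq_of_subset_of_ncard_le (subset_univ _) ?_
      rwa [Set.ncard_univ]
    exact (hle _).antisymm (by rw [h1]; exact subset_univ _)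

/-- On the powerset of a finite type a greatest fixpoint is reached by iteration. -/
theorem OrderHom.exists_iterate_eq_gfp {S : Type*} [Finite S] (f : Set S →o Set S) :
    ∃ n, f^[n] univ = OrderHom.gfp f := by
  have hle : ∀ k, OrderHom.gfp f ⊆ f^[k] univ := by
    intro k
    induction k with
    | zero => simp
    | succ k ih =>
      rw [Function.iterate_succ_apply', ← f.map_gfp]
      exact f.monotone ih
  have hanti : ∀ k, f^[k + 1] univ ⊆ f^[k] univ := by
    intro k
    induction k with
    | zero => simp
    | succ k ih =>
      rw [Function.iterate_succ_apply' f (k + 1), Function.iterate_succ_apply' f k]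
      rw [Function.iterate_succ_apply' f k] at ih
      exact f.monotone ih
  obtain ⟨n, hn⟩ := WellFoundedLT.antitone_chain_condition
    (antitone_nat_of_succ_le (f := fun k => f^[k] univ) hanti)
  refine ⟨n, (OrderHom.le_gfp f ?_).antisymm (hle n)⟩
  have := hn (n + 1) (Nat.le_succ n)
  rw [← Function.iterate_succ_apply' f]
  exact this.le

/-- The minimum of finitely many positive bounds. Inserting 1 keeps the set non-empty and the bound
at most 1. -/
theorem exists_pos_le_of_finite {ι : Type*} [Finite ι] (w : ι → ENNReal) :
    ∃ p : NNReal, 0 < p ∧ p ≤ 1 ∧ ∀ i, w i ≠ 0 → (p : ENNReal) ≤ w i := by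
  have : ∀ i, ∃ p : NNReal, 0 < p ∧ (w i ≠ 0 → (p : ENNReal) ≤ w i) := by
    intro i
    by_cases h : w i = 0
    · exact ⟨1, one_pos, fun h' => absurd h h'⟩
    · obtain ⟨p, hp, hp'⟩ := ENNReal.lt_iff_exists_nnreal_btwn.1 (pos_iff_ne_zero.2 h)
      exact ⟨p, by exact_mod_cast hp, fun _ => hp'.le⟩
  choose p hp hpw using this
  cases nonempty_fintype ι
  have hne : (insert 1 (Finset.univ.image p)).Nonempty := Finset.insert_nonempty _ _
  refine ⟨(insert 1 (Finset.univ.image p)).min' hne, ?_, ?_, fun i hi => ?_⟩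
  · have := Finset.min'_mem _ hne
    rw [Finset.mem_insert, Finset.mem_image] at this
    rcases this with h | ⟨i, -, h⟩
    · rw [h]; exact one_pos
    · rw [← h]; exact hp i
  · exact Finset.min'_le _ _ (by simp)
  · refine le_trans ?_ (hpw i hi)
    exact_mod_cast Finset.min'_le _ _ (by simp)

/-! ### The strategy of player 2 outside the fixpoint -/

namespace ConcurrentGame

variable {S : Type u} {A : Type v} (G : ConcurrentGame S A)

theorem YStar_eq_gfp : OrderHom.gfp (G.ASPHom univ G.YStar) = G.YStar :=
  OrderHom.map_lfp (G.nuASP univ)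

theorem ASP_YStar : G.ASP univ G.YStar G.YStar = G.YStar := by
  have h := OrderHom.map_gfp (G.ASPHom univ G.YStar)
  rwa [G.YStar_eq_gfp] at h

theorem mem_Allow₁_univ {s : S} {a : A} : a ∈ G.Allow₁ s univ ↔ a ∈ G.Γ₁ s := by
  simp [Allow₁]

theorem mem_Good₁_univ {s : S} {Y Z : Set S} {a : A} : a ∈ G.Good₁ s univ Y Z ↔ a ∈ G.Γ₁ s ∧
    ∀ b ∈ G.Γ₂ s, b ∉ G.Bad₂ s univ Y → G.succ s a b ⊆ Z ∧ G.reward s a b = true := by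
  simp [Good₁, mem_Allow₁_univ]

open Classical in
/-- Player 2's moves that avoid `Y`, or all his moves if there are none. -/
noncomputable def avoiding (Y : Set S) (s : S) : Finset A :=
  if ((G.Γ₂ s).filter (· ∉ G.Bad₂ s univ Y)).Nonempty then
    (G.Γ₂ s).filter (· ∉ G.Bad₂ s univ Y) else G.Γ₂ s

theorem avoiding_nonempty (Y : Set S) (s : S) : (G.avoiding Y s).Nonempty := by
  rw [avoiding]
  split_ifs with h
  exacts [h, G.nonempty₂ s]

theorem avoiding_subset (Y : Set S) (s : S) : G.avoiding Y s ⊆ G.Γ₂ s := by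
  classical
  rw [avoiding]
  split_ifs with h
  exacts [Finset.filter_subset _ _, subset_rfl]

/-- Outside ASP the fallback in `avoiding` does not occur: if all moves of player 2 were bad, every
move of player 1 would be vacuously good. -/
theorem mem_avoiding {s : S} {Y Z : Set S} (hs : s ∉ G.ASP univ Y Z) {b : A} :
    b ∈ G.avoiding Y s ↔ b ∈ G.Γ₂ s ∧ b ∉ G.Bad₂ s univ Y := by
  classical
  rw [avoiding]
  split_ifs with h
  · simp only [Finset.mem_filter]
  · exfalso
    obtain ⟨a, ha⟩ := G.nonempty₁ s
    refine hs ⟨a, G.mem_Good₁_univ.2 ⟨ha, fun b hb hb' => (h ⟨b, ?_⟩).elim⟩⟩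
    simp [hb, hb']

/-- The memoryless strategy of player 2 that plays all moves avoiding `Y` with the same
probability. -/
noncomputable def avoidStrategy (Y : Set S) : Strategy G.Γ₂ where
  act _ s := PMF.uniformOfFinset (G.avoiding Y s) (G.avoiding_nonempty Y s)
  available _ s := by
    intro b hb
    rw [PMF.mem_support_uniformOfFinset_iff] at hb
    exact G.avoiding_subset Y s hb

/-- A move that is not bad keeps every allowed move of player 1 out of Y*, and with X = S all
available moves are allowed. -/
theorem notMem_YStar_of_avoiding {t t' : S} {a b : A} (ht : t ∉ G.YStar) (ha : a ∈ G.Γ₁ t)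
    (hb : b ∈ G.avoiding G.YStar t) (ht' : t' ∈ G.succ t a b) : t' ∉ G.YStar := by
  rw [← G.ASP_YStar] at ht
  have h := (G.mem_avoiding ht (b := b)).1 hb
  exact fun hY => h.2 ⟨h.1, a, G.mem_Allow₁_univ.2 ha, t', ht', hY⟩

variable [Finite S]

/-- Outside the least fixpoint the states have ranks, such that player 2, avoiding the fixpoint, has
against every move of player 1 a move that gives no reward or may decrease the rank. -/
theorem exists_rank : ∃ (n : ℕ) (rk : S → ℕ), (∀ t, rk t ≤ n) ∧ ∀ t ∉ G.YStar, 0 < rk t ∧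
    ∀ a ∈ G.Γ₁ t, ∃ b ∈ G.avoiding G.YStar t, G.reward t a b = false ∨
      ∃ t' ∈ G.succ t a b, rk t' < rk t := by
  classical
  obtain ⟨n, hn⟩ := OrderHom.exists_iterate_eq_gfp (G.ASPHom univ G.YStar)
  rw [G.YStar_eq_gfp] at hn
  set f := G.ASPHom univ G.YStar with hf
  have hex : ∀ t, t ∉ G.YStar → ∃ j, t ∉ f^[j] univ := fun t ht => ⟨n, by rwa [hn]⟩
  -- The rank is the first stage of the decreasing iteration that no longer contains the state. On
  -- Y* the value only has to be at most n.
  refine ⟨n, fun t => if h : t ∈ G.YStar then n else Nat.find (hex t h), fun t => ?_,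
    fun t ht => ?_⟩
  · dsimp only
    split_ifs with h
    · exact le_rfl
    · exact Nat.find_min' _ (by rwa [hn])
  · simp only [dif_neg ht]
    have hspec := Nat.find_spec (hex t ht)
    have hmin := fun j hj => Nat.find_min (hex t ht) (m := j) hj
    set j := Nat.find (hex t ht) with hj
    have hj0 : j ≠ 0 := by
      intro h0
      rw [h0] at hspec
      simp at hspec
    obtain ⟨i, hi⟩ := Nat.exists_eq_succ_of_ne_zero hj0
    refine ⟨Nat.pos_of_ne_zero hj0, fun a ha => ?_⟩
    -- The state drops out at stage i + 1 because none of its moves is good relative to stage i; a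
    -- witness against goodness is a non-bad move with reward 0 or with a successor outside stage i,
    -- hence of rank at most i.
    have hti : t ∉ G.ASP univ G.YStar (f^[i] univ) := by
      rw [hi, Function.iterate_succ_apply'] at hspec
      exact hspec
    have h1 : a ∉ G.Good₁ t univ G.YStar (f^[i] univ) := fun h => hti ⟨a, h⟩
    rw [mem_Good₁_univ] at h1
    push Not at h1
    obtain ⟨b, hb, hb', h2⟩ := h1 ha
    have hbm := (G.mem_avoiding hti (b := b)).2 ⟨hb, hb'⟩
    refine ⟨b, hbm, ?_⟩
    by_cases hr : G.reward t a b = true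
    · right
      have h3 : ¬ G.succ t a b ⊆ f^[i] univ := fun h => h2 h hr
      obtain ⟨t', ht', hti'⟩ := not_subset.1 h3
      refine ⟨t', ht', ?_⟩
      have ht'Y : t' ∉ G.YStar := by
        intro hY
        exact hb' ⟨hb, a, G.mem_Allow₁_univ.2 ha, t', ht', hY⟩
      rw [dif_neg ht'Y]
      have := Nat.find_min' (hex t' ht'Y) hti'
      omega
    · left
      simpa using hr

variable [Finite A]

/-- The potential is 1 - q^rank / 2 outside Y*, and infinite on Y*, where the inequality becomes
trivial. Let p bound from below the probability of one avoiding move with one successor, and let q =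
p / 2. At rank i + 1, with probability at least p the product of discount and new potential is at
most 1 - q^i / 2: either the reward is missing or the rank falls to at most i. All other outcomes
contribute at most 1, so the mean is at most 1 - p q^i / 2. The old potential is 1 - p q^i / 4, and
the gap pays for the factor ρ = 1 - p q^n / 4. -/
theorem exists_potential : ∃ (ρ : NNReal) (g : S → ENNReal), 0 < ρ ∧ ρ < 1 ∧ (∀ t, 1 / 2 ≤ g t) ∧
    (∀ t ∉ G.YStar, g t ≤ 1) ∧ ∀ (σ₁ : Strategy G.Γ₁) (h : List (Round S A)) (t : S),
      (G.roundLaw σ₁ (G.avoidStrategy G.YStar) h t).mean (fun r =>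
        (if G.reward r.state r.move₁ r.move₂ then 1 else 1 / 2) *
          (G.δ r.state r.move₁ r.move₂).mean g) ≤ ρ * g t := by
  classical
  obtain ⟨n, rk, hrn, hrk⟩ := G.exists_rank
  -- The strategy is memoryless, so its weights at the empty history are those at every history.
  obtain ⟨p, hp0, hp1, hp⟩ := exists_pos_le_of_finite fun x : S × A × A × S =>
    (G.avoidStrategy G.YStar).act [] x.1 x.2.2.1 * G.δ x.1 x.2.1 x.2.2.1 x.2.2.2
  set q := p / 2 with hq
  have hq0 : 0 < q := by positivity
  have hq1 : q ≤ 1 / 2 := by rw [hq]; gcongr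
  have hq1' : q ≤ 1 := hq1.trans (by norm_num)
  have hqj : ∀ j, q ^ j ≤ 1 := fun j => pow_le_one₀ zero_le hq1'
  have hd : ∀ j, p * q ^ j / 4 ≤ 1 / 2 := by
    intro j
    have h1 : p * q ^ j ≤ 1 * 1 := mul_le_mul' hp1 (hqj j)
    rw [← NNReal.coe_le_coe] at h1 ⊢
    push_cast at h1 ⊢
    linarith
  set g : S → ENNReal := fun t =>
    if t ∈ G.YStar then ⊤ else ((1 - q ^ rk t / 2 : NNReal) : ENNReal) with hg
  have hρ0 : 0 < 1 - p * q ^ n / 4 :=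
    tsub_pos_of_lt ((hd n).trans_lt (NNReal.coe_lt_coe.1 (by norm_num)))
  refine ⟨1 - p * q ^ n / 4, g, hρ0, ?_, fun t => ?_, fun t ht => ?_, fun σ₁ h t => ?_⟩
  · exact tsub_lt_self one_pos (by positivity)
  · simp only [hg]
    split_ifs with h
    · exact le_top
    · have h1 : (1 / 2 : NNReal) ≤ 1 - q ^ rk t / 2 := by
        have := hqj (rk t)
        refine le_tsub_of_add_le_right ?_
        rw [← NNReal.coe_le_coe] at this ⊢
        push_cast at this ⊢
        linarith
      calc (1 / 2 : ENNReal) = ((1 / 2 : NNReal) : ENNReal) := by simp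
        _ ≤ _ := by exact_mod_cast h1
  · simp only [hg, if_neg ht]
    exact_mod_cast tsub_le_self
  · by_cases ht : t ∈ G.YStar
    · have : g t = ⊤ := by simp [hg, ht]
      rw [this, ENNReal.mul_top (by exact_mod_cast hρ0.ne')]
      exact le_top
    rw [mean_roundLaw, ← PMF.mean_const (σ₁.act h t) (_ * g t)]
    refine PMF.mean_mono _ fun a ha => ?_
    have haΓ := σ₁.available _ _ ha
    set u := (G.avoidStrategy G.YStar).act h t with hu
    -- The joint law of the move of player 2 and the next state, for a fixed move of player 1.
    set P : PMF (A × S) := u.bind fun b => (G.δ t a b).map fun t' => (b, t') with hP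
    have hmean : (u.mean fun b => (if G.reward t a b = true then 1 else 1 / 2) *
        (G.δ t a b).mean g) =
        P.mean fun x => (if G.reward t a x.1 = true then 1 else 1 / 2) * g x.2 := by
      simp only [hP, PMF.mean_bind, PMF.mean_map]
      exact congrArg _ (funext fun b' => (PMF.mean_mul_left _ _ _).symm)
    simp only [hmean]
    obtain ⟨hr0, hr⟩ := hrk t ht
    obtain ⟨i, hi⟩ := Nat.exists_eq_succ_of_ne_zero hr0.ne'
    obtain ⟨b, hb, hbt⟩ := hr a haΓ
    have hsupp : ∀ x ∈ P.support, x.2 ∉ G.YStar := by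
      intro x hx
      simp only [hP, PMF.mem_support_bind_iff, PMF.mem_support_map_iff] at hx
      obtain ⟨b', hb', t', ht', rfl⟩ := hx
      refine G.notMem_YStar_of_avoiding ht haΓ ?_ ht'
      simpa [hu, avoidStrategy] using hb'
    have hbu : u b ≠ 0 := by
      rw [← PMF.mem_support_iff]
      simpa [hu, avoidStrategy] using hb
    have hw : ∀ t' ∈ G.succ t a b, (p : ENNReal) ≤ P (b, t') := by
      intro t' ht'
      refine (hp (t, a, b, t') (mul_ne_zero hbu ((PMF.mem_support_iff _ _).1 ht'))).trans ?_
      rw [hP, PMF.bind_apply]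
      refine le_trans ?_ (ENNReal.le_tsum b)
      refine mul_le_mul' le_rfl ?_
      rw [PMF.map_apply]
      refine le_trans ?_ (ENNReal.le_tsum t')
      simp
    have hone : ∀ x ∈ P.support, (if G.reward t a x.1 = true then 1 else 1 / 2) * g x.2 ≤ 1 := by
      intro x hx
      have h1 : g x.2 ≤ 1 := by
        simp only [hg, if_neg (hsupp x hx)]
        exact_mod_cast tsub_le_self
      have h2 : (if G.reward t a x.1 = true then 1 else 1 / 2 : ENNReal) ≤ 1 := by
        split_ifs
        · exact le_rfl
        · simp
      exact mul_le_one' h2 h1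
    -- The favourable outcome: a missing reward halves the value, and 1/2 ≥ q^i / 2; a successor of
    -- rank at most i has potential at most 1 - q^i / 2.
    obtain ⟨x, hx, hxd⟩ : ∃ t' ∈ G.succ t a b,
        (if G.reward t a b = true then 1 else 1 / 2) * g t' + ((q ^ i / 2 : NNReal) : ENNReal)
          ≤ 1 := by
      rcases hbt with hf | ⟨t', ht', hlt⟩
      · obtain ⟨t', ht'⟩ := (G.δ t a b).support_nonempty
        refine ⟨t', ht', ?_⟩
        have h1 : g t' ≤ 1 := by
          simp only [hg, if_neg (G.notMem_YStar_of_avoiding ht haΓ hb ht')]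
          exact_mod_cast tsub_le_self
        have h2 : ((q ^ i / 2 : NNReal) : ENNReal) ≤ ((1 / 2 : NNReal) : ENNReal) := by
          have := hqj i
          exact_mod_cast (by gcongr : q ^ i / 2 ≤ 1 / 2)
        simp only [hf]
        calc (1 / 2 : ENNReal) * g t' + _ ≤ 1 / 2 * 1 + ((1 / 2 : NNReal) : ENNReal) := by gcongr
          _ = 1 := by simp [ENNReal.inv_two_add_inv_two]
      · refine ⟨t', ht', ?_⟩
        have h2 : (if G.reward t a b = true then 1 else 1 / 2 : ENNReal) ≤ 1 := by
          split_ifs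
          · exact le_rfl
          · simp
        have h3 : 1 - q ^ rk t' / 2 + q ^ i / 2 ≤ 1 := by
          have h4 : q ^ i ≤ q ^ rk t' := pow_le_pow_of_le_one zero_le hq1' (by omega)
          calc 1 - q ^ rk t' / 2 + q ^ i / 2 ≤ 1 - q ^ rk t' / 2 + q ^ rk t' / 2 := by gcongr
            _ = 1 := tsub_add_cancel_of_le (by
              have := hqj (rk t')
              rw [← NNReal.coe_le_coe] at this ⊢
              push_cast at this ⊢
              linarith)
        calc _ ≤ 1 * g t' + ((q ^ i / 2 : NNReal) : ENNReal) := by gcongr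
          _ ≤ 1 := by
            simp only [hg, if_neg (G.notMem_YStar_of_avoiding ht haΓ hb ht'), one_mul]
            exact_mod_cast h3
    have hfin := P.mean_add_le hone (hw x hx) hxd
    generalize (P.mean fun x => (if G.reward t a x.1 = true then 1 else 1 / 2) * g x.2) = X at hfin ⊢
    have hXtop : X ≠ ⊤ := by
      intro h
      rw [h] at hfin
      simp at hfin
    lift X to NNReal using hXtop
    simp only [hg, if_neg ht, hi]
    norm_cast at hfin ⊢
    have e1 := hd n
    have e2 : q ^ i.succ / 2 ≤ 1 := by
      have := hqj i.succ
      rw [← NNReal.coe_le_coe] at this ⊢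
      push_cast at this ⊢
      linarith
    have e3 : q ^ n ≤ q ^ i := pow_le_pow_of_le_one zero_le hq1' (by have := hrn t; omega)
    have e4 : p * q ^ n ≤ p * q ^ i := by gcongr
    have e5 : p * q ^ n / 4 ≤ 1 := e1.trans (NNReal.coe_le_coe.1 (by norm_num))
    have e6 := hqj i
    rw [← NNReal.coe_le_coe] at hfin e4 ⊢
    rw [NNReal.coe_mul, NNReal.coe_sub e5, NNReal.coe_sub e2]
    push_cast at hfin e4 ⊢
    -- This is where the choice q = p / 2 enters: the potential at rank i + 1 is 1 - p q^i / 4.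
    have e7 : (q : ℝ) ^ i.succ = p * q ^ i / 2 := by
      rw [Nat.succ_eq_add_one, pow_succ, hq]
      push_cast
      ring
    rw [e7]
    -- The second-order term in the product of ρ and the potential has the favourable sign.
    have e8 : 0 ≤ (p * q ^ n : ℝ) * (p * q ^ i) := by positivity
    nlinarith

/-- From a state outside the fixpoint player 2 keeps the average reward away from 1. -/
theorem exists_ae_limSup_lt : ∃ c > (0 : ℝ), ∃ σ₂ : Strategy G.Γ₂, ∀ s ∉ G.YStar,
    ∀ σ₁ : Strategy G.Γ₁, ∀ᵐ ω ∂G.playMeasure σ₁ σ₂ s, G.limSup ω < 1 - c := by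
  obtain ⟨ρ, g, hρ0, hρ1, hg, hgs, hstep⟩ := G.exists_potential
  obtain ⟨c, hc, h⟩ := G.exists_ae_limSup_le hρ0 hρ1
  exact ⟨c, hc, G.avoidStrategy G.YStar, fun s hs σ₁ => h σ₁ _ s 2 fun k => by
    simpa using G.lintegral_zeros_le σ₁ _ s g ρ hg (hgs s hs) (hstep σ₁) k⟩

end ConcurrentGame

/-! ### The strategy of player 1 inside the fixpoint, and determinacy -/

/-- A distribution with prescribed support, concentrated at one point up to `ε`. -/
theorem PMF.exists_concentrated {α : Type*} (s : Finset α) {a : α} (ha : a ∈ s) {ε : ENNReal}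
    (hε : ε ≠ 0) (hε1 : ε ≤ 1) :
    ∃ p : PMF α, p.support = s ∧ (p.mean fun x => Set.indicator {a}ᶜ 1 x) ≤ ε := by
  classical
  -- A mixture of the point mass at `a`, with weight 1 - ε, and the uniform distribution on `s`,
  -- with weight ε.
  let b : PMF Bool := PMF.ofFintype (fun b => cond b (1 - ε) ε) (by simp [tsub_add_cancel_of_le hε1])
  let k : Bool → PMF α := fun b => cond b (PMF.pure a) (PMF.uniformOfFinset s ⟨a, ha⟩)
  refine ⟨b.bind k, ?_, ?_⟩
  · ext x
    rw [PMF.mem_support_bind_iff]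
    constructor
    · rintro ⟨_ | _, -, hx⟩
      · exact (PMF.mem_support_uniformOfFinset_iff ⟨a, ha⟩ _).1 hx
      · have : x = a := by simpa [k] using hx
        exact this ▸ ha
    · intro hx
      exact ⟨false, by simp [b, hε], (PMF.mem_support_uniformOfFinset_iff ⟨a, ha⟩ _).2 hx⟩
  · rw [PMF.mean_bind, PMF.mean, tsum_bool]
    have h1 : ((k true).mean fun x => Set.indicator {a}ᶜ 1 x) = 0 := by
      simp [k, PMF.mean_pure]
    have h2 : ((k false).mean fun x => Set.indicator {a}ᶜ 1 x) ≤ 1 := by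
      rw [← PMF.mean_const (k false) 1]
      exact PMF.mean_mono _ fun x _ => Set.indicator_le_self' (by simp) x
    rw [h1, mul_zero, add_zero]
    calc b false * _ ≤ ε * 1 := by gcongr; simp [b]
      _ = ε := mul_one _

namespace ConcurrentGame

variable {S : Type u} {A : Type v} (G : ConcurrentGame S A)

/-- The approximations of `Y*` from below. -/
def YIter (i : ℕ) : Set S := (G.nuASP univ)^[i] ∅

theorem YIter_succ (i : ℕ) : G.YIter (i + 1) = G.ASP univ (G.YIter i) (G.YIter (i + 1)) := by
  have h := OrderHom.map_gfp (G.ASPHom univ (G.YIter i))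
  rw [YIter, Function.iterate_succ_apply']
  exact h.symm

theorem YIter_mono : Monotone G.YIter := by
  refine monotone_nat_of_le_succ fun k => ?_
  induction k with
  | zero => simp [YIter]
  | succ k ih =>
    rw [YIter, Function.iterate_succ_apply', YIter, Function.iterate_succ_apply']
    exact (G.nuASP univ).monotone ih

/-- The approximations increase, so a state enters them at a single stage at most, and one move per
state suffices. A state that never enters gets an arbitrary move. -/
theorem exists_good : ∃ good : S → A, (∀ s, good s ∈ G.Γ₁ s) ∧ ∀ s i, s ∈ G.YIter (i + 1) →
    s ∉ G.YIter i → good s ∈ G.Good₁ s univ (G.YIter i) (G.YIter (i + 1)) := by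
  classical
  have : ∀ s, ∃ a ∈ G.Γ₁ s, ∀ i, s ∈ G.YIter (i + 1) → s ∉ G.YIter i →
      a ∈ G.Good₁ s univ (G.YIter i) (G.YIter (i + 1)) := by
    intro s
    by_cases h : ∃ i, s ∈ G.YIter (i + 1) ∧ s ∉ G.YIter i
    · obtain ⟨i, h1, h2⟩ := h
      have h3 := h1
      rw [YIter_succ] at h3
      obtain ⟨a, ha⟩ := h3
      refine ⟨a, (G.mem_Good₁_univ.1 ha).1, fun j h3 h4 => ?_⟩
      have hij : i = j := by
        rcases lt_trichotomy i j with h | h | h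
        · exact absurd (G.YIter_mono (Nat.succ_le_of_lt h) h1) h4
        · exact h
        · exact absurd (G.YIter_mono (Nat.succ_le_of_lt h) h3) h2
      exact hij ▸ ha
    · obtain ⟨a, ha⟩ := G.nonempty₁ s
      exact ⟨a, ha, fun i h1 h2 => absurd ⟨i, h1, h2⟩ h⟩
  choose good h1 h2 using this
  exact ⟨good, h1, h2⟩

/-- Full support makes every bad move of player 2 risky for him. The error bounds 2^-(k+2) sum to
1/2, so never deviating has positive probability. -/
theorem exists_nearly_good_strategy (good : S → A) (hgood : ∀ s, good s ∈ G.Γ₁ s) :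
    ∃ σ₁ : Strategy G.Γ₁, ∀ h s, (σ₁.act h s).support = G.Γ₁ s ∧
      ((σ₁.act h s).mean fun x => Set.indicator {good s}ᶜ 1 x) ≤ 2⁻¹ ^ (h.length + 2) := by
  have : ∀ (h : List (Round S A)) (s : S), ∃ p : PMF A, p.support = G.Γ₁ s ∧
      (p.mean fun x => Set.indicator {good s}ᶜ 1 x) ≤ 2⁻¹ ^ (h.length + 2) := fun h s =>
    PMF.exists_concentrated _ (hgood s) (by simp) (pow_le_one₀ zero_le (by simp))
  choose act h1 h2 using this
  exact ⟨⟨act, fun h s => (h1 h s).subset⟩, fun h s => ⟨h1 h s, h2 h s⟩⟩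

/-- The plays in which from some round on all rewards are 1. -/
def EventuallyRewarded : Set (ℕ → Round S A) :=
  {ω | ∃ n, ∀ k ≥ n, G.reward (ω k).state (ω k).move₁ (ω k).move₂ = true}

/-- At most n rewards are missing, so the averages lie between 1 - n/k and 1. -/
theorem limInf_eq_one {ω : ℕ → Round S A} (h : ω ∈ G.EventuallyRewarded) : G.limInf ω = 1 := by
  obtain ⟨n, hn⟩ := h
  refine Tendsto.liminf_eq ?_
  have hz : ∀ k, G.zeros (pref k ω) ≤ n := by
    intro k
    induction k with
    | zero => simp [pref, zeros]
    | succ k ih =>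
      rcases lt_or_ge k n with hk | hk
      · refine (List.countP_le_length).trans ?_
        simpa using hk
      · rw [pref_succ, zeros, List.countP_append, ← zeros]
        simpa [hn k hk] using ih
  have h1 : Tendsto (fun k : ℕ => 1 - (n : ℝ) / k) atTop (nhds 1) := by
    simpa using (tendsto_const_div_atTop_nhds_zero_nat (n : ℝ)).const_sub 1
  refine tendsto_of_tendsto_of_tendsto_of_le_of_le' h1 tendsto_const_nhds ?_
    (Eventually.of_forall (G.avgReward_le_one ω))
  filter_upwards [eventually_gt_atTop 0] with k hk
  have h2 : (0 : ℝ) < k := by exact_mod_cast hk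
  have h3 : (G.zeros (pref k ω) : ℝ) ≤ n := by exact_mod_cast hz k
  rw [avgReward, one_div, inv_mul_eq_div, eq_sub_of_add_eq (G.sum_reward_add_zeros ω k), sub_div,
    div_self h2.ne']
  gcongr

theorem measurableSet_EventuallyRewarded : MeasurableSet G.EventuallyRewarded := by
  have : G.EventuallyRewarded = ⋃ n, ⋂ k ≥ n, (fun ω : ℕ → Round S A => ω k) ⁻¹'
      {r | G.reward r.state r.move₁ r.move₂ = true} := by
    ext ω
    simp [EventuallyRewarded]
  rw [this]
  exact MeasurableSet.iUnion fun n => MeasurableSet.iInter fun k => MeasurableSet.iInter fun _ =>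
    measurable_pi_apply k (MeasurableSet.of_discrete)

theorem YStar_eq_YIter [Finite S] : G.YStar = G.YIter (Nat.card S) :=
  (OrderHom.iterate_card_eq_lfp (G.nuASP univ)).symm

variable [Finite S] [Finite A]

/-- If player 1 plays all moves and a set is almost surely not reached, then player 2 almost surely
plays no move that could lead to it. -/
theorem ae_move₂_notMem_Bad₂ {σ₁ : Strategy G.Γ₁} (hσ₁ : ∀ h s, (σ₁.act h s).support = G.Γ₁ s)
    (σ₂ : Strategy G.Γ₂) (s : S) {Y : Set S}
    (hY : ∀ k, G.playMeasure σ₁ σ₂ s {ω | (ω k).state ∈ Y} = 0) :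
    ∀ᵐ ω ∂G.playMeasure σ₁ σ₂ s, ∀ k, (ω k).move₂ ∉ G.Bad₂ (ω k).state univ Y := by
  classical
  -- The conclusion concerns all rounds possible after the history, not only the round drawn.
  -- Conditioning on the history before round k + 1 excludes `Y` from the possible next states;
  -- conditioning once more, on the history before round k, extends this to all rounds that could
  -- have been drawn.
  have key : ∀ᵐ ω ∂G.playMeasure σ₁ σ₂ s, ∀ k, ∀ r ∈ (G.law σ₁ σ₂ s (pref k ω)).support,
      ∀ t ∈ G.succ r.state r.move₁ r.move₂, t ∉ Y := by
    refine ae_all_iff.2 fun k => ?_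
    have h1 := G.lintegral_round σ₁ σ₂ s (k + 1) fun _ r => if r.state ∈ Y then 1 else 0
    have h2 : ∫⁻ ω, (if (ω (k + 1)).state ∈ Y then 1 else 0) ∂G.playMeasure σ₁ σ₂ s = 0 := by
      rw [lintegral_eq_zero_iff (measurable_pref_round (k + 1) fun _ (r : Round S A) =>
        if r.state ∈ Y then (1 : ENNReal) else 0)]
      filter_upwards [measure_eq_zero_iff_ae_notMem.1 (hY (k + 1))] with ω hω
      simpa using hω
    rw [h2] at h1
    have h3 := (lintegral_eq_zero_iff (measurable_pref (k + 1) fun l =>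
      (G.law σ₁ σ₂ s l).mean fun r => if r.state ∈ Y then 1 else 0)).1 h1.symm
    have h4 : ∀ᵐ ω ∂G.playMeasure σ₁ σ₂ s, (ω k).state ∈ univ → ∀ t ∈
        (G.stateLaw s (pref (k + 1) ω)).support, t ∉ Y := by
      filter_upwards [h3] with ω hω _ t ht htY
      simp only [Pi.zero_apply, law, PMF.mean_bind] at hω
      have h5 := (PMF.mul_le_mean (G.stateLaw s (pref (k + 1) ω)) (fun t =>
        (G.roundLaw σ₁ σ₂ (pref (k + 1) ω) t).mean fun r => if r.state ∈ Y then 1 else 0) t)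
      rw [hω, mean_roundLaw] at h5
      simp only [htY, if_true, PMF.mean_const, mul_one, nonpos_iff_eq_zero] at h5
      exact (PMF.mem_support_iff _ _).1 ht h5
    have h6 : ∫⁻ ω, (if ∃ t ∈ G.succ (ω k).state (ω k).move₁ (ω k).move₂, t ∈ Y then 1 else 0)
        ∂G.playMeasure σ₁ σ₂ s = 0 := by
      rw [lintegral_eq_zero_iff (measurable_pref_round k fun _ (r : Round S A) =>
        if ∃ t ∈ G.succ r.state r.move₁ r.move₂, t ∈ Y then (1 : ENNReal) else 0)]
      filter_upwards [h4] with ω hω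
      rw [pref_succ, stateLaw_append] at hω
      simpa [succ] using hω
    rw [G.lintegral_round σ₁ σ₂ s k fun _ r =>
      if ∃ t ∈ G.succ r.state r.move₁ r.move₂, t ∈ Y then 1 else 0] at h6
    have h7 := (lintegral_eq_zero_iff (measurable_pref k fun l => (G.law σ₁ σ₂ s l).mean fun r =>
      if ∃ t ∈ G.succ r.state r.move₁ r.move₂, t ∈ Y then 1 else 0)).1 h6
    filter_upwards [h7] with ω hω r hr t ht htY
    simp only [Pi.zero_apply] at hω
    have h8 := PMF.mul_le_mean (G.law σ₁ σ₂ s (pref k ω)) (fun r =>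
      if ∃ t ∈ G.succ r.state r.move₁ r.move₂, t ∈ Y then 1 else 0) r
    rw [hω, if_pos ⟨t, ht, htY⟩] at h8
    simp only [mul_one, nonpos_iff_eq_zero] at h8
    exact (PMF.mem_support_iff _ _).1 hr h8
  filter_upwards [key, G.ae_mem_support_law σ₁ σ₂ s] with ω hω hsupp k ⟨_, a, ha, t, ht, htY⟩
  have h1 := (G.mem_support_law _ _ _ _ _).1 (hsupp k)
  -- If player 2's move were bad because of `a`, the round with `a` in place of player 1's actual
  -- move would also be possible, by full support and independence.
  refine hω k ⟨(ω k).state, a, (ω k).move₂⟩ ((G.mem_support_law _ _ _ _ _).2 ⟨h1.1, ?_, h1.2.2⟩)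
    t ht htY
  rw [hσ₁]
  exact ha.1

/-- Deviations of player 1 from the good moves are unlikely under every condition on the states
so far. -/
theorem measure_deviation_le {good : S → A} {σ₁ : Strategy G.Γ₁}
    (hσ₁ : ∀ h s, ((σ₁.act h s).mean fun x => Set.indicator {good s}ᶜ 1 x) ≤
      2⁻¹ ^ (h.length + 2)) (σ₂ : Strategy G.Γ₂) (s : S) (Y : Set S) {k₀ k : ℕ} (hk : k₀ ≤ k) :
    G.playMeasure σ₁ σ₂ s {ω | (ω k₀).state ∈ Y ∧ (ω k).move₁ ≠ good (ω k).state} ≤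
      2⁻¹ ^ (k + 2) * G.playMeasure σ₁ σ₂ s {ω | (ω k₀).state ∈ Y} := by
  classical
  -- The condition on round `k₀` as a function of the history before round `k` and the state of
  -- round `k`. It is thus known before player 1 moves, even if `k₀ = k`.
  let c : List (Round S A) → S → ENNReal := fun h t =>
    if ∃ y ∈ Y, (h.map Round.state ++ [t])[k₀]? = some y then 1 else 0
  have hc : ∀ ω : ℕ → Round S A, c (pref k ω) (ω k).state =
      Set.indicator {ω : ℕ → Round S A | (ω k₀).state ∈ Y} 1 ω := by
    intro ω
    have e1 : (pref k ω).map Round.state ++ [(ω k).state] = (pref (k + 1) ω).map Round.state := by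
      simp [pref_succ]
    have e2 : ((pref (k + 1) ω).map Round.state)[k₀]? = some (ω k₀).state := by
      have : k₀ < k + 1 := by omega
      rw [pref, List.map_ofFn, List.getElem?_ofFn, dif_pos this]
      rfl
    simp only [c, e1, e2, Option.some.injEq, Set.indicator, mem_ofPred_eq, Pi.one_apply,
      exists_eq_right']
  have hm : MeasurableSet {ω : ℕ → Round S A | (ω k₀).state ∈ Y} :=
    (measurable_pi_apply k₀ : Measurable fun ω : ℕ → Round S A => ω k₀)
      (MeasurableSet.of_discrete (s := {r : Round S A | r.state ∈ Y}))
  have hm' : MeasurableSet {ω : ℕ → Round S A | (ω k).move₁ ≠ good (ω k).state} :=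
    (measurable_pi_apply k : Measurable fun ω : ℕ → Round S A => ω k)
      (MeasurableSet.of_discrete (s := {r : Round S A | r.move₁ ≠ good r.state}))
  have e1 : ∫⁻ ω, c (pref k ω) (ω k).state * Set.indicator {good (ω k).state}ᶜ 1 (ω k).move₁
      ∂G.playMeasure σ₁ σ₂ s =
      G.playMeasure σ₁ σ₂ s {ω | (ω k₀).state ∈ Y ∧ (ω k).move₁ ≠ good (ω k).state} := by
    refine Eq.trans ?_ (lintegral_indicator_one (hm.inter hm'))
    refine lintegral_congr fun ω => ?_
    rw [hc]
    by_cases h1 : (ω k₀).state ∈ Y <;> by_cases h2 : (ω k).move₁ = good (ω k).state <;>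
      simp [Set.indicator, h1, h2]
  have e2 : ∫⁻ ω, c (pref k ω) (ω k).state ∂G.playMeasure σ₁ σ₂ s =
      G.playMeasure σ₁ σ₂ s {ω | (ω k₀).state ∈ Y} := by
    rw [← lintegral_indicator_one hm]
    exact lintegral_congr hc
  rw [← e1, ← e2, G.lintegral_round σ₁ σ₂ s k fun h r =>
    c h r.state * Set.indicator {good r.state}ᶜ 1 r.move₁,
    G.lintegral_round σ₁ σ₂ s k fun h r => c h r.state, ← lintegral_const_mul _
    (measurable_pref k fun l => (G.law σ₁ σ₂ s l).mean fun r => c l r.state)]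
  refine lintegral_mono fun ω => ?_
  simp only [law, PMF.mean_bind]
  rw [← PMF.mean_mul_left]
  refine PMF.mean_mono _ fun t _ => ?_
  rw [mean_roundLaw, mean_roundLaw]
  simp only [PMF.mean_const, PMF.mean_mul_left]
  rw [mul_comm]
  gcongr
  simpa using hσ₁ (pref k ω) t

/-- Induction on the stage. Either the previous stage is reached with positive probability at some
time, or it is almost surely avoided for ever. In the second case player 2 plays no bad move, and as
long as player 1 follows the good moves the play stays in the present stage with reward 1. -/
theorem measure_EventuallyRewarded_pos {good : S → A} (hgood : ∀ s i, s ∈ G.YIter (i + 1) →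
    s ∉ G.YIter i → good s ∈ G.Good₁ s univ (G.YIter i) (G.YIter (i + 1))) {σ₁ : Strategy G.Γ₁}
    (hσ₁ : ∀ h s, (σ₁.act h s).support = G.Γ₁ s ∧
      ((σ₁.act h s).mean fun x => Set.indicator {good s}ᶜ 1 x) ≤ 2⁻¹ ^ (h.length + 2))
    (σ₂ : Strategy G.Γ₂) (s : S) (i k₀ : ℕ)
    (h : G.playMeasure σ₁ σ₂ s {ω | (ω k₀).state ∈ G.YIter i} ≠ 0) :
    G.playMeasure σ₁ σ₂ s G.EventuallyRewarded ≠ 0 := by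
  induction i generalizing k₀ with
  | zero => simp [YIter] at h
  | succ i ih =>
    by_cases hY : ∃ k, G.playMeasure σ₁ σ₂ s {ω | (ω k).state ∈ G.YIter i} ≠ 0
    · obtain ⟨k, hk⟩ := hY
      exact ih k hk
    push Not at hY
    have hbad := G.ae_move₂_notMem_Bad₂ (fun h s => (hσ₁ h s).1) σ₂ s hY
    have hY' : ∀ᵐ ω ∂G.playMeasure σ₁ σ₂ s, ∀ k, (ω k).state ∉ G.YIter i :=
      ae_all_iff.2 fun k => measure_eq_zero_iff_ae_notMem.1 (hY k)
    set C := {ω : ℕ → Round S A | (ω k₀).state ∈ G.YIter (i + 1)} with hC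
    set D := fun k => {ω : ℕ → Round S A | (ω k₀).state ∈ G.YIter (i + 1) ∧
      (ω (k₀ + k)).move₁ ≠ good (ω (k₀ + k)).state} with hD
    -- A deviation at or after time `k₀` has at most half the probability of the starting event, by
    -- summing the geometric bounds.
    have hD1 : G.playMeasure σ₁ σ₂ s (⋃ k, D k) ≤ 2⁻¹ * G.playMeasure σ₁ σ₂ s C := by
      calc _ ≤ ∑' k, G.playMeasure σ₁ σ₂ s (D k) := measure_iUnion_le _
        _ ≤ ∑' k : ℕ, (2⁻¹ ^ k * (2⁻¹ * 2⁻¹)) * G.playMeasure σ₁ σ₂ s C := by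
          refine ENNReal.tsum_le_tsum fun k =>
            (G.measure_deviation_le (fun h s => (hσ₁ h s).2) σ₂ s _ (Nat.le_add_right k₀ k)).trans ?_
          gcongr
          rw [add_right_comm, ← pow_two, ← pow_add]
          refine pow_le_pow_of_le_one zero_le (by simp) (by omega)
        _ = 2⁻¹ * G.playMeasure σ₁ σ₂ s C := by
          rw [ENNReal.tsum_mul_right, ENNReal.tsum_mul_right, ENNReal.tsum_geometric,
            ENNReal.one_sub_inv_two, inv_inv, ← mul_assoc,
            ENNReal.mul_inv_cancel (by simp) (by simp), one_mul]
    have hlt : G.playMeasure σ₁ σ₂ s (⋃ k, D k) < G.playMeasure σ₁ σ₂ s C :=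
      hD1.trans_lt (by
        rw [← ENNReal.div_eq_inv_mul]
        exact ENNReal.half_lt_self h (measure_ne_top _ _))
    -- If the plays with eventually constant reward 1 were a null set, the starting event would
    -- almost surely be contained in the deviations, which are less probable.
    intro hE
    refine hlt.not_ge ?_
    refine measure_mono_ae ?_
    filter_upwards [hbad, hY', G.ae_mem_plays σ₁ σ₂ s, measure_eq_zero_iff_ae_notMem.1 hE]
      with ω h1 h2 h3 h4 (h5 : ω ∈ C)
    by_contra hn
    have hn' : ∀ k, (ω (k₀ + k)).move₁ = good (ω (k₀ + k)).state := by
      intro k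
      by_contra h6
      exact hn (mem_iUnion.2 ⟨k, h5, h6⟩)
    have step : ∀ k, (ω (k₀ + k)).state ∈ G.YIter (i + 1) →
        G.succ (ω (k₀ + k)).state (ω (k₀ + k)).move₁ (ω (k₀ + k)).move₂ ⊆ G.YIter (i + 1) ∧
        G.reward (ω (k₀ + k)).state (ω (k₀ + k)).move₁ (ω (k₀ + k)).move₂ = true := by
      intro k hk
      rw [hn' k]
      exact (G.mem_Good₁_univ.1 (hgood _ i hk (h2 _))).2 _ (h3 (k₀ + k)).2.1 (h1 _)
    have stay : ∀ k, (ω (k₀ + k)).state ∈ G.YIter (i + 1) := by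
      intro k
      induction k with
      | zero => exact h5
      | succ k ihk => exact (step k ihk).1 (h3 (k₀ + k)).2.2
    refine h4 ⟨k₀, fun k hk => ?_⟩
    obtain ⟨j, rfl⟩ := Nat.exists_eq_add_of_le hk
    exact (step j (stay j)).2

theorem ae_state_zero (σ₁ : Strategy G.Γ₁) (σ₂ : Strategy G.Γ₂) (s : S) :
    ∀ᵐ ω ∂G.playMeasure σ₁ σ₂ s, (ω 0).state = s := by
  filter_upwards [G.ae_mem_support_law σ₁ σ₂ s] with ω hω
  have h := ((G.mem_support_law _ _ _ _ _).1 (hω 0)).1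
  have : pref 0 ω = [] := rfl
  simpa [this] using h

/-- From the states of the fixpoint player 1 wins with positive probability. -/
theorem exists_measure_EventuallyRewarded_pos : ∃ σ₁ : Strategy G.Γ₁, ∀ s ∈ G.YStar,
    ∀ σ₂ : Strategy G.Γ₂, G.playMeasure σ₁ σ₂ s G.EventuallyRewarded ≠ 0 := by
  obtain ⟨good, h1, h2⟩ := G.exists_good
  obtain ⟨σ₁, hσ₁⟩ := G.exists_nearly_good_strategy good h1
  refine ⟨σ₁, fun s hs σ₂ => G.measure_EventuallyRewarded_pos h2 hσ₁ σ₂ s (Nat.card S) 0 ?_⟩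
  rw [← G.YStar_eq_YIter]
  intro h0
  have h3 := measure_eq_zero_iff_ae_notMem.1 h0
  have h4 : ∀ᵐ ω ∂G.playMeasure σ₁ σ₂ s, False := by
    filter_upwards [h3, G.ae_state_zero σ₁ σ₂ s] with ω hω he
    exact hω (by simpa [he] using hs)
  rw [ae_iff] at h4
  simp at h4

/-- One strategy for each player and one constant `c` serve all states and objectives. The bounds on
an objective needed for each inclusion are isolated in `hpos`, `hpos'`, `halm` and `halm'`; for the
intersections and unions the index `c` is the decisive one. -/
theorem limInf_limSup_determinacy :
    (G.YStar = G.Positive₁ (G.LimInfAvg 1) ∧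
      G.YStar = G.Positive₁ (G.LimSupAvg 1) ∧
      G.YStar = ⋂ ε > (0 : ℝ), G.Positive₁ (G.LimInfAvg (1 - ε)) ∧
      G.YStar = ⋂ ε > (0 : ℝ), G.Positive₁ (G.LimSupAvg (1 - ε))) ∧
    (G.YStarᶜ = G.Almost₂ (G.CoLimInfAvg 1) ∧
      G.YStarᶜ = G.Almost₂ (G.CoLimSupAvg 1) ∧
      G.YStarᶜ = ⋃ c > (0 : ℝ), G.Almost₂ (G.CoLimInfAvg (1 - c)) ∧
      G.YStarᶜ = ⋃ c > (0 : ℝ), G.Almost₂ (G.CoLimSupAvg (1 - c))) := by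
  obtain ⟨σ₁, hσ₁⟩ := G.exists_measure_EventuallyRewarded_pos
  obtain ⟨c, hc, σ₂, hσ₂⟩ := G.exists_ae_limSup_lt
  have hpos : ∀ Φ : Set (ℕ → Round S A), (∀ ω ∈ G.plays, G.limInf ω = 1 → ω ∈ Φ) →
      G.YStar ⊆ G.Positive₁ Φ := by
    refine fun Φ hΦ s hs => ⟨σ₁, fun σ₂ => (pos_iff_ne_zero.2 (hσ₁ s hs σ₂)).trans_le ?_⟩
    refine measure_mono_ae ?_
    filter_upwards [G.ae_mem_plays σ₁ σ₂ s] with ω h1 h2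
    exact hΦ ω h1 (G.limInf_eq_one h2)
  have hpos' : ∀ Φ : Set (ℕ → Round S A), (∀ ω ∈ Φ, 1 - c ≤ G.limSup ω) →
      G.Positive₁ Φ ⊆ G.YStar := by
    rintro Φ hΦ s ⟨σ, hσ⟩
    by_contra hs
    refine (hσ σ₂).ne' (measure_eq_zero_iff_ae_notMem.2 ?_)
    filter_upwards [hσ₂ s hs σ] with ω h1 h2
    exact (hΦ ω h2).not_gt h1
  have halm : ∀ Φ : Set (ℕ → Round S A), (∀ ω ∈ G.plays, G.limSup ω < 1 - c → ω ∈ Φ) →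
      G.YStarᶜ ⊆ G.Almost₂ Φ := by
    refine fun Φ hΦ s hs => ⟨σ₂, fun σ => ?_⟩
    rw [← measure_univ (μ := G.playMeasure σ σ₂ s)]
    refine measure_congr (eventuallyEq_univ.2 ?_)
    filter_upwards [G.ae_mem_plays σ σ₂ s, hσ₂ s hs σ] with ω h1 h2
    exact hΦ ω h1 h2
  have halm' : ∀ Φ : Set (ℕ → Round S A), (∀ ω ∈ Φ, G.limInf ω < 1) →
      G.Almost₂ Φ ⊆ G.YStarᶜ := by
    rintro Φ hΦ s ⟨σ, hσ⟩ hs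
    refine hσ₁ s hs σ ?_
    have h1 : Φ ⊆ G.EventuallyRewardedᶜ := fun ω h h' => (hΦ ω h).ne (G.limInf_eq_one h')
    have h2 := measure_mono (μ := G.playMeasure σ₁ σ s) h1
    rw [hσ σ₁] at h2
    -- A strategy winning almost surely for player 2 would give probability 0 to an event that
    -- player 1 makes positive.
    exact (prob_compl_eq_one_iff G.measurableSet_EventuallyRewarded).1 (prob_le_one.antisymm h2)
  have hle := G.limInf_le_limSup
  refine ⟨⟨?_, ?_, ?_, ?_⟩, ?_, ?_, ?_, ?_⟩
  · refine (hpos (G.LimInfAvg 1) fun ω h1 h2 => ⟨h1, h2.ge⟩).antisymm (hpos' (G.LimInfAvg 1) fun ω h => ?_)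
    have h2 := h.2; have := hle ω; linarith
  · refine (hpos (G.LimSupAvg 1) fun ω h1 h2 => ⟨h1, h2.symm.trans_le (hle ω)⟩).antisymm (hpos' (G.LimSupAvg 1) fun ω h => ?_)
    have h2 := h.2; linarith
  · refine (subset_iInter₂ fun ε hε => hpos (G.LimInfAvg (1 - ε)) fun ω h1 h2 => ⟨h1, ?_⟩).antisymm
      ((iInter₂_subset c hc).trans (hpos' (G.LimInfAvg (1 - c)) fun ω h => h.2.trans (hle ω)))
    rw [h2]; linarith
  · refine (subset_iInter₂ fun ε hε => hpos (G.LimSupAvg (1 - ε)) fun ω h1 h2 => ⟨h1, ?_⟩).antisymm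
      ((iInter₂_subset c hc).trans (hpos' (G.LimSupAvg (1 - c)) fun ω h => h.2))
    have := hle ω; linarith
  · refine (halm (G.CoLimInfAvg 1) fun ω h1 h2 => ⟨h1, ?_⟩).antisymm (halm' (G.CoLimInfAvg 1) fun ω h => h.2)
    have := hle ω; linarith
  · refine (halm (G.CoLimSupAvg 1) fun ω h1 h2 => ⟨h1, ?_⟩).antisymm (halm' (G.CoLimSupAvg 1) fun ω h => (hle ω).trans_lt h.2)
    linarith
  · refine (subset_iUnion₂_of_subset c hc (halm (G.CoLimInfAvg (1 - c)) fun ω h1 h2 => ⟨h1, (hle ω).trans_lt h2⟩)).antisymm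
      (iUnion₂_subset fun ε hε => halm' (G.CoLimInfAvg (1 - ε)) fun ω h => ?_)
    have h2 := h.2; have : ε > 0 := hε; linarith
  · refine (subset_iUnion₂_of_subset c hc (halm (G.CoLimSupAvg (1 - c)) fun ω h1 h2 => ⟨h1, h2⟩)).antisymm
      (iUnion₂_subset fun ε hε => halm' (G.CoLimSupAvg (1 - ε)) fun ω h => ?_)
    have h2 := h.2; have : ε > 0 := hε; have := hle ω; linarith

end ConcurrentGame

/-! ### Program logic for the random access machine -/

namespace RAM

theorem Memory.store_same (m : Memory) (x i k : ℕ) :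
    m.store x i k x = Function.update (m x) i k := by
  simp [Memory.store]

theorem Memory.store_ne (m : Memory) {x y : ℕ} (h : y ≠ x) (i k : ℕ) :
    m.store x i k y = m y := by
  simp [Memory.store, h]

/-- Total correctness: from the memory `m` the program `p` halts with a number of steps and a final
memory satisfying `Q`. -/
def Does (p : Program) (m : Memory) (Q : ℕ → Memory → Prop) : Prop :=
  ∃ t m', Runs p m t m' ∧ Q t m'

theorem Does.mono {p : Program} {m : Memory} {Q Q' : ℕ → Memory → Prop} (h : Does p m Q)
    (hQ : ∀ t m', Q t m' → Q' t m') : Does p m Q' := by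
  obtain ⟨t, m', h1, h2⟩ := h
  exact ⟨t, m', h1, hQ _ _ h2⟩

/-- This and the following rules are equivalences, so that rewriting with them executes
straight-line code symbolically and adds up its cost. -/
theorem does_skip {m : Memory} {Q : ℕ → Memory → Prop} : Does .skip m Q ↔ Q 1 m := by
  constructor
  · rintro ⟨t, m', h, hQ⟩
    cases h
    exact hQ
  · exact fun h => ⟨_, _, .skip m, h⟩

theorem does_write {x : ℕ} {i e : Exp} {m : Memory} {Q : ℕ → Memory → Prop} :
    Does (.write x i e) m Q ↔ Q (i.cost + e.cost + 1) (m.store x (i.val m) (e.val m)) := by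
  constructor
  · rintro ⟨t, m', h, hQ⟩
    cases h
    exact hQ
  · exact fun h => ⟨_, _, .write x i e m, h⟩

theorem does_seq {p q : Program} {m : Memory} {Q : ℕ → Memory → Prop} :
    Does (.seq p q) m Q ↔ Does p m fun t m' => Does q m' fun t' m'' => Q (t + t') m'' := by
  constructor
  · rintro ⟨t, m', h, hQ⟩
    cases h with
    | seq h1 h2 => exact ⟨_, _, h1, _, _, h2, hQ⟩
  · rintro ⟨t, m', h1, t', m'', h2, hQ⟩
    exact ⟨_, _, .seq h1 h2, hQ⟩

theorem does_ite_pos {e : Exp} {p q : Program} {m : Memory} {Q : ℕ → Memory → Prop}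
    (he : e.val m ≠ 0) : Does (.ite e p q) m Q ↔ Does p m fun t m' => Q (e.cost + t + 1) m' := by
  constructor
  · rintro ⟨t, m', h, hQ⟩
    cases h with
    | iteTrue h1 h2 => exact ⟨_, _, h2, hQ⟩
    | iteFalse h1 h2 => exact absurd h1 he
  · rintro ⟨t, m', h, hQ⟩
    exact ⟨_, _, .iteTrue he h, hQ⟩

theorem does_ite_neg {e : Exp} {p q : Program} {m : Memory} {Q : ℕ → Memory → Prop}
    (he : e.val m = 0) : Does (.ite e p q) m Q ↔ Does q m fun t m' => Q (e.cost + t + 1) m' := by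
  constructor
  · rintro ⟨t, m', h, hQ⟩
    cases h with
    | iteTrue h1 h2 => exact absurd he h1
    | iteFalse h1 h2 => exact ⟨_, _, h2, hQ⟩
  · rintro ⟨t, m', h, hQ⟩
    exact ⟨_, _, .iteFalse he h, hQ⟩

theorem does_loop_pos {e : Exp} {p : Program} {m : Memory} {Q : ℕ → Memory → Prop}
    (he : e.val m ≠ 0) : Does (.loop e p) m Q ↔ Does p m fun t m' =>
      Does (.loop e p) m' fun t' m'' => Q (e.cost + t + t' + 1) m'' := by
  constructor
  · rintro ⟨t, m', h, hQ⟩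
    cases h with
    | loopTrue h1 h2 h3 => exact ⟨_, _, h2, _, _, h3, hQ⟩
    | loopFalse h1 => exact absurd h1 he
  · rintro ⟨t, m', h, t', m'', h', hQ⟩
    exact ⟨_, _, .loopTrue he h h', hQ⟩

theorem does_loop_neg {e : Exp} {p : Program} {m : Memory} {Q : ℕ → Memory → Prop}
    (he : e.val m = 0) : Does (.loop e p) m Q ↔ Q (e.cost + 1) m := by
  constructor
  · rintro ⟨t, m', h, hQ⟩
    cases h with
    | loopTrue h1 h2 h3 => exact absurd he h1
    | loopFalse h1 => exact hQ
  · exact fun h => ⟨_, _, .loopFalse he, h⟩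

/-- Whether the program may write into an array. -/
def Program.writes (x : ℕ) : Program → Bool
  | .skip => false
  | .write y _ _ => x == y
  | .seq p q => p.writes x || q.writes x
  | .ite _ p q => p.writes x || q.writes x
  | .loop _ p => p.writes x

/-- A syntactic check replaces invariants about arrays that a program does not touch. -/
theorem Runs.frame {p : Program} {m m' : Memory} {t : ℕ} (h : Runs p m t m') {x : ℕ}
    (hx : p.writes x = false) : m' x = m x := by
  induction h with
  | skip => rfl
  | write y i e m => exact m.store_ne (by simpa [Program.writes] using hx) _ _
  | seq _ _ ih1 ih2 =>
    simp only [Program.writes, Bool.or_eq_false_iff] at hx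
    rw [ih2 hx.2, ih1 hx.1]
  | iteTrue _ _ ih =>
    simp only [Program.writes, Bool.or_eq_false_iff] at hx
    exact ih hx.1
  | iteFalse _ _ ih =>
    simp only [Program.writes, Bool.or_eq_false_iff] at hx
    exact ih hx.2
  | loopTrue _ _ _ ih1 ih2 => rw [ih2 hx, ih1 hx]
  | loopFalse => rfl

theorem Does.frame {p : Program} {m : Memory} {Q : ℕ → Memory → Prop} (h : Does p m Q) :
    Does p m fun t m' => Q t m' ∧ ∀ x, p.writes x = false → m' x = m x := by
  obtain ⟨t, m', h1, h2⟩ := h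
  exact ⟨t, m', h1, h2, fun x hx => h1.frame hx⟩

/-- A loop that counts the variable `i` up to the variable `k`, where each round takes at most `c`
steps. -/
theorem does_for {k i c : ℕ} {p : Program} (I : ℕ → Memory → Prop) (N : ℕ)
    (step : ∀ j < N, ∀ m, I j m → m k 0 = N → m i 0 = j →
      Does p m fun t m' => t ≤ c ∧ I (j + 1) m' ∧ m' k 0 = N ∧ m' i 0 = j + 1)
    (j : ℕ) (hj : j ≤ N) (m : Memory) (hI : I j m) (hk : m k 0 = N) (hi : m i 0 = j) :
    Does (.loop (.sub (.read k (.lit 0)) (.read i (.lit 0))) p) m fun t m' =>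
      t ≤ (c + 6) * (N - j) + 6 ∧ I N m' ∧ m' i 0 = N := by
  obtain ⟨d, hd⟩ := Nat.exists_eq_add_of_le hj
  induction d generalizing j m with
  | zero =>
    have : j = N := by omega
    subst this
    rw [does_loop_neg (by simp [Exp.val, hk, hi])]
    simp [Exp.cost, hI, hi]
  | succ d ih =>
    rw [does_loop_pos (by simp [Exp.val, hk, hi]; omega)]
    refine (step j (by omega) m hI hk hi).mono fun t m' ⟨h1, h2, h3, h4⟩ => ?_
    refine (ih (j + 1) (by omega) m' h2 h3 h4 (by omega)).mono fun t' m'' ⟨h5, h6, h7⟩ => ?_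
    refine ⟨?_, h6, h7⟩
    -- Evaluating the guard costs 5 and testing it 1, which explains the constant 6.
    have e : N - j = N - (j + 1) + 1 := by omega
    rw [e, Nat.mul_add]
    simp only [Exp.cost]
    omega

end RAM

/-! ### The program -/

namespace RAM

/-! The arrays of the program for `Y*`; scalar variables are stored in cell 0 of their arrays. -/

notation "arrIn" => 0
notation "arrOut" => 1
notation "varN" => 2
notation "varPos" => 3
notation "varState" => 4
notation "varRows" => 5
notation "varAct" => 6
notation "varWidth" => 7
notation "varCells" => 8
notation "varCol" => 9
notation "varSuccs" => 10
notation "varEdges" => 11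
notation "arrSrc" => 12
notation "arrAct" => 13
notation "arrCol" => 14
notation "arrTgt" => 15
notation "arrCnt" => 16
notation "arrNext" => 17
notation "arrHead" => 18
notation "arrBad" => 19
notation "arrDead" => 20
notation "arrAlive" => 21
notation "arrQueue" => 22
notation "varFront" => 23
notation "varBack" => 24
notation "varCur" => 25
notation "varIdx" => 26
notation "varRound" => 27

/-- The value of a scalar variable. -/
abbrev var (x : ℕ) : Exp := .read x (.lit 0)

/-- The current entry of the input. -/
abbrev inputAt (k : ℕ) : Exp := .read arrIn (.add (var varPos) (.lit k))

/-- Assignment to a scalar variable. -/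
abbrev set (x : ℕ) (e : Exp) : Program := .write x (.lit 0) e

abbrev inc (x : ℕ) (e : Exp) : Program := set x (.add (var x) e)

abbrev dec (x : ℕ) : Program := set x (.sub (var x) (.lit 1))

/-- Append an edge with the given target to the table of edges. -/
def addEdge (e : Exp) : Program :=
  .seq (.write arrSrc (var varEdges) (var varState)) <|
  .seq (.write arrAct (var varEdges) (var varAct)) <|
  .seq (.write arrCol (var varEdges) (var varCol)) <|
  .seq (.write arrTgt (var varEdges) e) <|
  inc varEdges (.lit 1)

/-- Read the list of successors of a transition. -/
def readSuccs : Program :=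
  .loop (var varSuccs) <|
    .seq (addEdge (inputAt 0)) <| .seq (inc varPos (.lit 1)) <| dec varSuccs

/-- Read the transitions for one move of player 1; a missing reward is turned into an edge to the
additional state with the number `N`. -/
def readRow : Program :=
  .loop (var varCells) <|
    .seq (set varSuccs (inputAt 1)) <|
    .seq (.ite (inputAt 0) .skip (addEdge (var varN))) <|
    .seq (inc varPos (.lit 2)) <|
    .seq readSuccs <|
    .seq (inc varCol (var varN)) <| dec varCells

/-- Column numbers restart at the current state for each move of player 1, since they name moves of
player 2 and must agree across rows. Steps of length `N` keep the state recoverable as the remainder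
modulo `N`. -/
def readRows : Program :=
  .loop (var varRows) <|
    .seq (set varCells (var varWidth)) <|
    .seq (set varCol (var varState)) <|
    .seq readRow <|
    .seq (inc varAct (var varN)) <| dec varRows

def readStates : Program :=
  .loop (.sub (var varN) (var varState)) <|
    .seq (set varRows (inputAt 0)) <|
    .seq (set varWidth (inputAt 1)) <|
    .seq (inc varPos (.lit 2)) <|
    .seq (set varAct (var varState)) <|
    .seq (.write arrCnt (var varState) (var varRows)) <|
    .seq readRows <| inc varState (.lit 1)

/-- Read the input into a table of edges. -/
def readInput : Program :=
  .seq (set varN (.read arrIn (.lit 0))) <| .seq (set varPos (.lit 1)) readStates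

/-- Run a program for all values of the index variable below the value of the variable `k`. -/
def forIdx (k : ℕ) (p : Program) : Program :=
  .seq (set varIdx (.lit 0)) <|
  .loop (.sub (var k) (var varIdx)) <| .seq p (inc varIdx (.lit 1))

/-- Chain the edges with the same target. -/
def link : Program :=
  forIdx varEdges <|
    .seq (.write arrNext (var varIdx) (.read arrHead (.read arrTgt (var varIdx)))) <|
    .write arrHead (.read arrTgt (var varIdx)) (.add (var varIdx) (.lit 1))

/-- Resetting the cells that occur in edges suffices, because no other cell is ever marked; this
keeps the cost linear in the number of edges. -/
def clear : Program :=
  forIdx varEdges <|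
    .seq (.write arrBad (.read arrCol (var varIdx)) (.lit 0)) <|
    .write arrDead (.read arrAct (var varIdx)) (.lit 0)

/-- Mark the moves of player 2 that may lead to an alive state. -/
def markBad : Program :=
  forIdx varEdges <|
    .ite (.read arrAlive (.read arrTgt (var varIdx)))
      (.write arrBad (.read arrCol (var varIdx)) (.lit 1)) .skip

/-- The entry of a state counts its moves not yet killed; a state is alive when it is not 0. The
additional state `N` is left at 0. -/
def revive : Program :=
  forIdx varN <| .write arrAlive (var varIdx) (.read arrCnt (var varIdx))

/-- Kill the move of player 1 of the edge `varIdx`, and its state if it has no other move. -/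
def kill : Program :=
  .ite (.read arrBad (.read arrCol (var varIdx))) .skip <|
  .ite (.read arrDead (.read arrAct (var varIdx))) .skip <|
  .seq (.write arrDead (.read arrAct (var varIdx)) (.lit 1)) <|
  .seq (.write arrAlive (.read arrSrc (var varIdx))
    (.sub (.read arrAlive (.read arrSrc (var varIdx))) (.lit 1))) <|
  .ite (.read arrAlive (.read arrSrc (var varIdx))) .skip <|
  .seq (.write arrQueue (var varBack) (.read arrSrc (var varIdx))) (inc varBack (.lit 1))

/-- Kill along the chain of edges that starts at `varCur`. -/
def killChain : Program :=
  .loop (var varCur) <|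
    .seq (set varIdx (.sub (var varCur) (.lit 1))) <|
    .seq kill <| set varCur (.read arrNext (var varIdx))

/-- The queue is never shortened; states behind the front have been processed, those between front
and back are waiting. -/
def killQueue : Program :=
  .loop (.sub (var varBack) (var varFront)) <|
    .seq (set varCur (.read arrHead (.read arrQueue (var varFront)))) <|
    .seq (inc varFront (.lit 1)) killChain

/-- Compute the greatest fixpoint. -/
def innerFixpoint : Program :=
  .seq (.write arrQueue (.lit 0) (var varN)) <|
  .seq (set varFront (.lit 0)) <| .seq (set varBack (.lit 1)) killQueue

/-- The order matters: `markBad` reads the previous approximation from the alive array, which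
`revive` then overwrites. -/
def iteration : Program :=
  .seq clear <| .seq markBad <| .seq revive innerFixpoint

def output : Program :=
  forIdx varN <| .ite (.read arrAlive (var varIdx)) (.write arrOut (var varIdx) (.lit 1)) .skip

/-- The program that computes `Y*`. -/
def fixpointProgram : Program :=
  .seq readInput <| .seq link <| .seq (set varRound (var varN)) <|
  .seq (.loop (var varRound) (.seq iteration (dec varRound))) output

end RAM

/-! ### Reading the input into the table of edges -/

namespace RAM

/-- An edge from a state to a state, labelled by a move of each player. -/
structure Edge where
  src : ℕ
  act : ℕ
  col : ℕ
  tgt : ℕ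

/-- The edges stored in the tables of the memory. -/
def EdgeTable (m : Memory) (l : List Edge) : Prop :=
  m varEdges 0 = l.length ∧ ∀ (i : ℕ) (e : Edge), l[i]? = some e →
    m arrSrc i = e.src ∧ m arrAct i = e.act ∧ m arrCol i = e.col ∧ m arrTgt i = e.tgt

theorem EdgeTable.congr {m m' : Memory} {l : List Edge} (h : EdgeTable m l)
    (h0 : m' varEdges = m varEdges) (h1 : m' arrSrc = m arrSrc) (h2 : m' arrAct = m arrAct)
    (h3 : m' arrCol = m arrCol) (h4 : m' arrTgt = m arrTgt) : EdgeTable m' l := by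
  simpa only [EdgeTable, h0, h1, h2, h3, h4] using h

/-- The expression is evaluated after some of the tables have been written, so its value may depend
only on the arrays below 11, which stay unchanged. -/
theorem does_addEdge {e : Exp} {t : ℕ} {m : Memory} {l : List Edge} (h : EdgeTable m l)
    (he : ∀ m' : Memory, (∀ x < 11, m' x = m x) → e.val m' = t) :
    Does (addEdge e) m fun k m' => k ≤ e.cost + 30 ∧
      EdgeTable m' (l ++ [⟨m varState 0, m varAct 0, m varCol 0, t⟩]) ∧
      ∀ x < 11, m' x = m x := by
  have hf : Does (addEdge e) m fun k m' => k ≤ e.cost + 30 ∧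
      EdgeTable m' (l ++ [⟨m varState 0, m varAct 0, m varCol 0, t⟩]) := by
    simp only [addEdge, does_seq, does_write]
    rw [he]
    · simp only [Exp.val, Exp.cost]
      refine ⟨by omega, ?_, ?_⟩
      · simp [Memory.store_same, Memory.store_ne, h.1]
      · intro i d hd
        have hm := h.1
        simp only [Memory.store_same, Memory.store_ne, ne_eq,
          Nat.reduceEqDiff, not_false_eq_true, hm]
        rcases lt_trichotomy i l.length with hi | hi | hi
        · rw [List.getElem?_append_left hi] at hd
          simp only [Function.update_of_ne hi.ne]
          exact h.2 i d hd
        · subst hi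
          simp only [List.getElem?_concat_length, Option.some.injEq] at hd
          subst hd
          simp
        · rw [List.getElem?_eq_none (by simp; omega)] at hd
          simp at hd
    · intro x hx
      rw [Memory.store_ne _ (by omega), Memory.store_ne _ (by omega), Memory.store_ne _ (by omega)]
  refine hf.frame.mono fun k m' ⟨⟨h1, h2⟩, h3⟩ => ⟨h1, h2, fun x hx => h3 x ?_⟩
  interval_cases x <;> rfl

theorem getD_of_drop {w r : List ℕ} {p x : ℕ} (h : w.drop p = x :: r) :
    w.getD p 0 = x ∧ w.drop (p + 1) = r := by
  constructor
  · have := congrArg (·[0]?) h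
    simp only [List.getElem?_drop, List.getElem?_cons_zero, add_zero] at this
    simp [List.getD, this]
  · rw [← List.tail_drop, h, List.tail_cons]

/-- The reading position is described by the unread suffix of the input, which makes the proof an
induction over the decoded list. The parsers below follow the same pattern. -/
theorem does_readSuccs {w : List ℕ} (ts rest : List ℕ) {l : List Edge} {m : Memory}
    (hin : m arrIn = fun i => w.getD i 0) (hpos : w.drop (m varPos 0) = ts ++ rest)
    (hs : m varSuccs 0 = ts.length) (hE : EdgeTable m l) :
    Does readSuccs m fun k m' => k ≤ 100 * ts.length + 10 ∧ w.drop (m' varPos 0) = rest ∧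
      EdgeTable m' (l ++ ts.map fun t => ⟨m varState 0, m varAct 0, m varCol 0, t⟩) := by
  induction ts generalizing l m with
  | nil =>
    rw [readSuccs, does_loop_neg (by simpa [Exp.val] using hs)]
    exact ⟨by simp [Exp.cost], hpos, by simpa using hE⟩
  | cons t ts ih =>
    rw [List.cons_append] at hpos
    obtain ⟨h1, h2⟩ := getD_of_drop hpos
    rw [readSuccs, does_loop_pos (by simp [Exp.val, hs]), does_seq]
    refine (does_addEdge (t := t) hE fun m' hm' => ?_).mono fun k m' ⟨h3, h4, h5⟩ => ?_
    · simp only [Exp.val, hm' 0 (by norm_num), hm' 3 (by norm_num), hin, add_zero]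
      exact h1
    simp only [does_seq, does_write]
    have e1 := h5 3 (by norm_num)
    have e2 := h5 10 (by norm_num)
    refine (ih (l := l ++ [⟨m varState 0, m varAct 0, m varCol 0, t⟩]) ?_ ?_ ?_ ?_).mono
      fun k' m'' ⟨h6, h7, h8⟩ => ?_
    · simp [Memory.store_ne, h5 0 (by norm_num), hin]
    · simp [Memory.store_ne, Memory.store_same, Exp.val, e1, h2]
    · simp [Memory.store_ne, Memory.store_same, Exp.val, e2, hs]
    · exact h4.congr (by simp [Memory.store_ne]) (by simp [Memory.store_ne])
        (by simp [Memory.store_ne]) (by simp [Memory.store_ne]) (by simp [Memory.store_ne])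
    · refine ⟨?_, h7, ?_⟩
      · simp only [Exp.cost, List.length_cons] at h3 ⊢
        omega
      · simpa [Memory.store_ne, h5] using h8

/-- The targets of the edges for a transition with reward `r` and successors `ts`. -/
def targets (n r : ℕ) (ts : List ℕ) : List ℕ := (if r = 0 then [n] else []) ++ ts

/-- The edges for the transitions of one move of player 1. -/
def rowEdges (n s a : ℕ) : ℕ → List (ℕ × List ℕ) → List Edge
  | _, [] => []
  | b, (r, ts) :: row => (targets n r ts).map (fun t => ⟨s, a, b, t⟩) ++ rowEdges n s a (b + n) row

/-- The input for the transitions of one move of player 1. -/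
def rowCode (row : List (ℕ × List ℕ)) : List ℕ := row.flatMap fun x => x.1 :: x.2.length :: x.2

theorem does_readRow {w : List ℕ} (row : List (ℕ × List ℕ)) (rest : List ℕ) {l : List Edge}
    {m : Memory} (hin : m arrIn = fun i => w.getD i 0)
    (hpos : w.drop (m varPos 0) = rowCode row ++ rest)
    (hs : m varCells 0 = row.length) (hE : EdgeTable m l) :
    Does readRow m fun k m' => k ≤ 100 * (rowCode row).length + 10 ∧
      w.drop (m' varPos 0) = rest ∧
      EdgeTable m' (l ++ rowEdges (m varN 0) (m varState 0) (m varAct 0) (m varCol 0) row) := by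
  induction row generalizing l m with
  | nil =>
    rw [readRow, does_loop_neg (by simpa [Exp.val] using hs)]
    exact ⟨by simp [Exp.cost], hpos, by simpa [rowEdges] using hE⟩
  | cons x row ih =>
    obtain ⟨r, ts⟩ := x
    simp only [rowCode, List.flatMap_cons, List.cons_append, List.append_assoc] at hpos
    rw [← rowCode] at hpos
    obtain ⟨h1, h2⟩ := getD_of_drop hpos
    obtain ⟨h3, h4⟩ := getD_of_drop h2
    have hlen : (rowCode ((r, ts) :: row)).length = 2 + ts.length + (rowCode row).length := by
      simp [rowCode]; omega
    -- The test of the reward, which adds the edge to the additional state exactly when the reward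
    -- is 0.
    have hite : ∀ m₁ : Memory, (∀ x < 10, m₁ x = m x) → EdgeTable m₁ l →
        Does (.ite (inputAt 0) .skip (addEdge (var varN))) m₁ fun k m' => k ≤ 50 ∧
          EdgeTable m' (l ++ (if r = 0 then [m varN 0] else []).map fun t =>
            ⟨m varState 0, m varAct 0, m varCol 0, t⟩) ∧ ∀ x < 11, m' x = m₁ x := by
      intro m₁ hm₁ hE₁
      have e0 : Exp.val m₁ (inputAt 0) = r := by
        simp only [Exp.val, hm₁ 0 (by norm_num), hm₁ 3 (by norm_num), hin, add_zero]
        exact h1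
      by_cases hr : r = 0
      · rw [does_ite_neg (by rw [e0, hr])]
        refine (does_addEdge (t := m varN 0) hE₁ fun m' hm' => ?_).mono fun k m' ⟨h5, h6, h7⟩ => ?_
        · simp [Exp.val, hm' 2 (by norm_num), hm₁ 2 (by norm_num)]
        · simp only [Exp.cost] at h5 ⊢
          refine ⟨by omega, ?_, h7⟩
          simpa [hr, hm₁ 4 (by norm_num), hm₁ 6 (by norm_num), hm₁ 9 (by norm_num)] using h6
      · rw [does_ite_pos (by rwa [e0]), does_skip]
        simp [Exp.cost, hr, hE₁]
    rw [readRow, does_loop_pos (by simp [Exp.val, hs]), ← readRow]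
    simp only [does_seq, does_write]
    refine (hite _ ?_ ?_).mono fun k m₂ ⟨h5, h6, h7⟩ => ?_
    · intro x hx
      rw [Memory.store_ne _ (by omega)]
    · exact hE.congr (by simp [Memory.store_ne]) (by simp [Memory.store_ne])
        (by simp [Memory.store_ne]) (by simp [Memory.store_ne]) (by simp [Memory.store_ne])
    have f0 : ∀ x < 10, m₂ x = m x := by
      intro x hx
      rw [h7 x (by omega), Memory.store_ne _ (by omega)]
    have f10 : m₂ 10 0 = ts.length := by
      rw [h7 10 (by norm_num)]
      simp only [Memory.store_same, Exp.val, Function.update_self, hin]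
      exact h3
    refine (does_readSuccs (w := w) (l := l ++ (if r = 0 then [m varN 0] else []).map fun t =>
      ⟨m varState 0, m varAct 0, m varCol 0, t⟩) ts (rowCode row ++ rest) ?_ ?_ ?_ ?_).frame.mono
      fun k' m₃ ⟨⟨h8, h9, h10⟩, h11⟩ => ?_
    · simp [Memory.store_ne, f0, hin]
    · simp [Memory.store_same, Exp.val, f0, h4]
    · simp [Memory.store_ne, f10]
    · exact h6.congr (by simp [Memory.store_ne]) (by simp [Memory.store_ne])
        (by simp [Memory.store_ne]) (by simp [Memory.store_ne]) (by simp [Memory.store_ne])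
    have g : ∀ x < 10, x ≠ 3 → m₃ x = m x := by
      intro x hx hx3
      rw [h11 x (by interval_cases x <;> first | rfl | exact absurd rfl hx3),
        Memory.store_ne _ (by omega), f0 x hx]
    simp only [Memory.store_ne, ne_eq, Nat.reduceEqDiff, not_false_eq_true,
      f0 4 (by norm_num), f0 6 (by norm_num), f0 9 (by norm_num)] at h10
    refine (ih (l := l ++ (targets (m varN 0) r ts).map fun t =>
      ⟨m varState 0, m varAct 0, m varCol 0, t⟩) ?_ ?_ ?_ ?_).mono fun k'' m₄ ⟨h12, h13, h14⟩ => ?_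
    · simp [Memory.store_ne, g, hin]
    · simp [Memory.store_ne, h9]
    · simp [Memory.store_ne, Memory.store_same, Exp.val, g, hs]
    · rw [targets, List.map_append, ← List.append_assoc]
      exact h10.congr (by simp [Memory.store_ne]) (by simp [Memory.store_ne])
        (by simp [Memory.store_ne]) (by simp [Memory.store_ne]) (by simp [Memory.store_ne])
    · refine ⟨?_, h13, ?_⟩
      -- The two header cells of a transition pay for the constant overhead.
      · rw [hlen]
        simp only [Exp.cost]
        omega
      · simpa [Memory.store_ne, Memory.store_same, Exp.val, g, rowEdges] using h14

/-- The edges for the moves of player 1 at one state. -/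
def stateEdges (n s : ℕ) : ℕ → List (List (ℕ × List ℕ)) → List Edge
  | _, [] => []
  | a, row :: rows => rowEdges n s a s row ++ stateEdges n s (a + n) rows

theorem two_mul_length_le_rowCode (row : List (ℕ × List ℕ)) :
    2 * row.length ≤ (rowCode row).length := by
  induction row with
  | nil => simp
  | cons x row ih =>
    simp only [rowCode, List.flatMap_cons, List.length_append, List.length_cons] at ih ⊢
    omega

theorem does_readRows {w : List ℕ} (rows : List (List (ℕ × List ℕ))) (rest : List ℕ)
    {l : List Edge} {m : Memory} (hin : m arrIn = fun i => w.getD i 0)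
    (hpos : w.drop (m varPos 0) = rows.flatMap rowCode ++ rest)
    (hs : m varRows 0 = rows.length) (hw : ∀ row ∈ rows, row.length = m varWidth 0)
    (hw0 : 0 < m varWidth 0) (hE : EdgeTable m l) :
    Does readRows m fun k m' => k ≤ 200 * (rows.flatMap rowCode).length + 10 ∧
      w.drop (m' varPos 0) = rest ∧
      EdgeTable m' (l ++ stateEdges (m varN 0) (m varState 0) (m varAct 0) rows) := by
  induction rows generalizing l m with
  | nil =>
    rw [readRows, does_loop_neg (by simpa [Exp.val] using hs)]
    exact ⟨by simp [Exp.cost], hpos, by simpa [stateEdges] using hE⟩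
  | cons row rows ih =>
    rw [List.flatMap_cons, List.append_assoc] at hpos
    rw [readRows, does_loop_pos (by simp [Exp.val, hs]), ← readRows]
    simp only [does_seq, does_write]
    refine (does_readRow (w := w) (l := l) row (rows.flatMap rowCode ++ rest) ?_ ?_ ?_ ?_).frame.mono
      fun k m₁ ⟨⟨h1, h2, h3⟩, h4⟩ => ?_
    · simp [Memory.store_ne, hin]
    · simp [Memory.store_ne, hpos]
    · simp [Memory.store_ne, Memory.store_same, Exp.val, hw row]
    · exact hE.congr (by simp [Memory.store_ne]) (by simp [Memory.store_ne])
        (by simp [Memory.store_ne]) (by simp [Memory.store_ne]) (by simp [Memory.store_ne])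
    have f : ∀ x < 8, x ≠ 3 → m₁ x = m x := by
      intro x hx hx3
      rw [h4 x (by interval_cases x <;> first | rfl | exact absurd rfl hx3),
        Memory.store_ne _ (by omega), Memory.store_ne _ (by omega)]
    simp only [Memory.store_ne, Memory.store_same, ne_eq, Nat.reduceEqDiff, not_false_eq_true,
      Exp.val, Function.update_self] at h3
    refine (ih (l := l ++ rowEdges (m varN 0) (m varState 0) (m varAct 0) (m varState 0) row)
      ?_ ?_ ?_ ?_ ?_ ?_).mono fun k' m₂ ⟨h5, h6, h7⟩ => ?_
    · simp [Memory.store_ne, f, hin]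
    · simp [Memory.store_ne, h2]
    · simp [Memory.store_ne, Memory.store_same, Exp.val, f, hs]
    · intro row' hr
      simp [Memory.store_ne, f, hw row' (List.mem_cons_of_mem _ hr)]
    · simpa [Memory.store_ne, f] using hw0
    · exact h3.congr (by simp [Memory.store_ne]) (by simp [Memory.store_ne])
        (by simp [Memory.store_ne]) (by simp [Memory.store_ne]) (by simp [Memory.store_ne])
    · refine ⟨?_, h6, ?_⟩
      -- Player 2 has a move, so the code of a row is not empty and pays for the overhead of the
      -- row.
      · have h8 := two_mul_length_le_rowCode row
        have h9 := hw row List.mem_cons_self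
        simp only [Exp.cost, List.flatMap_cons, List.length_append]
        omega
      · simpa [Memory.store_ne, Memory.store_same, Exp.val, f, stateEdges] using h7

/-- The input for one state, given as the number of moves of player 2 and the transitions for every
move of player 1. -/
def stateCode (x : ℕ × List (List (ℕ × List ℕ))) : List ℕ :=
  x.2.length :: x.1 :: x.2.flatMap rowCode

/-- The edges of a game. -/
def gameEdges (n : ℕ) : ℕ → List (ℕ × List (List (ℕ × List ℕ))) → List Edge
  | _, [] => []
  | s, x :: xs => stateEdges n s s x.2 ++ gameEdges n (s + 1) xs

/-- The last clause serves the induction: reading later states preserves the counts already written.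
-/
theorem does_readStates {w : List ℕ} (xs : List (ℕ × List (List (ℕ × List ℕ)))) {l : List Edge}
    {m : Memory} (hin : m arrIn = fun i => w.getD i 0)
    (hpos : w.drop (m varPos 0) = xs.flatMap stateCode)
    (hs : m varN 0 = m varState 0 + xs.length) (hw : ∀ x ∈ xs, ∀ row ∈ x.2, row.length = x.1)
    (hw0 : ∀ x ∈ xs, 0 < x.1) (hE : EdgeTable m l) :
    Does readStates m fun k m' => k ≤ 200 * (xs.flatMap stateCode).length + 10 ∧
      EdgeTable m' (l ++ gameEdges (m varN 0) (m varState 0) xs) ∧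
      (∀ i x, xs[i]? = some x → m' arrCnt (m varState 0 + i) = x.2.length) ∧
      ∀ i < m varState 0, m' arrCnt i = m arrCnt i := by
  induction xs generalizing l m with
  | nil =>
    rw [readStates, does_loop_neg (by simp [Exp.val, hs])]
    exact ⟨by simp [Exp.cost], by simpa [gameEdges] using hE, by simp, fun _ _ => rfl⟩
  | cons x xs ih =>
    simp only [List.flatMap_cons, stateCode, List.cons_append] at hpos
    obtain ⟨h1, h2⟩ := getD_of_drop hpos
    obtain ⟨h3, h4⟩ := getD_of_drop h2
    rw [readStates, does_loop_pos (by simp [Exp.val, hs]), ← readStates]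
    simp only [does_seq, does_write]
    refine (does_readRows (w := w) (l := l) x.2 (xs.flatMap stateCode) ?_ ?_ ?_ ?_ ?_ ?_).frame.mono
      fun k m₁ ⟨⟨h5, h6, h7⟩, h8⟩ => ?_
    · simp [Memory.store_ne, hin]
    · simp [Memory.store_ne, Memory.store_same, Exp.val]
      simpa using h4
    · simp [Memory.store_ne, Memory.store_same, Exp.val, hin]
      simpa using h1
    · intro row hr
      rw [hw x List.mem_cons_self row hr]
      simp [Memory.store_ne, Memory.store_same, Exp.val, hin]
      simpa using h3.symm
    · have := hw0 x List.mem_cons_self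
      rw [← h3] at this
      simpa [Memory.store_ne, Memory.store_same, Exp.val, hin] using this
    · exact hE.congr (by simp [Memory.store_ne]) (by simp [Memory.store_ne])
        (by simp [Memory.store_ne]) (by simp [Memory.store_ne]) (by simp [Memory.store_ne])
    have f0 : m₁ 0 = m 0 := by simp [h8 0 rfl, Memory.store_ne]
    have f2 : m₁ 2 = m 2 := by simp [h8 2 rfl, Memory.store_ne]
    have f4 : m₁ 4 = m 4 := by simp [h8 4 rfl, Memory.store_ne]
    have f16 : m₁ 16 = Function.update (m 16) (m 4 0) x.2.length := by
      simp [h8 16 rfl, Memory.store_ne, Memory.store_same, Exp.val, hin]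
      rw [← h1]
      simp
    simp only [Memory.store_ne, Memory.store_same, ne_eq, Nat.reduceEqDiff, not_false_eq_true,
      Exp.val, Function.update_self] at h7
    refine (ih (l := l ++ stateEdges (m varN 0) (m varState 0) (m varState 0) x.2)
      ?_ ?_ ?_ ?_ ?_ ?_).mono fun k' m₂ ⟨h9, h10, h11, h12⟩ => ?_
    · simp [Memory.store_ne, f0, hin]
    · simp [Memory.store_ne, h6]
    · simp [Memory.store_ne, Memory.store_same, Exp.val, f2, f4, hs]
      omega
    · exact fun y hy => hw y (List.mem_cons_of_mem _ hy)
    · exact fun y hy => hw0 y (List.mem_cons_of_mem _ hy)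
    · exact h7.congr (by simp [Memory.store_ne]) (by simp [Memory.store_ne])
        (by simp [Memory.store_ne]) (by simp [Memory.store_ne]) (by simp [Memory.store_ne])
    simp only [Memory.store_ne, Memory.store_same, Exp.val, f2, f4, f16, ne_eq, Nat.reduceEqDiff,
      not_false_eq_true, Function.update_self] at h10 h11 h12
    refine ⟨?_, ?_, ?_, ?_⟩
    · simp only [Exp.cost, stateCode, List.flatMap_cons, List.length_append, List.length_cons]
      omega
    · simpa [gameEdges] using h10
    · intro i y hy
      cases i with
      | zero =>
        simp only [List.getElem?_cons_zero, Option.some.injEq] at hy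
        rw [add_zero, h12 _ (by omega), Function.update_self, hy]
      | succ i =>
        have := h11 i y (by simpa using hy)
        rwa [add_assoc, add_comm 1 i] at this
    · intro i hi
      rw [h12 i (by omega), Function.update_of_ne (by omega)]

/-- The last clause provides the zero initialisation of the output, the chains, the marks and the
alive array for the later phases. -/
theorem does_readInput (xs : List (ℕ × List (List (ℕ × List ℕ))))
    (hw : ∀ x ∈ xs, ∀ row ∈ x.2, row.length = x.1) (hw0 : ∀ x ∈ xs, 0 < x.1) :
    Does readInput (init (xs.length :: xs.flatMap stateCode)) fun k m =>
      k ≤ 200 * (xs.flatMap stateCode).length + 20 ∧ m varN 0 = xs.length ∧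
      EdgeTable m (gameEdges xs.length 0 xs) ∧
      (∀ i x, xs[i]? = some x → m arrCnt i = x.2.length) ∧
      ∀ x, (x = 1 ∨ 17 ≤ x) → m x = fun _ => 0 := by
  simp only [readInput, does_seq, does_write]
  refine (does_readStates (w := xs.length :: xs.flatMap stateCode) (l := []) xs
    ?_ ?_ ?_ hw hw0 ?_).frame.mono fun k m ⟨⟨h1, h2, h3, h4⟩, h5⟩ => ?_
  · funext i
    simp [Memory.store_ne, init]
  · simp [Memory.store_same, Exp.val]
  · simp [Memory.store_ne, Memory.store_same, Exp.val, init]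
  · refine ⟨by simp [Memory.store_ne, init], ?_⟩
    simp
  · simp only [Memory.store_ne, Memory.store_same, Exp.val, ne_eq, Nat.reduceEqDiff,
      not_false_eq_true, Function.update_self, init, OfNat.ofNat_ne_zero, if_true, if_false,
      List.getD_cons_zero, List.nil_append, zero_add] at h2 h3
    refine ⟨?_, ?_, h2, h3, ?_⟩
    · simp only [Exp.cost]
      linarith
    · rw [h5 2 rfl]
      simp [Memory.store_ne, Memory.store_same, Exp.val, init]
    · intro x hx
      rw [h5 x, Memory.store_ne _ (by omega), Memory.store_ne _ (by omega)]
      · funext i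
        simp only [init]
        rw [if_neg (by omega)]
      · simp only [readStates, readRows, readRow, readSuccs, addEdge, Program.writes,
          Bool.or_eq_false_iff, beq_eq_false_iff_ne, true_and]
        omega

end RAM

/-! ### The loops over all edges or all states -/

namespace RAM

/-- The body may assume that every array it does not write, other than the index, still has its
initial content; the invariant must not depend on the index variable. -/
theorem does_forIdx {k c : ℕ} {p : Program} {m : Memory} (I : ℕ → Memory → Prop)
    (hI : ∀ j m i, I j m → I j (m.store varIdx 0 i)) (hk : k ≠ varIdx) (hpk : p.writes k = false)
    (hp : p.writes varIdx = false) (h0 : I 0 m)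
    (step : ∀ j < m k 0, ∀ m', I j m' → m' varIdx 0 = j →
      (∀ x, x ≠ varIdx → p.writes x = false → m' x = m x) →
      Does p m' fun t m'' => t ≤ c ∧ I (j + 1) m'') :
    Does (forIdx k p) m fun t m' => t ≤ (c + 20) * m k 0 + 20 ∧ I (m k 0) m' := by
  simp only [forIdx, does_seq, does_write]
  refine (does_for (c := c + 10) (fun j m' => I j m' ∧
    ∀ x, x ≠ varIdx → p.writes x = false → m' x = m x) (m k 0) ?_ 0 (Nat.zero_le _) _ ?_ ?_ ?_).mono
    fun t m' ⟨h1, h2, _⟩ => ⟨?_, h2.1⟩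
  · intro j hj m' ⟨h1, h2⟩ h3 h4
    rw [does_seq]
    refine (step j hj m' h1 h4 h2).frame.mono fun t m'' ⟨⟨h5, h6⟩, h7⟩ => ?_
    rw [does_write]
    refine ⟨?_, ⟨hI _ _ _ h6, fun x hx hpx => ?_⟩, ?_, ?_⟩
    · simp only [Exp.cost]
      omega
    · rw [Memory.store_ne _ hx, h7 x hpx, h2 x hx hpx]
    · rw [Memory.store_ne _ hk, h7 k hpk, h3]
    · simp [Memory.store_same, Exp.val, h7 _ hp, h4]
  · refine ⟨hI _ _ _ h0, fun x hx _ => Memory.store_ne _ hx _ _⟩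
  · rw [Memory.store_ne _ hk]
  · simp [Memory.store_same, Exp.val]
  · simp only [Exp.cost]
    have e : (c + 20) * m k 0 = (c + 10 + 6) * m k 0 + 4 * m k 0 := by ring
    rw [e]
    rw [Nat.sub_zero] at h1
    omega

/-- The successor of the last edge before `c` with target `t`, or 0 if there is none. -/
def prev (tgt : ℕ → ℕ) (t : ℕ) : ℕ → ℕ
  | 0 => 0
  | c + 1 => if tgt c = t then c + 1 else prev tgt t c

/-- Edge numbers are stored shifted by one, so that 0 ends a chain. When edge e is linked, the head
of its target is the latest earlier edge with that target, which becomes its successor in the chain.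
-/
theorem does_link {m : Memory} (hhead : ∀ t, m arrHead t = 0) :
    Does link m fun k m' => k ≤ 60 * m varEdges 0 + 20 ∧
      (∀ t, m' arrHead t = prev (m arrTgt) t (m varEdges 0)) ∧
      ∀ e < m varEdges 0, m' arrNext e = prev (m arrTgt) (m arrTgt e) e := by
  refine (does_forIdx (c := 40) (fun j m' => (∀ t, m' arrHead t = prev (m arrTgt) t j) ∧
    ∀ e < j, m' arrNext e = prev (m arrTgt) (m arrTgt e) e) ?_ ?_ rfl rfl ?_ ?_).mono
    fun t m' ⟨h1, h2⟩ => ⟨h1, h2⟩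
  · intro j m' i h
    simpa [Memory.store_ne] using h
  · norm_num
  · exact ⟨hhead, by simp⟩
  · intro j hj m' ⟨h1, h2⟩ h3 h4
    have h15 : m' 15 = m 15 := h4 15 (by norm_num) rfl
    simp only [does_seq, does_write, Exp.cost, Exp.val, Memory.store_ne, ne_eq, Nat.reduceEqDiff,
      not_false_eq_true, Memory.store_same, h15, h3]
    refine ⟨by norm_num, fun t => ?_, fun e he => ?_⟩
    · by_cases ht : m 15 j = t
      · simp [prev, ht]
      · rw [Function.update_of_ne (Ne.symm ht)]
        simp [prev, ht, h1]
    · rcases Nat.lt_succ_iff_lt_or_eq.1 he with he | rfl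
      · rw [Function.update_of_ne he.ne, h2 e he]
      · simp [h1]

/-- The last clause covers the cells that belong to no edge. -/
theorem does_clear (m : Memory) :
    Does clear m fun k m' => k ≤ 60 * m varEdges 0 + 20 ∧
      (∀ e < m varEdges 0, m' arrBad (m arrCol e) = 0 ∧ m' arrDead (m arrAct e) = 0) ∧
      ∀ a, m arrDead a = 0 → m' arrDead a = 0 := by
  refine (does_forIdx (c := 40) (fun j m' =>
    (∀ e < j, m' arrBad (m arrCol e) = 0 ∧ m' arrDead (m arrAct e) = 0) ∧
      ∀ a, m arrDead a = 0 → m' arrDead a = 0) ?_ ?_ rfl rfl ?_ ?_).mono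
    fun t m' ⟨h1, h2⟩ => ⟨h1, h2⟩
  · intro j m' i h
    simpa [Memory.store_ne] using h
  · norm_num
  · exact ⟨by simp, fun _ h => h⟩
  · intro j hj m' ⟨h1, h2⟩ h3 h4
    have h13 : m' 13 = m 13 := h4 13 (by norm_num) rfl
    have h14 : m' 14 = m 14 := h4 14 (by norm_num) rfl
    simp only [does_seq, does_write, Exp.cost, Exp.val, Memory.store_ne, ne_eq, Nat.reduceEqDiff,
      not_false_eq_true, Memory.store_same, h13, h14, h3, Function.update_apply]
    refine ⟨by norm_num, fun e he => ?_, fun a ha => ?_⟩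
    · rcases Nat.lt_succ_iff_lt_or_eq.1 he with he | rfl
      · rw [(h1 e he).1, (h1 e he).2]
        simp
      · simp
    · rw [h2 a ha]
      simp

theorem does_markBad {m : Memory} (hbad : ∀ e < m varEdges 0, m arrBad (m arrCol e) = 0) :
    Does markBad m fun k m' => k ≤ 60 * m varEdges 0 + 20 ∧
      ∀ e < m varEdges 0, m' arrBad (m arrCol e) ≠ 0 ↔
        ∃ e' < m varEdges 0, m arrCol e' = m arrCol e ∧ m arrAlive (m arrTgt e') ≠ 0 := by
  refine (does_forIdx (c := 40) (fun j m' => ∀ e < m varEdges 0, m' arrBad (m arrCol e) ≠ 0 ↔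
        ∃ e' < j, m arrCol e' = m arrCol e ∧ m arrAlive (m arrTgt e') ≠ 0) ?_ ?_ rfl rfl ?_ ?_).mono
    fun t m' ⟨h1, h2⟩ => ⟨h1, h2⟩
  · intro j m' i h
    simpa [Memory.store_ne] using h
  · norm_num
  · intro e he
    simp [hbad e he]
  · intro j hj m' h1 h3 h4
    have h14 : m' 14 = m 14 := h4 14 (by norm_num) rfl
    have h15 : m' 15 = m 15 := h4 15 (by norm_num) rfl
    have h21 : m' 21 = m 21 := h4 21 (by norm_num) rfl
    have hval : Exp.val m' (.read arrAlive (.read arrTgt (var varIdx))) = m 21 (m 15 j) := by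
      simp [Exp.val, h21, h15, h3]
    by_cases h : m 21 (m 15 j) = 0
    · rw [does_ite_neg (by rw [hval, h]), does_skip]
      refine ⟨by simp [Exp.cost], fun e he => ?_⟩
      rw [h1 e he]
      constructor
      · rintro ⟨e', h5, h6⟩
        exact ⟨e', by omega, h6⟩
      · rintro ⟨e', h5, h6, h7⟩
        refine ⟨e', ?_, h6, h7⟩
        rcases Nat.lt_succ_iff_lt_or_eq.1 h5 with h5 | rfl
        · exact h5
        · exact absurd h h7
    · rw [does_ite_pos (by rwa [hval]), does_write]
      refine ⟨by simp [Exp.cost], fun e he => ?_⟩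
      simp only [Memory.store_same, Exp.val, h14, h3, Function.update_apply]
      split_ifs with h5
      · simp only [ne_eq, one_ne_zero, not_false_eq_true, true_iff]
        exact ⟨j, by omega, h5.symm, h⟩
      · rw [h1 e he]
        constructor
        · rintro ⟨e', h6, h7⟩
          exact ⟨e', by omega, h7⟩
        · rintro ⟨e', h6, h7, h8⟩
          refine ⟨e', ?_, h7, h8⟩
          rcases Nat.lt_succ_iff_lt_or_eq.1 h6 with h6 | rfl
          · exact h6
          · exact absurd h7.symm h5

theorem does_revive (m : Memory) :
    Does revive m fun k m' => k ≤ 60 * m varN 0 + 20 ∧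
      (∀ s < m varN 0, m' arrAlive s = m arrCnt s) ∧
      ∀ s ≥ m varN 0, m' arrAlive s = m arrAlive s := by
  refine (does_forIdx (c := 40) (fun j m' => (∀ s < j, m' arrAlive s = m arrCnt s) ∧
      ∀ s ≥ m varN 0, m' arrAlive s = m arrAlive s) ?_ ?_ rfl rfl ?_ ?_).mono
    fun t m' ⟨h1, h2⟩ => ⟨h1, h2⟩
  · intro j m' i h
    simpa [Memory.store_ne] using h
  · norm_num
  · exact ⟨by simp, fun _ _ => rfl⟩
  · intro j hj m' ⟨h1, h2⟩ h3 h4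
    have h16 : m' 16 = m 16 := h4 16 (by norm_num) rfl
    simp only [does_write, Exp.cost, Exp.val, Memory.store_same, h16, h3]
    refine ⟨by norm_num, fun s hs => ?_, fun s hs => ?_⟩
    · rcases Nat.lt_succ_iff_lt_or_eq.1 hs with hs | rfl
      · rw [Function.update_of_ne hs.ne, h1 s hs]
      · simp
    · rw [Function.update_of_ne (by omega), h2 s hs]

theorem does_output {m : Memory} (hout : ∀ s, m arrOut s = 0) :
    Does output m fun k m' => k ≤ 60 * m varN 0 + 20 ∧
      ∀ s < m varN 0, m' arrOut s = if m arrAlive s = 0 then 0 else 1 := by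
  refine (does_forIdx (c := 40) (fun j m' => (∀ s < j, m' arrOut s = if m arrAlive s = 0 then 0
      else 1) ∧ ∀ s ≥ j, m' arrOut s = 0) ?_ ?_ rfl rfl ?_ ?_).mono
    fun t m' ⟨h1, h2⟩ => ⟨h1, h2.1⟩
  · intro j m' i h
    simpa [Memory.store_ne] using h
  · norm_num
  · exact ⟨by simp, fun s _ => hout s⟩
  · intro j hj m' ⟨h1, h2⟩ h3 h4
    have h21 : m' 21 = m 21 := h4 21 (by norm_num) rfl
    have hval : Exp.val m' (.read arrAlive (var varIdx)) = m 21 j := by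
      simp [Exp.val, h21, h3]
    by_cases h : m 21 j = 0
    · rw [does_ite_neg (by rw [hval, h]), does_skip]
      refine ⟨by simp [Exp.cost], fun s hs => ?_, fun s hs => h2 s (by omega)⟩
      rcases Nat.lt_succ_iff_lt_or_eq.1 hs with hs | rfl
      · exact h1 s hs
      · rw [if_pos h, h2 s le_rfl]
    · rw [does_ite_pos (by rwa [hval]), does_write]
      simp only [Memory.store_same, Exp.val, h3, Exp.cost]
      refine ⟨by norm_num, fun s hs => ?_, fun s hs => ?_⟩
      · rcases Nat.lt_succ_iff_lt_or_eq.1 hs with hs | rfl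
        · rw [Function.update_of_ne hs.ne, h1 s hs]
        · simp [h]
      · rw [Function.update_of_ne (by omega), h2 s (by omega)]

end RAM

/-! ### The worklist computation of the inner greatest fixpoint -/

namespace RAM

/-- The tables that describe a game with `n` states and `E` edges. -/
structure Arena where
  n : ℕ
  E : ℕ
  src : ℕ → ℕ
  act : ℕ → ℕ
  col : ℕ → ℕ
  tgt : ℕ → ℕ
  cnt : ℕ → ℕ

namespace Arena

/-- The moves of player 1 at `s` are coded by the numbers `i * n + s` with `i < cnt s`. -/
structure Valid (T : Arena) : Prop where
  src_lt : ∀ e < T.E, T.src e < T.n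
  tgt_le : ∀ e < T.E, T.tgt e ≤ T.n
  act_eq : ∀ e < T.E, ∃ i < T.cnt (T.src e), T.act e = i * T.n + T.src e
  cnt_pos : ∀ s < T.n, 0 < T.cnt s

/-- The tables and the chains of edges are stored in the memory. -/
structure Stored (T : Arena) (m : Memory) : Prop where
  n : m varN 0 = T.n
  E : m varEdges 0 = T.E
  src : m arrSrc = T.src
  act : m arrAct = T.act
  col : m arrCol = T.col
  tgt : m arrTgt = T.tgt
  cnt : ∀ s < T.n, m arrCnt s = T.cnt s
  head : ∀ t, m arrHead t = prev T.tgt t T.E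
  next : ∀ e < T.E, m arrNext e = prev T.tgt (T.tgt e) e

theorem Stored.congr {T : Arena} {m m' : Memory} (h : T.Stored m)
    (hm : ∀ x, x = 2 ∨ (11 ≤ x ∧ x ≤ 18) → m' x = m x) : T.Stored m' := by
  constructor
  · rw [hm 2 (by norm_num), h.n]
  · rw [hm 11 (by norm_num), h.E]
  · rw [hm 12 (by norm_num), h.src]
  · rw [hm 13 (by norm_num), h.act]
  · rw [hm 14 (by norm_num), h.col]
  · rw [hm 15 (by norm_num), h.tgt]
  · rw [hm 16 (by norm_num)]; exact h.cnt
  · rw [hm 18 (by norm_num)]; exact h.head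
  · rw [hm 17 (by norm_num)]; exact h.next

/-- Every state in `Z` has a move of player 1 such that all edges with a move of player 2 that is
not bad stay in `Z`. -/
def Closed (T : Arena) (bad : ℕ → ℕ) (Z : Set ℕ) : Prop :=
  ∀ s ∈ Z, s < T.n ∧ ∃ i < T.cnt s, ∀ e < T.E, T.act e = i * T.n + s → bad (T.col e) = 0 →
    T.tgt e ∈ Z

/-- The invariant of the computation of the greatest closed set, when the edges in `D` have been
processed, and the states in `q` have been removed. -/
structure Inv (T : Arena) (bad : ℕ → ℕ) (D : Set ℕ) (q : List ℕ) (m : Memory) : Prop where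
  dead : ∀ a, m arrDead a ≠ 0 ↔ ∃ e < T.E, e ∈ D ∧ bad (T.col e) = 0 ∧ T.act e = a
  alive : ∀ s < T.n, m arrAlive s =
    ((Finset.range (T.cnt s)).filter fun i => m arrDead (i * T.n + s) = 0).card
  alive_ge : ∀ s ≥ T.n, m arrAlive s = 0
  back : m varBack 0 = q.length
  queue : ∀ (i x : ℕ), q[i]? = some x → m arrQueue i = x
  nodup : q.Nodup
  mem : ∀ x, x ∈ q ↔ x = T.n ∨ (x < T.n ∧ m arrAlive x = 0)
  sound : ∀ Z, T.Closed bad Z → ∀ x ∈ q, x ∉ Z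

theorem Inv.congr {T : Arena} {bad : ℕ → ℕ} {D D' : Set ℕ} {q : List ℕ} {m m' : Memory}
    (h : T.Inv bad D q m) (hD : ∀ e < T.E, bad (T.col e) = 0 → (e ∈ D' ↔ e ∈ D))
    (h20 : m' arrDead = m arrDead) (h21 : m' arrAlive = m arrAlive)
    (h22 : m' arrQueue = m arrQueue) (h24 : m' varBack = m varBack) : T.Inv bad D' q m' := by
  constructor
  · intro a
    rw [h20, h.dead a]
    constructor
    · rintro ⟨e, h1, h2, h3, h4⟩
      exact ⟨e, h1, (hD e h1 h3).2 h2, h3, h4⟩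
    · rintro ⟨e, h1, h2, h3, h4⟩
      exact ⟨e, h1, (hD e h1 h3).1 h2, h3, h4⟩
  · rw [h20, h21]; exact h.alive
  · rw [h21]; exact h.alive_ge
  · rw [h24]; exact h.back
  · rw [h22]; exact h.queue
  · exact h.nodup
  · rw [h21]; exact h.mem
  · exact h.sound

/-- Division with remainder: the number of a move determines its state and its index. -/
theorem mul_add_inj {n i j s t : ℕ} (hs : s < n) (ht : t < n) (h : i * n + s = j * n + t) :
    i = j ∧ s = t := by
  have h1 : (i * n + s) % n = s := by rw [Nat.mul_comm, Nat.mul_add_mod, Nat.mod_eq_of_lt hs]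
  have h2 : (j * n + t) % n = t := by rw [Nat.mul_comm, Nat.mul_add_mod, Nat.mod_eq_of_lt ht]
  have hst : s = t := by rw [← h1, h, h2]
  subst hst
  refine ⟨Nat.eq_of_mul_eq_mul_right (by omega : 0 < n) (by omega), rfl⟩

/-- The edge leads to a removed state. If its column is not bad and its move is still live, the move
dies and the count of its source drops by one. When the count reaches 0, every move of the source
has a non-bad edge into a removed state, so no closed set contains the source. -/
theorem does_kill {T : Arena} (hT : T.Valid) {bad : ℕ → ℕ} {D : Set ℕ} {q : List ℕ} {m : Memory}
    (hm : T.Stored m) (hbad : m arrBad = bad) (h : T.Inv bad D q m) {e : ℕ} (he : e < T.E)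
    (hidx : m varIdx 0 = e) (ht : T.tgt e ∈ q) (hD : ∀ d ∈ D, T.tgt d ∈ q) :
    Does kill m fun k m' => k ≤ 60 ∧ ∃ q', T.Inv bad (insert e D) (q ++ q') m' := by
  rw [kill]
  have v1 : Exp.val m (.read arrBad (.read arrCol (var varIdx))) = bad (T.col e) := by
    simp [Exp.val, hidx, hm.col, hbad]
  by_cases hb : bad (T.col e) = 0
  swap
  · rw [does_ite_pos (by rwa [v1]), does_skip]
    refine ⟨by simp [Exp.cost], [], ?_⟩
    rw [List.append_nil]
    refine h.congr (fun d hd hbd => ?_) rfl rfl rfl rfl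
    rw [Set.mem_insert_iff, or_iff_right]
    rintro rfl
    exact hb hbd
  rw [does_ite_neg (by rw [v1, hb])]
  have v2 : Exp.val m (.read arrDead (.read arrAct (var varIdx))) = m arrDead (T.act e) := by
    simp [Exp.val, hidx, hm.act]
  by_cases hd : m arrDead (T.act e) = 0
  swap
  · rw [does_ite_pos (by rwa [v2]), does_skip]
    refine ⟨by simp [Exp.cost], [], ?_⟩
    rw [List.append_nil]
    -- The move was killed by an earlier edge `d`, so processing this edge changes nothing.
    obtain ⟨d, hd1, hd2, hd3, hd4⟩ := (h.dead _).1 hd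
    refine ⟨fun a => ?_, h.alive, h.alive_ge, h.back, h.queue, h.nodup, h.mem, h.sound⟩
    rw [h.dead]
    constructor
    · rintro ⟨x, h1, h2, h3⟩
      exact ⟨x, h1, Set.mem_insert_of_mem _ h2, h3⟩
    · rintro ⟨x, h1, h2, h3, h4⟩
      rcases h2 with rfl | h2
      · exact ⟨d, hd1, hd2, hd3, hd4.trans h4⟩
      · exact ⟨x, h1, h2, h3, h4⟩
  rw [does_ite_neg (by rw [v2, hd])]
  obtain ⟨i₀, hi₀, hact⟩ := hT.act_eq e he
  have hsrc := hT.src_lt e he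
  set s := T.src e with hs
  simp only [does_seq, does_write]
  set m₁ := (m.store arrDead (Exp.val m (.read arrAct (var varIdx))) (Exp.val m (.lit 1))) with hm₁
  set m₂ := m₁.store arrAlive (Exp.val m₁ (.read arrSrc (var varIdx)))
    (Exp.val m₁ (.sub (.read arrAlive (.read arrSrc (var varIdx))) (.lit 1))) with hm₂
  have e20 : m₂ arrDead = Function.update (m arrDead) (T.act e) 1 := by
    simp [hm₁, hm₂, Memory.store_ne, Memory.store_same, Exp.val, hidx, hm.act]
  have e21 : m₂ arrAlive = Function.update (m arrAlive) s (m arrAlive s - 1) := by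
    simp [hm₁, hm₂, Memory.store_ne, Memory.store_same, Exp.val, hidx, hm.src, hs]
  have e22 : m₂ arrQueue = m arrQueue := by simp [hm₁, hm₂, Memory.store_ne]
  have e24 : m₂ varBack = m varBack := by simp [hm₁, hm₂, Memory.store_ne]
  have e12 : m₂ arrSrc = T.src := by simp [hm₁, hm₂, Memory.store_ne, hm.src]
  have e26 : m₂ varIdx 0 = e := by simp [hm₁, hm₂, Memory.store_ne, hidx]
  have v3 : Exp.val m₂ (.read arrAlive (.read arrSrc (var varIdx))) = m arrAlive s - 1 := by
    simp [Exp.val, e12, e26, e21, hs]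
  have hdead : ∀ a, m₂ arrDead a ≠ 0 ↔
      ∃ d < T.E, d ∈ insert e D ∧ bad (T.col d) = 0 ∧ T.act d = a := by
    intro a
    rw [e20]
    by_cases ha : a = T.act e
    · subst ha
      simp only [Function.update_self, ne_eq, one_ne_zero, not_false_eq_true, true_iff]
      exact ⟨e, he, Set.mem_insert _ _, hb, rfl⟩
    · rw [Function.update_of_ne ha, h.dead]
      constructor
      · rintro ⟨x, h1, h2, h3⟩
        exact ⟨x, h1, Set.mem_insert_of_mem _ h2, h3⟩
      · rintro ⟨x, h1, h2, h3, h4⟩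
        rcases h2 with rfl | h2
        · exact absurd h4.symm ha
        · exact ⟨x, h1, h2, h3, h4⟩
  have halive : ∀ r < T.n, m₂ arrAlive r =
      ((Finset.range (T.cnt r)).filter fun i => m₂ arrDead (i * T.n + r) = 0).card := by
    intro r hr
    by_cases hrs : r = s
    · subst hrs
      rw [e21, Function.update_self, h.alive _ hr, e20]
      -- Exactly the index `i₀` leaves the set of live moves of the source.
      have : ((Finset.range (T.cnt (T.src e))).filter fun i =>
          Function.update (m arrDead) (T.act e) 1 (i * T.n + T.src e) = 0) =
          ((Finset.range (T.cnt (T.src e))).filter fun i =>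
            m arrDead (i * T.n + T.src e) = 0).erase i₀ := by
        ext i
        rw [Finset.mem_erase, Finset.mem_filter, Finset.mem_filter]
        by_cases hi : i = i₀
        · subst hi
          simp [hact, ← hs]
        · rw [Function.update_of_ne]
          · tauto
          · rw [hact]
            intro h'
            exact hi (mul_add_inj hr hr h').1
      rw [this, Finset.card_erase_of_mem]
      rw [Finset.mem_filter, Finset.mem_range, ← hact]
      exact ⟨hi₀, hd⟩
    · rw [e21, Function.update_of_ne hrs, h.alive r hr, e20]
      congr 1
      refine Finset.filter_congr fun i _ => ?_
      rw [Function.update_of_ne]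
      rw [hact]
      intro h'
      exact hrs (mul_add_inj hr hsrc h').2
  have hge : ∀ r ≥ T.n, m₂ arrAlive r = 0 := by
    intro r hr
    rw [e21, Function.update_of_ne (by omega), h.alive_ge r hr]
  -- Before the kill this move was live, so the truncated subtraction is exact and the source is not
  -- yet in the queue.
  have hpos : m arrAlive s ≠ 0 := by
    rw [h.alive s hsrc]
    refine (Finset.card_pos.2 ⟨i₀, ?_⟩).ne'
    rw [Finset.mem_filter, Finset.mem_range, ← hact]
    exact ⟨hi₀, hd⟩
  have hsq : s ∉ q := by
    intro hq
    rcases (h.mem s).1 hq with h1 | h1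
    · omega
    · exact hpos h1.2
  by_cases hz : m arrAlive s - 1 = 0
  · rw [does_ite_neg (by rw [v3, hz])]
    simp only [does_seq, does_write]
    refine ⟨by simp [Exp.cost], [s], ?_⟩
    set m₃ := Memory.store (m₂.store arrQueue (Exp.val m₂ (var varBack))
      (Exp.val m₂ (.read arrSrc (var varIdx)))) varBack _ _ with hm₃
    have g20 : m₃ arrDead = m₂ arrDead := by simp [hm₃, Memory.store_ne]
    have g21 : m₃ arrAlive = m₂ arrAlive := by simp [hm₃, Memory.store_ne]
    refine ⟨?_, ?_, ?_, ?_, ?_, ?_, ?_, ?_⟩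
    · rw [g20]; exact hdead
    · rw [g20, g21]; exact halive
    · rw [g21]; exact hge
    · simp [hm₃, Memory.store_ne, Memory.store_same, Exp.val, e24, h.back]
    · intro i x hx
      simp only [hm₃, Memory.store_ne, Memory.store_same, Exp.val, e24, e22, e12, e26, h.back,
        ne_eq, Nat.reduceEqDiff, not_false_eq_true]
      rcases lt_trichotomy i q.length with hi | rfl | hi
      · rw [Function.update_of_ne hi.ne]
        rw [List.getElem?_append_left hi] at hx
        exact h.queue i x hx
      · rw [Function.update_self]
        simpa using hx
      · rw [List.getElem?_eq_none (by simp; omega)] at hx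
        simp at hx
    · rw [List.nodup_append]
      refine ⟨h.nodup, List.nodup_singleton _, fun a ha b hb hab => ?_⟩
      rw [List.mem_singleton] at hb
      exact hsq (hb ▸ hab ▸ ha)
    · intro x
      rw [g21, e21, List.mem_append, List.mem_singleton]
      by_cases hx : x = s
      · subst hx
        simp [hz, hsrc]
      · rw [Function.update_of_ne hx, h.mem]
        tauto
    · intro Z hZ x hx hxZ
      rw [List.mem_append, List.mem_singleton] at hx
      rcases hx with hx | rfl
      · exact h.sound Z hZ x hx hxZ
      -- Whichever move a closed set uses at the new state, that move is dead, so one of its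
      -- processed edges would put a removed state into the closed set.
      · obtain ⟨_, i, hi, hi'⟩ := hZ _ hxZ
        have h1 : m₂ arrAlive s = 0 := by rw [e21, Function.update_self, hz]
        rw [halive s hsrc, Finset.card_eq_zero, Finset.filter_eq_empty_iff] at h1
        obtain ⟨d, hd1, hd2, hd3, hd4⟩ := (hdead _).1 (h1 (Finset.mem_range.2 hi))
        have h2 := hi' d hd1 hd4 hd3
        rcases hd2 with rfl | hd2
        · exact h.sound Z hZ _ ht h2
        · exact h.sound Z hZ _ (hD d hd2) h2
  · rw [does_ite_pos (by rwa [v3]), does_skip]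
    refine ⟨by simp [Exp.cost], [], ?_⟩
    rw [List.append_nil]
    refine ⟨hdead, halive, hge, by rw [e24, h.back], by rw [e22]; exact h.queue, h.nodup, ?_,
      h.sound⟩
    intro x
    rw [h.mem, e21]
    by_cases hx : x = s
    · subst hx
      simp [hz, hpos]
    · rw [Function.update_of_ne hx]

/-- Induction on a bound for the edge numbers: an edge with another target does not change `prev`,
and an edge with target `t` is the next of the chain. Only the latter are charged. -/
theorem does_killChain {T : Arena} (hT : T.Valid) {bad : ℕ → ℕ} {t : ℕ} (c : ℕ) (hc : c ≤ T.E)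
    {D : Set ℕ} {q : List ℕ} {m : Memory} (hm : T.Stored m) (hbad : m arrBad = bad)
    (h : T.Inv bad D q m) (hcur : m varCur 0 = prev T.tgt t c) (ht : t ∈ q)
    (hD : ∀ d ∈ D, T.tgt d ∈ q) :
    Does killChain m fun k m' => k ≤ 100 * Nat.count (fun e => T.tgt e = t) c + 10 ∧
      ∃ q', T.Inv bad (D ∪ {e | e < c ∧ T.tgt e = t}) (q ++ q') m' := by
  induction c generalizing D q m with
  | zero =>
    rw [killChain, does_loop_neg (by simpa [Exp.val, prev] using hcur)]
    refine ⟨by simp [Exp.cost], [], ?_⟩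
    rw [List.append_nil]
    exact h.congr (by simp) rfl rfl rfl rfl
  | succ c ih =>
    by_cases htc : T.tgt c = t
    swap
    · simp only [prev, if_neg htc] at hcur
      refine (ih (by omega) hm hbad h hcur ht hD).mono fun k m' ⟨h1, q', h2⟩ => ?_
      refine ⟨by simpa [Nat.count_succ, htc] using h1, q', h2.congr (fun e _ _ => ?_) rfl rfl rfl rfl⟩
      simp only [Set.mem_union, Set.mem_ofPred_eq]
      refine or_congr Iff.rfl (and_congr_left fun h3 => ?_)
      have : e ≠ c := fun h4 => htc (h4 ▸ h3)
      omega
    simp only [prev, if_pos htc] at hcur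
    rw [killChain, does_loop_pos (by simp [Exp.val, hcur]), ← killChain]
    simp only [does_seq, does_write]
    refine (does_kill hT (D := D) (q := q) (bad := bad) (e := c) ?_ ?_ ?_ (by omega) ?_ ?_
      hD).frame.mono fun k m₁ ⟨⟨h1, q₁, h2⟩, h3⟩ => ?_
    · exact hm.congr fun x hx => Memory.store_ne _ (by omega) _ _
    · simp [Memory.store_ne, hbad]
    · exact h.congr (fun _ _ _ => Iff.rfl) (by simp [Memory.store_ne]) (by simp [Memory.store_ne])
        (by simp [Memory.store_ne]) (by simp [Memory.store_ne])
    · simp [Memory.store_same, Exp.val, hcur]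
    · rwa [htc]
    have hf : ∀ x, x = 2 ∨ (11 ≤ x ∧ x ≤ 18) ∨ x = 19 → m₁ x = m x := by
      intro x hx
      rw [h3 x, Memory.store_ne _ (by omega)]
      simp only [kill, Program.writes, Bool.or_eq_false_iff, beq_eq_false_iff_ne, true_and]
      omega
    have hm₁ : T.Stored m₁ := hm.congr fun x hx => hf x (by tauto)
    have h26 : m₁ varIdx 0 = c := by
      rw [h3 26 rfl]
      simp [Memory.store_same, Exp.val, hcur]
    refine (ih (D := insert c D) (q := q ++ q₁) (by omega) ?_ ?_ ?_ ?_ ?_ ?_).mono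
      fun k' m₂ ⟨h4, q₂, h5⟩ => ?_
    · exact hm₁.congr fun x hx => Memory.store_ne _ (by omega) _ _
    · simp [Memory.store_ne, hf, hbad]
    · exact h2.congr (fun _ _ _ => Iff.rfl) (by simp [Memory.store_ne]) (by simp [Memory.store_ne])
        (by simp [Memory.store_ne]) (by simp [Memory.store_ne])
    · simp only [Memory.store_same, Exp.val, Function.update_self, h26]
      rw [hm₁.next c (by omega), htc]
    · exact List.mem_append_left _ ht
    · intro d hd
      rcases hd with rfl | hd
      · exact List.mem_append_left _ (htc ▸ ht)
      · exact List.mem_append_left _ (hD d hd)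
    · refine ⟨?_, q₁ ++ q₂, ?_⟩
      · rw [Nat.count_succ, if_pos htc]
        simp only [Exp.cost]
        omega
      · rw [← List.append_assoc]
        refine h5.congr (fun e _ _ => ?_) rfl rfl rfl rfl
        simp only [Set.mem_union, Set.mem_ofPred_eq, Set.mem_insert_iff]
        constructor
        · rintro (h6 | ⟨h6, h7⟩)
          · exact .inl (.inr h6)
          · rcases Nat.lt_succ_iff_lt_or_eq.1 h6 with h8 | h8
            · exact .inr ⟨h8, h7⟩
            · exact .inl (.inl h8)
        · rintro ((h6 | h6) | ⟨h6, h7⟩)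
          · exact .inr ⟨by omega, h6 ▸ htc⟩
          · exact .inl h6
          · exact .inr ⟨by omega, h7⟩

/-- The amortisation: taking `t` from the queue uses up precisely the charge of the edges with
target `t`. -/
theorem count_notMem_append {f : ℕ → ℕ} {l : List ℕ} {t : ℕ} (ht : t ∉ l) (c : ℕ) :
    Nat.count (fun e => f e ∉ l ++ [t]) c + Nat.count (fun e => f e = t) c =
      Nat.count (fun e => f e ∉ l) c := by
  induction c with
  | zero => simp
  | succ c ih =>
    simp only [Nat.count_succ, ← ih]
    by_cases h1 : f c = t
    · simp [h1, ht]; omega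
    · by_cases h2 : f c ∈ l <;> simp [h1, h2]
      omega

/-- The queue has no repetitions and contains numbers up to n only, so it empties after at most n +
1 rounds; `d` bounds those remaining. Each edge is charged once, when its target is taken from the
queue. -/
theorem does_killQueue {T : Arena} (hT : T.Valid) {bad : ℕ → ℕ} (d : ℕ) {q₁ q₂ : List ℕ}
    (hd : T.n + 1 - q₁.length ≤ d) {m : Memory} (hm : T.Stored m) (hbad : m arrBad = bad)
    (h : T.Inv bad {e | T.tgt e ∈ q₁} (q₁ ++ q₂) m) (hfront : m varFront 0 = q₁.length) :
    Does killQueue m fun k m' => k ≤ 100 * Nat.count (fun e => T.tgt e ∉ q₁) T.E + 60 * d + 10 ∧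
      ∃ q, T.Inv bad {e | T.tgt e ∈ q} q m' := by
  induction d generalizing q₁ q₂ m with
  | zero =>
    cases q₂ with
    | nil =>
      rw [List.append_nil] at h
      rw [killQueue, does_loop_neg (by simp [Exp.val, hfront, h.back])]
      exact ⟨by simp [Exp.cost], q₁, h⟩
    | cons t q₂ =>
      exfalso
      -- With no rounds left, n + 1 states have been processed, and there is no room for another.
      have h1 : (q₁ ++ t :: q₂).length ≤ T.n + 1 := by
        rw [← List.toFinset_card_of_nodup h.nodup, ← Finset.card_range (T.n + 1)]
        refine Finset.card_le_card fun x hx => ?_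
        rw [List.mem_toFinset, h.mem] at hx
        rw [Finset.mem_range]
        omega
      rw [List.length_append, List.length_cons] at h1
      omega
  | succ d ih =>
    cases q₂ with
    | nil =>
      rw [List.append_nil] at h
      rw [killQueue, does_loop_neg (by simp [Exp.val, hfront, h.back])]
      refine ⟨by simp only [Exp.cost]; omega, q₁, h⟩
    | cons t q₂ =>
      rw [killQueue, does_loop_pos (by simp [Exp.val, hfront, h.back]), ← killQueue]
      simp only [does_seq, does_write]
      have hqt : m arrQueue q₁.length = t := h.queue _ _ (by simp)
      refine (does_killChain hT (t := t) (bad := bad) (D := {e | T.tgt e ∈ q₁})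
        (q := q₁ ++ t :: q₂) T.E le_rfl ?_ ?_ ?_ ?_ (by simp) ?_).frame.mono
        fun k m₁ ⟨⟨h1, q', h2⟩, h3⟩ => ?_
      · exact hm.congr fun x hx => by rw [Memory.store_ne _ (by omega), Memory.store_ne _ (by omega)]
      · simp [Memory.store_ne, hbad]
      · exact h.congr (fun _ _ _ => Iff.rfl) (by simp [Memory.store_ne]) (by simp [Memory.store_ne])
          (by simp [Memory.store_ne]) (by simp [Memory.store_ne])
      · simp [Memory.store_same, Memory.store_ne, Exp.val, hfront, hqt, hm.head]
      · intro e he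
        exact List.mem_append_left _ he
      have hf : ∀ x, x = 2 ∨ (11 ≤ x ∧ x ≤ 18) ∨ x = 19 → m₁ x = m x := by
        intro x hx
        rw [h3 x, Memory.store_ne _ (by omega), Memory.store_ne _ (by omega)]
        simp only [killChain, kill, Program.writes, Bool.or_eq_false_iff, beq_eq_false_iff_ne,
          true_and]
        omega
      have ht : t ∉ q₁ := by
        have := h.nodup
        rw [List.nodup_append] at this
        intro h'
        exact this.2.2 t h' t List.mem_cons_self rfl
      refine (ih (q₁ := q₁ ++ [t]) (q₂ := q₂ ++ q') ?_ ?_ ?_ ?_ ?_).mono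
        fun k' m₂ ⟨h4, h5⟩ => ⟨?_, h5⟩
      · rw [List.length_append, List.length_singleton]
        omega
      · exact hm.congr fun x hx => hf x (by tauto)
      · rw [hf 19 (by norm_num), hbad]
      · have e1 : q₁ ++ [t] ++ (q₂ ++ q') = q₁ ++ t :: q₂ ++ q' := by simp
        rw [e1]
        refine h2.congr (fun e he _ => ?_) rfl rfl rfl rfl
        simp [he]
      · rw [h3 23 rfl]
        simp [Memory.store_same, Memory.store_ne, Exp.val, hfront]
      · have e2 := count_notMem_append (f := T.tgt) ht T.E
        simp only [Exp.cost]
        omega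

/-- The computation of the greatest closed set. -/
theorem does_innerFixpoint {T : Arena} (hT : T.Valid) {m : Memory} (hm : T.Stored m)
    (hdead : ∀ a, m arrDead a = 0) (halive : ∀ s < T.n, m arrAlive s = T.cnt s)
    (hge : ∀ s ≥ T.n, m arrAlive s = 0) :
    Does innerFixpoint m fun k m' => k ≤ 200 * (T.E + T.n + 1) ∧
      T.Closed (m arrBad) {s | m' arrAlive s ≠ 0} ∧
      (∀ Z, T.Closed (m arrBad) Z → ∀ s ∈ Z, m' arrAlive s ≠ 0) ∧
      (∀ a, m' arrDead a ≠ 0 → ∃ e < T.E, T.act e = a) ∧ ∀ s ≥ T.n, m' arrAlive s = 0 := by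
  simp only [innerFixpoint, does_seq, does_write]
  refine (does_killQueue hT (q₁ := []) (q₂ := [T.n]) (bad := m arrBad) (T.n + 1) (by simp)
    ?_ ?_ ?_ ?_).mono fun k m' ⟨h1, q, h2⟩ => ⟨?_, ?_, ?_, ?_, h2.alive_ge⟩
  · exact hm.congr fun x hx => by
      rw [Memory.store_ne _ (by omega), Memory.store_ne _ (by omega), Memory.store_ne _ (by omega)]
  · simp [Memory.store_ne]
  · constructor
    · intro a
      simp [Memory.store_ne, hdead]
    · intro s hs
      simp [Memory.store_ne, hdead, halive s hs]
    · simpa [Memory.store_ne] using hge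
    · simp [Memory.store_same, Exp.val]
    · intro i x hx
      cases i with
      | zero =>
        simp only [List.nil_append, List.getElem?_cons_zero, Option.some.injEq] at hx
        simp [Memory.store_ne, Memory.store_same, Exp.val, hm.n, hx]
      | succ i => simp at hx
    · simp
    · intro x
      simp only [List.nil_append, List.mem_singleton, Memory.store_ne, ne_eq, Nat.reduceEqDiff,
        not_false_eq_true]
      -- At the start only the additional state is queued, since every proper state has a move.
      refine (or_iff_left ?_).symm
      rintro ⟨h1, h2⟩
      rw [halive x h1] at h2
      exact (hT.cnt_pos x h1).ne' h2
    · intro Z hZ x hx hxZ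
      have := (hZ x hxZ).1
      simp only [List.nil_append, List.mem_singleton] at hx
      omega
  · simp [Memory.store_same, Memory.store_ne, Exp.val]
  · have h3 := Nat.count_le (p := fun e => T.tgt e ∉ ([] : List ℕ)) (n := T.E)
    simp only [Exp.cost]
    omega
  · intro s hs
    have hsn : s < T.n := by
      by_contra h'
      exact hs (h2.alive_ge s (by omega))
    refine ⟨hsn, ?_⟩
    have hs' : m' arrAlive s ≠ 0 := hs
    rw [h2.alive s hsn] at hs'
    obtain ⟨i, hi⟩ := Finset.card_pos.1 (Nat.pos_of_ne_zero hs')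
    rw [Finset.mem_filter, Finset.mem_range] at hi
    -- A surviving state has a live move. If a non-bad edge of this move led to a removed state, the
    -- edge would have been processed, and the move would be dead.
    refine ⟨i, hi.1, fun e he hact hb h0 => ?_⟩
    refine (h2.dead (i * T.n + s)).2 ⟨e, he, ?_, hb, hact⟩ hi.2
    change T.tgt e ∈ q
    rw [h2.mem]
    rcases (hT.tgt_le e he).lt_or_eq with h4 | h4
    · exact .inr ⟨h4, h0⟩
    · exact .inl h4
  · intro Z hZ s hs h0
    exact h2.sound Z hZ s ((h2.mem s).2 (.inr ⟨(hZ s hs).1, h0⟩)) hs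
  · intro a ha
    obtain ⟨e, he, _, _, h4⟩ := (h2.dead a).1 ha
    exact ⟨e, he, h4⟩

end Arena

end RAM

/-! ### The outer iteration and the whole program -/

namespace RAM

namespace Arena

/-- `Closed`, where the bad moves of player 2 are those with an edge into `Y`. -/
def ClosedOutside (T : Arena) (Y Z : Set ℕ) : Prop :=
  ∀ s ∈ Z, s < T.n ∧ ∃ i < T.cnt s, ∀ e < T.E, T.act e = i * T.n + s →
    (∀ d < T.E, T.col d = T.col e → T.tgt d ∉ Y) → T.tgt e ∈ Z

/-- The greatest closed set. -/
def step (T : Arena) (Y : Set ℕ) : Set ℕ := ⋃₀ {Z | T.ClosedOutside Y Z}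

/-- The memory between the iterations, when `Y` is the current approximation. -/
structure Ready (T : Arena) (Y : Set ℕ) (m : Memory) : Prop where
  stored : T.Stored m
  dead : ∀ a, m arrDead a ≠ 0 → ∃ e < T.E, T.act e = a
  alive : ∀ s, m arrAlive s ≠ 0 ↔ s ∈ Y
  alive_ge : ∀ s ≥ T.n, m arrAlive s = 0

/-- Once the marks are seen to describe exactly the columns with an edge into `Y`, closedness for
the marks is `ClosedOutside Y`. The surviving states form a closed set containing every other, hence
the union of all closed sets. -/
theorem does_iteration {T : Arena} (hT : T.Valid) {Y : Set ℕ} {m : Memory} (h : T.Ready Y m) :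
    Does iteration m fun k m' => k ≤ 400 * (T.E + T.n + 1) ∧ T.Ready (T.step Y) m' := by
  rw [iteration]
  simp only [does_seq]
  have hm := h.stored
  refine (does_clear m).frame.mono fun k₁ m₁ ⟨⟨h1, h2, h3⟩, h4⟩ => ?_
  have hm₁ : T.Stored m₁ := hm.congr fun x hx => h4 x (by
    simp only [clear, forIdx, Program.writes, Bool.or_eq_false_iff, beq_eq_false_iff_ne]; omega)
  have c1 : m₁ arrCol = m arrCol := by rw [hm₁.col, hm.col]
  have E1 : m₁ varEdges = m varEdges := h4 11 rfl
  refine (does_markBad (m := m₁) ?_).frame.mono fun k₂ m₂ ⟨⟨h5, h6⟩, h7⟩ => ?_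
  · rw [c1, E1]
    exact fun e he => (h2 e he).1
  have hm₂ : T.Stored m₂ := hm₁.congr fun x hx => h7 x (by
    simp only [markBad, forIdx, Program.writes, Bool.or_eq_false_iff, beq_eq_false_iff_ne,
      and_true]
    omega)
  refine (does_revive m₂).frame.mono fun k₃ m₃ ⟨⟨h8, h9, h10⟩, h11⟩ => ?_
  have hm₃ : T.Stored m₃ := hm₂.congr fun x hx => h11 x (by
    simp only [revive, forIdx, Program.writes, Bool.or_eq_false_iff, beq_eq_false_iff_ne]; omega)
  have hge : ∀ s ≥ T.n, m₃ arrAlive s = 0 := by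
    intro s hs
    rw [h10 s (by rwa [hm₂.n]), h7 21 rfl, h4 21 rfl, h.alive_ge s hs]
  refine (does_innerFixpoint hT hm₃ ?_ ?_ hge).frame.mono
    fun k₄ m₄ ⟨⟨h12, h13, h14, h15, h16⟩, h17⟩ => ?_
  · intro a
    -- A dead cell is either 0 already or belongs to an edge and has been cleared.
    rw [h11 20 rfl, h7 20 rfl]
    by_cases ha : m arrDead a = 0
    · exact h3 a ha
    · obtain ⟨e, he, rfl⟩ := h.dead a ha
      have := (h2 e (by rwa [hm.E])).2
      rwa [hm.act] at this
  · intro s hs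
    rw [h9 s (by rwa [hm₂.n]), hm₂.cnt s hs]
  have hbad : ∀ e < T.E, m₃ arrBad (T.col e) = 0 ↔
      ∀ d < T.E, T.col d = T.col e → T.tgt d ∉ Y := by
    intro e he
    have := h6 e (by rwa [hm₁.E])
    rw [hm₁.col, hm₁.E, hm₁.tgt, h4 21 rfl] at this
    simp only [h.alive] at this
    rw [h11 19 rfl, ← not_iff_not, ← ne_eq, this]
    push Not
    rfl
  have hclosed : ∀ Z, T.Closed (m₃ arrBad) Z ↔ T.ClosedOutside Y Z := by
    intro Z
    refine forall₂_congr fun s _ => and_congr Iff.rfl (exists_congr fun i => and_congr Iff.rfl ?_)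
    refine forall₂_congr fun e he => ?_
    rw [hbad e he]
  refine ⟨?_, ?_, h15, ?_, h16⟩
  · rw [hm.E] at h1
    rw [hm₁.E] at h5
    rw [hm₂.n] at h8
    omega
  · exact hm₃.congr fun x hx => h17 x (by
      simp only [innerFixpoint, killQueue, killChain, kill, Program.writes, Bool.or_eq_false_iff,
        beq_eq_false_iff_ne, true_and]
      omega)
  · intro s
    constructor
    · intro hs
      exact ⟨_, (hclosed _).1 h13, hs⟩
    · rintro ⟨Z, hZ, hs⟩
      exact h14 Z ((hclosed Z).2 hZ) s hs

theorem does_rounds {T : Arena} (hT : T.Valid) (r : ℕ) {Y : Set ℕ} {m : Memory} (h : T.Ready Y m)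
    (hr : m varRound 0 = r) :
    Does (.loop (var varRound) (.seq iteration (dec varRound))) m fun k m' =>
      k ≤ (400 * (T.E + T.n + 1) + 20) * r + 10 ∧ T.Ready (T.step^[r] Y) m' := by
  induction r generalizing Y m with
  | zero =>
    rw [does_loop_neg (by simpa [Exp.val] using hr)]
    exact ⟨by simp [Exp.cost], h⟩
  | succ r ih =>
    rw [does_loop_pos (by simp [Exp.val, hr]), does_seq]
    refine (does_iteration hT h).frame.mono fun k m₁ ⟨⟨h1, h2⟩, h3⟩ => ?_
    rw [does_write]
    have e27 : m₁ varRound = m varRound := h3 27 rfl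
    refine (ih (Y := T.step Y) ⟨?_, ?_, ?_, ?_⟩ ?_).mono fun k' m₂ ⟨h4, h5⟩ => ⟨?_, ?_⟩
    · exact h2.stored.congr fun x hx => Memory.store_ne _ (by omega) _ _
    · simpa [Memory.store_ne] using h2.dead
    · simpa [Memory.store_ne] using h2.alive
    · simpa [Memory.store_ne] using h2.alive_ge
    · simp [Memory.store_same, Exp.val, e27, hr]
    · rw [Nat.mul_succ]
      simp only [Exp.cost]
      omega
    · rwa [Function.iterate_succ_apply]

/-- The arena has the given numbers of moves and edges. -/
structure Presents (T : Arena) (xs : List (ℕ × List (List (ℕ × List ℕ)))) : Prop where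
  n : T.n = xs.length
  E : T.E = (gameEdges xs.length 0 xs).length
  cnt : ∀ i x, xs[i]? = some x → T.cnt i = x.2.length
  edge : ∀ (i : ℕ) (e : Edge), (gameEdges xs.length 0 xs)[i]? = some e →
    T.src i = e.src ∧ T.act i = e.act ∧ T.col i = e.col ∧ T.tgt i = e.tgt

end Arena

/-- The arena is read off the memory after parsing, and its tables are prescribed only on the actual
edges and states; hence validity is required of every arena presenting the input. -/
theorem does_fixpointProgram (xs : List (ℕ × List (List (ℕ × List ℕ))))
    (hw : ∀ x ∈ xs, ∀ row ∈ x.2, row.length = x.1) (hw0 : ∀ x ∈ xs, 0 < x.1)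
    (hvalid : ∀ T : Arena, T.Presents xs → T.Valid) :
    Does fixpointProgram (init (xs.length :: xs.flatMap stateCode)) fun k m =>
      k ≤ 1000 * ((xs.flatMap stateCode).length + (gameEdges xs.length 0 xs).length +
        (xs.length + 1) * ((gameEdges xs.length 0 xs).length + xs.length + 1)) ∧
      ∃ T : Arena, T.Presents xs ∧ ∀ s < xs.length,
        (s ∈ T.step^[xs.length] ∅ → m arrOut s = 1) ∧
        (s ∉ T.step^[xs.length] ∅ → m arrOut s = 0) := by
  rw [fixpointProgram]
  simp only [does_seq]
  refine (does_readInput xs hw hw0).mono fun k₁ m₁ ⟨h1, h2, h3, h4, h5⟩ => ?_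
  let T : Arena := ⟨m₁ 2 0, m₁ 11 0, m₁ 12, m₁ 13, m₁ 14, m₁ 15, m₁ 16⟩
  have hTE : T.E = (gameEdges xs.length 0 xs).length := h3.1
  have hTn : T.n = xs.length := h2
  have hP : T.Presents xs := ⟨hTn, hTE, h4, h3.2⟩
  have hT := hvalid T hP
  refine (does_link (m := m₁) (by simp [h5])).frame.mono fun k₂ m₂ ⟨⟨h6, h7, h8⟩, h9⟩ => ?_
  have hf : ∀ x, x ≠ 17 → x ≠ 18 → x ≠ 26 → m₂ x = m₁ x := by
    intro x h17 h18 h26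
    refine h9 x ?_
    simp only [link, forIdx, Program.writes, Bool.or_eq_false_iff, beq_eq_false_iff_ne]
    omega
  have hS : T.Stored m₂ := by
    refine ⟨?_, ?_, ?_, ?_, ?_, ?_, ?_, h7, h8⟩
    · rw [hf 2 (by norm_num) (by norm_num) (by norm_num)]
    · rw [hf 11 (by norm_num) (by norm_num) (by norm_num)]
    · rw [hf 12 (by norm_num) (by norm_num) (by norm_num)]
    · rw [hf 13 (by norm_num) (by norm_num) (by norm_num)]
    · rw [hf 14 (by norm_num) (by norm_num) (by norm_num)]
    · rw [hf 15 (by norm_num) (by norm_num) (by norm_num)]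
    · rw [hf 16 (by norm_num) (by norm_num) (by norm_num)]
      exact fun _ _ => rfl
  have hz : ∀ x, x = 1 ∨ x = 20 ∨ x = 21 → m₂ x = fun _ => 0 := by
    intro x hx
    rw [hf x (by omega) (by omega) (by omega), h5 x (by omega)]
  rw [does_write]
  refine (Arena.does_rounds hT xs.length (Y := ∅) ⟨?_, ?_, ?_, ?_⟩ ?_).frame.mono
    fun k₃ m₃ ⟨⟨h10, h11⟩, h12⟩ => ?_
  · exact hS.congr fun x hx => Memory.store_ne _ (by omega) _ _
  · simp [Memory.store_ne, hz]
  · simp [Memory.store_ne, hz]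
  · simp [Memory.store_ne, hz]
  · simp only [Memory.store_same, Exp.val, Function.update_self]
    rw [hS.n, hTn]
  have e2 : m₃ varN 0 = xs.length := by rw [h11.stored.n, hTn]
  have e1 : m₃ arrOut = fun _ => 0 := by
    rw [h12 1 rfl, Memory.store_ne _ (by norm_num), hz 1 (by norm_num)]
  refine (does_output (m := m₃) (by simp [e1])).mono fun k₄ m₄ ⟨h13, h14⟩ => ⟨?_, T, hP, ?_⟩
  · rw [← hTE]
    rw [e2] at h13
    rw [hTn] at h10
    have h6' : k₂ ≤ 60 * T.E + 20 := h6
    simp only [Exp.cost]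
    have e3 : (400 * (T.E + xs.length + 1) + 20) * xs.length ≤
        420 * (xs.length * (T.E + xs.length + 1)) := by
      have : 20 * xs.length ≤ 20 * (xs.length * (T.E + xs.length + 1)) := by
        gcongr
        exact Nat.le_mul_of_pos_right _ (by omega)
      linarith
    rw [Nat.add_mul, one_mul]
    omega
  · intro s hs
    rw [h14 s (by rwa [e2]), ← h11.alive s]
    constructor
    · intro h; rw [if_neg h]
    · intro h; rw [if_pos (not_not.1 h)]

end RAM

/-! ### Edges of the encoded game and their number -/

namespace RAM

theorem mem_rowEdges {n s a : ℕ} {e : Edge} (row : List (ℕ × List ℕ)) (b : ℕ) :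
    e ∈ rowEdges n s a b row ↔ ∃ (j : ℕ) (x : ℕ × List ℕ), row[j]? = some x ∧
      ∃ t ∈ targets n x.1 x.2, e = ⟨s, a, j * n + b, t⟩ := by
  induction row generalizing b with
  | nil => simp [rowEdges]
  | cons x row ih =>
    obtain ⟨r, ts⟩ := x
    rw [rowEdges, List.mem_append, List.mem_map, ih]
    constructor
    · rintro (⟨t, ht, rfl⟩ | ⟨j, x, hx, t, ht, rfl⟩)
      · exact ⟨0, (r, ts), rfl, t, ht, by simp⟩
      · exact ⟨j + 1, x, by simpa using hx, t, ht, by congr 1; ring⟩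
    · rintro ⟨j, x, hx, t, ht, rfl⟩
      cases j with
      | zero =>
        simp only [List.getElem?_cons_zero, Option.some.injEq] at hx
        subst hx
        exact .inl ⟨t, ht, by simp⟩
      | succ j => exact .inr ⟨j, x, by simpa using hx, t, ht, by congr 1; ring⟩

theorem mem_stateEdges {n s : ℕ} {e : Edge} (rows : List (List (ℕ × List ℕ))) (a : ℕ) :
    e ∈ stateEdges n s a rows ↔ ∃ (i : ℕ) (row : List (ℕ × List ℕ)), rows[i]? = some row ∧
      e ∈ rowEdges n s (i * n + a) s row := by
  induction rows generalizing a with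
  | nil => simp [stateEdges]
  | cons row rows ih =>
    rw [stateEdges, List.mem_append, ih]
    constructor
    · rintro (h | ⟨i, x, hx, h⟩)
      · exact ⟨0, row, rfl, by simpa using h⟩
      · refine ⟨i + 1, x, by simpa using hx, ?_⟩
        rwa [show (i + 1) * n + a = i * n + (a + n) by ring]
    · rintro ⟨i, x, hx, h⟩
      cases i with
      | zero =>
        simp only [List.getElem?_cons_zero, Option.some.injEq] at hx
        subst hx
        exact .inl (by simpa using h)
      | succ i =>
        refine .inr ⟨i, x, by simpa using hx, ?_⟩
        rwa [show i * n + (a + n) = (i + 1) * n + a by ring]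

theorem mem_gameEdges {n : ℕ} {e : Edge} (xs : List (ℕ × List (List (ℕ × List ℕ)))) (s : ℕ) :
    e ∈ gameEdges n s xs ↔ ∃ (k : ℕ) (x : ℕ × List (List (ℕ × List ℕ))), xs[k]? = some x ∧
      e ∈ stateEdges n (k + s) (k + s) x.2 := by
  induction xs generalizing s with
  | nil => simp [gameEdges]
  | cons x xs ih =>
    rw [gameEdges, List.mem_append, ih]
    constructor
    · rintro (h | ⟨k, x, hx, h⟩)
      · exact ⟨0, x, rfl, by simpa using h⟩
      · refine ⟨k + 1, x, by simpa using hx, ?_⟩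
        rwa [show k + 1 + s = k + (s + 1) by ring]
    · rintro ⟨k, y, hy, h⟩
      cases k with
      | zero =>
        simp only [List.getElem?_cons_zero, Option.some.injEq] at hy
        subst hy
        exact .inl (by simpa using h)
      | succ k =>
        refine .inr ⟨k, y, by simpa using hy, ?_⟩
        rwa [show k + (s + 1) = k + 1 + s by ring]

/-- The possible additional edge of a transition is paid for by the two header cells of its record.
-/
theorem length_rowEdges_le (n s a b : ℕ) (row : List (ℕ × List ℕ)) :
    (rowEdges n s a b row).length ≤ (rowCode row).length := by
  induction row generalizing b with
  | nil => simp [rowEdges]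
  | cons x row ih =>
    obtain ⟨r, ts⟩ := x
    have := ih (b + n)
    simp only [rowEdges, rowCode, List.flatMap_cons, List.length_append, List.length_map, targets,
      List.length_cons] at this ⊢
    have h1 : (if r = 0 then [n] else []).length ≤ 1 := by split_ifs <;> simp
    omega

theorem length_stateEdges_le (n s a : ℕ) (rows : List (List (ℕ × List ℕ))) :
    (stateEdges n s a rows).length ≤ (rows.flatMap rowCode).length := by
  induction rows generalizing a with
  | nil => simp [stateEdges]
  | cons row rows ih =>
    have := ih (a + n)
    have h := length_rowEdges_le n s a s row
    simp only [stateEdges, List.flatMap_cons, List.length_append]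
    omega

theorem length_gameEdges_le (n s : ℕ) (xs : List (ℕ × List (List (ℕ × List ℕ)))) :
    (gameEdges n s xs).length ≤ (xs.flatMap stateCode).length := by
  induction xs generalizing s with
  | nil => simp [gameEdges]
  | cons x xs ih =>
    have := ih (s + 1)
    have h := length_stateEdges_le n s s x.2
    simp only [gameEdges, List.flatMap_cons, List.length_append, stateCode, List.length_cons] at *
    omega

end RAM

/-! ### From the game to the tables and back -/

namespace ConcurrentGame

open RAM

variable {S : Type u} {A : Type v} {G : ConcurrentGame S A} [Fintype S]

theorem ncard_succ_pos (G : ConcurrentGame S A) (s : S) (a b : A) : 0 < (G.succ s a b).ncard :=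
  (Set.ncard_pos).2 (G.δ s a b).support_nonempty

/-- Every state has a transition with a successor; thus costs linear in the number of states are
absorbed by |δ|. -/
theorem card_le_transitionSize (G : ConcurrentGame S A) : Fintype.card S ≤ G.transitionSize := by
  rw [transitionSize, Fintype.card_eq_sum_ones]
  refine Finset.sum_le_sum fun s _ => Nat.succ_le_of_lt ?_
  exact Finset.sum_pos (fun a _ => Finset.sum_pos (fun b _ => G.ncard_succ_pos s a b)
        (G.nonempty₂ s)) (G.nonempty₁ s)

namespace Listing

variable (L : G.Listing)

/-- The transitions from `s` for a move of player 1, as numbers. -/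
def row (s : S) (a : A) : List (ℕ × List ℕ) :=
  (L.moves₂ s).map fun b => ((G.reward s a b).toNat, (L.succs s a b).map fun t => (L.num t : ℕ))

/-- The game as a table of numbers. -/
def table : List (ℕ × List (List (ℕ × List ℕ))) :=
  (List.finRange (Fintype.card S)).map fun i =>
    ((L.moves₂ (L.num.symm i)).length,
      (L.moves₁ (L.num.symm i)).map fun a => L.row (L.num.symm i) a)

@[simp] theorem length_table : L.table.length = Fintype.card S := by
  simp [table]

theorem code_eq_table : L.code = L.table.length :: L.table.flatMap RAM.stateCode := by
  rw [code, length_table, table, List.flatMap_map]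
  congr 2
  funext i
  simp [RAM.stateCode, stateCode, row, rowCode, transitionCode, List.flatMap_map]

theorem getElem?_table {k : ℕ} {x : ℕ × List (List (ℕ × List ℕ))} :
    L.table[k]? = some x ↔ ∃ s : S, (L.num s : ℕ) = k ∧
      x = ((L.moves₂ s).length, (L.moves₁ s).map fun a => L.row s a) := by
  constructor
  · intro h
    have hk : k < Fintype.card S := by
      have := (List.getElem?_eq_some_iff.1 h).1
      simpa using this
    refine ⟨L.num.symm ⟨k, hk⟩, by simp, ?_⟩
    rw [List.getElem?_eq_some_iff] at h
    obtain ⟨_, h⟩ := h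
    rw [← h]
    simp [table]
  · rintro ⟨s, rfl, rfl⟩
    rw [List.getElem?_eq_some_iff]
    exact ⟨by simp, by simp [table]⟩

/-- The edges of the game in the tables of the machine. -/
theorem mem_gameEdges_table {e : Edge} :
    e ∈ gameEdges (Fintype.card S) 0 L.table ↔ ∃ (s : S) (i : ℕ) (a : A) (j : ℕ) (b : A),
      (L.moves₁ s)[i]? = some a ∧ (L.moves₂ s)[j]? = some b ∧
      ∃ t ∈ targets (Fintype.card S) (G.reward s a b).toNat
        ((L.succs s a b).map fun t => (L.num t : ℕ)),
      e = ⟨L.num s, i * Fintype.card S + L.num s, j * Fintype.card S + L.num s, t⟩ := by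
  simp only [mem_gameEdges, mem_stateEdges, mem_rowEdges, L.getElem?_table, add_zero]
  constructor
  · rintro ⟨_, _, ⟨s, rfl, rfl⟩, i, r, hr, j, x, hx, t, ht, rfl⟩
    simp only [List.getElem?_map, Option.map_eq_some_iff] at hr
    obtain ⟨a, ha, rfl⟩ := hr
    simp only [row, List.getElem?_map, Option.map_eq_some_iff] at hx
    obtain ⟨b, hb, rfl⟩ := hx
    exact ⟨s, i, a, j, b, ha, hb, t, ht, rfl⟩
  · rintro ⟨s, i, a, j, b, ha, hb, t, ht, rfl⟩
    exact ⟨_, _, ⟨s, rfl, rfl⟩, i, L.row s a, by simp [ha], j, _, by simp only [row, List.getElem?_map, hb]; rfl, t, ht, rfl⟩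

theorem mem_targets {s : S} {a b : A} {t : ℕ} :
    t ∈ targets (Fintype.card S) (G.reward s a b).toNat
      ((L.succs s a b).map fun t => (L.num t : ℕ)) ↔
    (t = Fintype.card S ∧ G.reward s a b = false) ∨ ∃ u ∈ G.succ s a b, (L.num u : ℕ) = t := by
  cases h : G.reward s a b <;> simp [targets, L.mem_succs]

theorem exists_edge {T : Arena} (hT : T.Presents L.table) (d : Edge)
    (hd : d ∈ gameEdges (Fintype.card S) 0 L.table) : ∃ e < T.E, T.src e = d.src ∧
      T.act e = d.act ∧ T.col e = d.col ∧ T.tgt e = d.tgt := by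
  rw [List.mem_iff_getElem?] at hd
  obtain ⟨e, he⟩ := hd
  have hE := hT.E
  rw [L.length_table] at hE
  refine ⟨e, ?_, hT.edge e d (by rwa [L.length_table])⟩
  rw [hE]
  exact (List.getElem?_eq_some_iff.1 he).1

theorem exists_of_lt {T : Arena} (hT : T.Presents L.table) {e : ℕ} (he : e < T.E) :
    ∃ d ∈ gameEdges (Fintype.card S) 0 L.table, T.src e = d.src ∧
      T.act e = d.act ∧ T.col e = d.col ∧ T.tgt e = d.tgt := by
  have h := hT.edge e
  have hE := hT.E
  rw [L.length_table] at hE h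
  rw [hE] at he
  exact ⟨_, List.getElem_mem he, h _ (List.getElem?_eq_getElem he)⟩

theorem cnt_num {T : Arena} (hT : T.Presents L.table) (s : S) :
    T.cnt (L.num s) = (L.moves₁ s).length := by
  rw [hT.cnt _ _ (L.getElem?_table.2 ⟨s, rfl, rfl⟩), List.length_map]

theorem length_moves₁_pos (s : S) : 0 < (L.moves₁ s).length := by
  obtain ⟨a, ha⟩ := G.nonempty₁ s
  exact List.length_pos_of_mem ((L.mem₁ s a).2 ha)

theorem length_moves₂_pos (s : S) : 0 < (L.moves₂ s).length := by
  obtain ⟨a, ha⟩ := G.nonempty₂ s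
  exact List.length_pos_of_mem ((L.mem₂ s a).2 ha)

theorem valid_of_presents {T : Arena} (hT : T.Presents L.table) : T.Valid := by
  have hn : T.n = Fintype.card S := by rw [hT.n, L.length_table]
  constructor
  · intro e he
    obtain ⟨d, hd, h1, -⟩ := L.exists_of_lt hT he
    obtain ⟨s, i, a, j, b, -, -, t, -, rfl⟩ := L.mem_gameEdges_table.1 hd
    rw [h1, hn]
    exact (L.num s).2
  · intro e he
    obtain ⟨d, hd, -, -, -, h1⟩ := L.exists_of_lt hT he
    obtain ⟨s, i, a, j, b, -, -, t, ht, rfl⟩ := L.mem_gameEdges_table.1 hd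
    rw [h1, hn]
    rcases L.mem_targets.1 ht with ⟨rfl, -⟩ | ⟨u, -, rfl⟩
    · exact le_rfl
    · exact (L.num u).2.le
  · intro e he
    obtain ⟨d, hd, h1, h2, -⟩ := L.exists_of_lt hT he
    obtain ⟨s, i, a, j, b, ha, -, t, -, rfl⟩ := L.mem_gameEdges_table.1 hd
    refine ⟨i, ?_, ?_⟩
    · rw [h1, L.cnt_num hT]
      exact (List.getElem?_eq_some_iff.1 ha).1
    · rw [h1, h2, hn]
  · intro k hk
    rw [hn] at hk
    have := L.cnt_num hT (L.num.symm ⟨k, hk⟩)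
    simp only [Equiv.apply_symm_apply] at this
    rw [this]
    exact L.length_moves₁_pos _

/-- The numbers of the states in a set. -/
def numbers (Y : Set S) : Set ℕ := {k | ∃ s ∈ Y, (L.num s : ℕ) = k}

theorem num_mem_numbers {Y : Set S} {s : S} : (L.num s : ℕ) ∈ L.numbers Y ↔ s ∈ Y := by
  constructor
  · rintro ⟨t, ht, h⟩
    rwa [← L.num.injective (Fin.ext h)]
  · exact fun h => ⟨s, h, rfl⟩

theorem card_notMem_numbers (Y : Set S) : Fintype.card S ∉ L.numbers Y := by
  rintro ⟨t, -, h⟩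
  exact (L.num t).2.ne h

/-- A column number determines the state and the move of player 2, and its edges run over all moves
of player 1, which are all allowed as X = S. The edges for missing rewards do no harm: the
additional state is not the number of a state, so they make no move bad. -/
theorem avoids_iff_notMem_Bad₂ {T : Arena} (hT : T.Presents L.table) (Y : Set S) (s : S) {j : ℕ}
    {b : A} (hb : (L.moves₂ s)[j]? = some b) :
    (∀ d < T.E, T.col d = j * Fintype.card S + L.num s → T.tgt d ∉ L.numbers Y) ↔
      b ∉ G.Bad₂ s univ Y := by
  constructor
  · rintro h ⟨_, a, ha, t, ht, htY⟩
    obtain ⟨i, hi⟩ := List.mem_iff_getElem?.1 ((L.mem₁ s a).2 ha.1)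
    obtain ⟨d, hd, h1⟩ := L.exists_edge hT _ (L.mem_gameEdges_table.2
      ⟨s, i, a, j, b, hi, hb, L.num t, L.mem_targets.2 (.inr ⟨t, ht, rfl⟩), rfl⟩)
    refine h d hd h1.2.2.1 ?_
    rw [h1.2.2.2]
    exact L.num_mem_numbers.2 htY
  · intro h d hd hcol htgt
    obtain ⟨d', hd', -, -, h3, h4⟩ := L.exists_of_lt hT hd
    obtain ⟨s', i, a, j', b', ha, hb', t, ht, rfl⟩ := L.mem_gameEdges_table.1 hd'
    rw [h3] at hcol
    obtain ⟨rfl, h5⟩ := Arena.mul_add_inj (L.num s').2 (L.num s).2 hcol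
    obtain rfl := L.num.injective (Fin.ext h5)
    obtain rfl : b' = b := by rw [hb] at hb'; exact (Option.some.inj hb').symm
    rw [h4] at htgt
    rcases L.mem_targets.1 ht with ⟨rfl, -⟩ | ⟨u, hu, rfl⟩
    · exact L.card_notMem_numbers Y htgt
    · exact h ⟨(L.mem₂ _ _).1 (List.mem_of_getElem? hb), a, ⟨(L.mem₁ _ _).1
        (List.mem_of_getElem? ha), fun _ _ => subset_univ _⟩, u, hu, L.num_mem_numbers.1 htgt⟩

/-- A good move has reward 1 against every non-bad move, so none of the edges to be checked leads to
the additional state. -/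
theorem closedOutside_numbers {T : Arena} (hT : T.Presents L.table) {Y Z : Set S}
    (hZ : Z ⊆ G.ASP univ Y Z) : T.ClosedOutside (L.numbers Y) (L.numbers Z) := by
  have hn : T.n = Fintype.card S := by rw [hT.n, L.length_table]
  rintro _ ⟨s, hs, rfl⟩
  refine ⟨by rw [hn]; exact (L.num s).2, ?_⟩
  obtain ⟨a, ha, hgood⟩ := hZ hs
  obtain ⟨i, hi⟩ := List.mem_iff_getElem?.1 ((L.mem₁ s a).2 ha.1)
  refine ⟨i, ?_, fun e he hact hav => ?_⟩
  · rw [L.cnt_num hT]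
    exact (List.getElem?_eq_some_iff.1 hi).1
  obtain ⟨d, hd, -, h2, h3, h4⟩ := L.exists_of_lt hT he
  obtain ⟨s', i', a', j, b, ha', hb, t, ht, rfl⟩ := L.mem_gameEdges_table.1 hd
  rw [h2, hn] at hact
  obtain ⟨rfl, h5⟩ := Arena.mul_add_inj (L.num s').2 (L.num s).2 hact
  obtain rfl := L.num.injective (Fin.ext h5)
  obtain rfl : a' = a := by rw [hi] at ha'; exact (Option.some.inj ha').symm
  rw [h3] at hav
  have hbad := (L.avoids_iff_notMem_Bad₂ hT Y s' hb).1 hav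
  obtain ⟨h6, h7⟩ := hgood b ⟨(L.mem₂ _ _).1 (List.mem_of_getElem? hb), hbad⟩
  rw [h4]
  rcases L.mem_targets.1 ht with ⟨-, h8⟩ | ⟨u, hu, rfl⟩
  · rw [h7] at h8
    cases h8
  · exact L.num_mem_numbers.2 (h6 hu)

/-- Conversely, a closed set consists of numbers below n, so an edge to the additional state is
impossible; this recovers the reward 1 for the good move. -/
theorem subset_ASP_of_closedOutside {T : Arena} (hT : T.Presents L.table) {Y : Set S} {Z : Set ℕ}
    (hZ : T.ClosedOutside (L.numbers Y) Z) :
    {s | (L.num s : ℕ) ∈ Z} ⊆ G.ASP univ Y {s | (L.num s : ℕ) ∈ Z} := by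
  have hn : T.n = Fintype.card S := by rw [hT.n, L.length_table]
  intro s hs
  obtain ⟨_, i, hi, hclosed⟩ := hZ _ hs
  rw [L.cnt_num hT] at hi
  have hia := List.getElem?_eq_getElem hi
  set a := (L.moves₁ s)[i] with ha
  have haΓ : a ∈ G.Γ₁ s := (L.mem₁ s a).1 (List.getElem_mem hi)
  have key : ∀ b ∈ G.Γ₂ s, b ∉ G.Bad₂ s univ Y → ∀ t ∈ targets (Fintype.card S)
      (G.reward s a b).toNat ((L.succs s a b).map fun t => (L.num t : ℕ)), t ∈ Z := by
    intro b hb hbad t ht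
    obtain ⟨j, hj⟩ := List.mem_iff_getElem?.1 ((L.mem₂ s b).2 hb)
    obtain ⟨e, he, -, h2, h3, h4⟩ := L.exists_edge hT _ (L.mem_gameEdges_table.2
      ⟨s, i, a, j, b, hia, hj, t, ht, rfl⟩)
    have := hclosed e he (by rw [h2, hn]) (by
      rw [h3]
      exact (L.avoids_iff_notMem_Bad₂ hT Y s hj).2 hbad)
    rwa [h4] at this
  refine ⟨a, ⟨haΓ, fun _ _ => subset_univ _⟩, fun b hb => ⟨fun t ht => ?_, ?_⟩⟩
  · exact key b hb.1 hb.2 _ (L.mem_targets.2 (.inr ⟨t, ht, rfl⟩))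
  · by_contra hr
    have h1 := key b hb.1 hb.2 (Fintype.card S)
      (L.mem_targets.2 (.inl ⟨rfl, by simpa using hr⟩))
    have h2 := (hZ _ h1).1
    omega

/-- Both sides are the greatest post-fixpoint, by Knaster–Tarski: closed sets and sets Z ⊆ ASP(S, Y,
Z) correspond to each other by the two preceding lemmas. -/
theorem step_numbers {T : Arena} (hT : T.Presents L.table) (Y : Set S) :
    T.step (L.numbers Y) = L.numbers (G.nuASP univ Y) := by
  have hn : T.n = Fintype.card S := by rw [hT.n, L.length_table]
  refine Subset.antisymm ?_ ?_
  · rintro k ⟨Z, hZ, hk⟩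
    have hk' := (hZ k hk).1
    rw [hn] at hk'
    have h1 := OrderHom.le_gfp (G.ASPHom univ Y) (L.subset_ASP_of_closedOutside hT hZ)
    refine ⟨L.num.symm ⟨k, hk'⟩, h1 ?_, by simp⟩
    simpa using hk
  · intro k hk
    refine ⟨_, L.closedOutside_numbers hT (Z := G.nuASP univ Y) ?_, hk⟩
    exact (OrderHom.map_gfp (G.ASPHom univ Y)).ge

theorem iterate_step {T : Arena} (hT : T.Presents L.table) (k : ℕ) :
    T.step^[k] ∅ = L.numbers ((G.nuASP univ)^[k] ∅) := by
  induction k with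
  | zero => simp [numbers]
  | succ k ih => rw [Function.iterate_succ_apply', ih, L.step_numbers hT,
      Function.iterate_succ_apply']

theorem length_transitionCode (s : S) (a b : A) :
    (L.transitionCode s a b).length = 2 + (G.succ s a b).ncard := by
  classical
  have : G.succ s a b = ((L.succs s a b).toFinset : Set S) := by
    ext t
    simp [L.mem_succs]
  rw [this, Set.ncard_coe_finset, List.toFinset_card_of_nodup (L.nodup_succs s a b)]
  simp [transitionCode]
  omega

theorem length_stateCode (s : S) : (L.stateCode s).length =
    2 + ∑ a ∈ G.Γ₁ s, ∑ b ∈ G.Γ₂ s, (2 + (G.succ s a b).ncard) := by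
  classical
  have h1 : G.Γ₁ s = (L.moves₁ s).toFinset := by
    ext a
    simp [L.mem₁]
  have h2 : G.Γ₂ s = (L.moves₂ s).toFinset := by
    ext a
    simp [L.mem₂]
  rw [h1, h2]
  simp only [List.sum_toFinset _ (L.nodup₁ s), List.sum_toFinset _ (L.nodup₂ s), stateCode,
    List.length_cons, List.length_flatMap, L.length_transitionCode]
  omega

theorem length_code_le : (L.table.flatMap RAM.stateCode).length ≤ 5 * G.transitionSize := by
  have h0 : L.code.length = 1 + (L.table.flatMap RAM.stateCode).length := by
    rw [L.code_eq_table, List.length_cons, add_comm]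
  have h1 : L.code.length = 1 + ∑ s, (L.stateCode s).length := by
    rw [code, List.length_cons, List.length_flatMap, add_comm]
    congr 1
    rw [← List.ofFn_eq_map, List.sum_ofFn]
    exact Equiv.sum_comp L.num.symm fun s => (L.stateCode s).length
  have h2 : ∑ s, (L.stateCode s).length ≤ 5 * G.transitionSize := by
    rw [transitionSize, Finset.mul_sum]
    refine Finset.sum_le_sum fun s _ => ?_
    rw [L.length_stateCode]
    -- Every transition has a successor, so its two header cells are at most twice the number of
    -- successors. The two header cells of the state account for the rest of the constant 5.
    have h3 : ∑ a ∈ G.Γ₁ s, ∑ b ∈ G.Γ₂ s, (2 + (G.succ s a b).ncard) ≤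
        3 * ∑ a ∈ G.Γ₁ s, ∑ b ∈ G.Γ₂ s, (G.succ s a b).ncard := by
      rw [Finset.mul_sum]
      refine Finset.sum_le_sum fun a _ => ?_
      rw [Finset.mul_sum]
      refine Finset.sum_le_sum fun b _ => ?_
      have := G.ncard_succ_pos s a b
      omega
    have h4 : 0 < ∑ a ∈ G.Γ₁ s, ∑ b ∈ G.Γ₂ s, (G.succ s a b).ncard :=
      Finset.sum_pos (fun a _ => Finset.sum_pos (fun b _ => G.ncard_succ_pos s a b)
        (G.nonempty₂ s)) (G.nonempty₁ s)
    omega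
  omega

/-- The program computes the fixpoint in time proportional to the product of the number of states
and the size of the transition relation. -/
theorem computesWithin_fixpointProgram [Nonempty S] : ComputesWithin fixpointProgram L G.YStar
    (30000 * (Fintype.card S * G.transitionSize)) := by
  have hrow : ∀ x ∈ L.table, 0 < x.1 ∧ ∀ row ∈ x.2, row.length = x.1 := by
    intro x hx
    obtain ⟨k, hk⟩ := List.mem_iff_getElem?.1 hx
    obtain ⟨s, -, rfl⟩ := L.getElem?_table.1 hk
    refine ⟨L.length_moves₂_pos s, fun r hr => ?_⟩
    obtain ⟨a, -, rfl⟩ := List.mem_map.1 hr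
    simp [row]
  obtain ⟨t, m, hrun, ht, T, hT, hm⟩ := does_fixpointProgram L.table (fun x hx => (hrow x hx).2)
    (fun x hx => (hrow x hx).1) fun T hT => L.valid_of_presents hT
  rw [← L.code_eq_table] at hrun
  refine ⟨t, m, hrun, ht.trans ?_, fun s => ?_⟩
  · have h1 := L.length_code_le
    have h2 := length_gameEdges_le L.table.length 0 L.table
    have h3 := G.card_le_transitionSize
    have h4 : 0 < Fintype.card S := Fintype.card_pos
    rw [L.length_table] at h2 ⊢
    set n := Fintype.card S with hn
    set D := G.transitionSize with hD
    set F := (L.table.flatMap RAM.stateCode).length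
    set E := (gameEdges n 0 L.table).length
    have h5 : D ≤ n * D := Nat.le_mul_of_pos_left _ h4
    -- Here n + 1 ≤ 2n, E ≤ 5|δ| and n ≤ |δ|, using that there is a state. The bound in all is 1000
    -- (5 + 5 + 14) n |δ|, within the stated constant.
    have h6 : (n + 1) * (E + n + 1) ≤ (n + n) * (5 * D + D + D) :=
      Nat.mul_le_mul (by omega) (by omega)
    have h7 : (n + n) * (5 * D + D + D) = 14 * (n * D) := by ring
    omega
  · rw [L.length_table] at hm
    have h := hm (L.num s) (L.num s).2
    have hY : (G.nuASP univ)^[Fintype.card S] ∅ = G.YStar := by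
      rw [← Nat.card_eq_fintype_card]
      exact OrderHom.iterate_card_eq_lfp _
    rwa [L.iterate_step hT, L.num_mem_numbers, hY] at h

end Listing

end ConcurrentGame

/-! ### The theorem -/

theorem mainTheorem4 :
    (∀ (S : Type u) (A : Type v) [Fintype S] [Fintype A] (G : ConcurrentGame S A),
      (G.YStar = G.Positive₁ (G.LimInfAvg 1) ∧
        G.YStar = G.Positive₁ (G.LimSupAvg 1) ∧
        G.YStar = ⋂ ε > (0 : ℝ), G.Positive₁ (G.LimInfAvg (1 - ε)) ∧
        G.YStar = ⋂ ε > (0 : ℝ), G.Positive₁ (G.LimSupAvg (1 - ε))) ∧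
      (G.YStarᶜ = G.Almost₂ (G.CoLimInfAvg 1) ∧
        G.YStarᶜ = G.Almost₂ (G.CoLimSupAvg 1) ∧
        G.YStarᶜ = ⋃ c > (0 : ℝ), G.Almost₂ (G.CoLimInfAvg (1 - c)) ∧
        G.YStarᶜ = ⋃ c > (0 : ℝ), G.Almost₂ (G.CoLimSupAvg (1 - c)))) ∧
    (∃ (p : RAM.Program) (C : ℕ),
      ∀ (S : Type u) (A : Type v) [Fintype S] [Nonempty S] [Fintype A]
        (G : ConcurrentGame S A) (L : G.Listing),
        ComputesWithin p L G.YStar (C * (Fintype.card S * G.transitionSize))) := by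
  exact ⟨fun S A _ _ G => G.limInf_limSup_determinacy, RAM.fixpointProgram, 30000,
    fun S A _ _ _ G L => L.computesWithin_fixpointProgram⟩
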